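/- Let $G$ be a Lie group acting smoothly from the left on a smooth manifold $M$. For $g\in G$ let $g^*$ denote the induced left action on real differential forms, i.e. pullback along $x\mapsto g^{-1}x$, so that $(g^*a)(x)=a(g^{-1}x)$ on functions and $(gh)^*=g^*h^*$. Let $(\Omega^*(M),d)$ be the de Rham complex. Let $\mathcal H(G,M)$ be the differential graded topological Hopf algebroid with base algebra $B=\Omega^*(M)$, total algebra $A=C^\infty(G;\Omega^*(M))$, source and target maps $\alpha(b)(g)=b$, $\beta(b)(g)=g^*b$, and, under the identification $A\otimes_BA\cong C^\infty(G\times G;\Omega^*(M))$, $(\varphi\otimes_B\psi)(g_1,g_2)=\varphi(g_1)\,g_1^*\psi(g_2)$, coproduct $\Delta(\varphi)(g_1,g_2)=\varphi(g_1g_2)$, counit $\varepsilon(\varphi)=\varphi(1)$ and antipode $S(\varphi)(g)=g^*\varphi(g^{-1})$. Its cyclic module has $C^0=B$ and $C^n=A^{\otimes_Bn}$ (completed tensor powers), identified with $C^\infty(G^{n};\Omega^*(M))$ through $$(a^1\otimes\cdots\otimes a^n)(g_1,\dots,g_n)=a^1(g_1)\,g_1^*a^2(g_2)\,(g_1g_2)^*a^3(g_3)\cdots(g_1\cdots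 g_{n-1})^*a^n(g_n).$$ The cofaces on $C^n$ are $\delta_0c=1\otimes c$, $\delta_i=\Delta$ applied to the $i$-th factor $(1\le i\le n)$ and $\delta_{n+1}c=c\otimes 1$ (on $C^0$: $\delta_0=\beta$, $\delta_1=\alpha$); the codegeneracy $\sigma_i$ is $\varepsilon$ applied to the $(i+1)$-st factor; and $\tau_n(a^1\otimes\cdots\otimes a^n)=(\Delta^{n-1}S(a^1))\cdot(a^2\otimes\cdots\otimes a^n\otimes1)$, $\tau_0=\mathrm{id}$. Put $b=\sum_i(-1)^i\delta_i$, $\lambda_n=(-1)^n\tau_n$, $N_n=\sum_{j=0}^n\lambda_n^j$ and $\mathbf B=N_n\,\sigma_n\,\tau_{n+1}(1-\lambda_{n+1}):C^{n+1}\to C^n$. The cyclic cohomology $HC^\bullet(\mathcal H(G,M))$ is the cohomology of the total complex of the $(b,\mathbf B)$-bicomplex together with $d$: cochains of degree $m$ are families $c^{p,q,k}\in C^\infty(G^p;\Omega^q(M))$ with $p,q,k\ge0$, $p+q+2k=m$, and the differential is $b+(-1)^pd+\mathbf B$, where $\mathbf B$ maps column $k$ to column $k+1$. Write $S:HC^m\to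 HC^{m+2}$ for the periodicity map induced by the shift $k\mapsto k+1$. The differentiable cohomology $H^\bullet(G;(\Omega^*(M),d))$ is the cohomology of the total complex of $C^\infty(G^p;\Omega^q(M))$ with the differential $\partial+(-1)^pd$, where $$(\partial c)(g_1,\dots,g_{p+1})=g_1^*c(g_2,\dots,g_{p+1})+\sum_{i=1}^p(-1)^ic(\dots,g_ig_{i+1},\dots)+(-1)^{p+1}c(g_1,\dots,g_p).$$ Let $I:HC^m(\mathcal H(G,M))\to H^m(G;(\Omega^*(M),d))$ be the map induced by the projection onto the column $k=0$. Theorem. For every $m\ge0$ there is a linear isomorphism $$HC^m(\mathcal H(G,M))\;\cong\;\bigoplus_{k\ge0}H^{m-2k}(G;(\Omega^*(M),d)),\qquad H^j=0\text{ for }j<0,$$ and these isomorphisms can be chosen such that the component $k=0$ is $I$ and that $S$ shifts the index of the summands: for $x\in HC^m$ the component of $S x\in HC^{m+2}$ with index $k+1$ is the component of $x$ with index $k$. -/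

import Mathlib

open scoped Manifold ContDiff Bundle Topology
open Bundle

namespace HopfCyclic
noncomputable section

section Alternating
variable {E F G : Type*} [NormedAddCommGroup E] [NormedSpace ℝ E] [NormedAddCommGroup F]
  [NormedSpace ℝ F] [NormedAddCommGroup G] [NormedSpace ℝ G]

/-- Alternatization, as a continuous linear map. -/
def altCLM (q : ℕ) :
    ContinuousMultilinearMap ℝ (fun _ : Fin q ↦ E) G →L[ℝ] (E [⋀^Fin q]→L[ℝ] G) :=
  LinearMap.mkContinuous
    { toFun := fun f ↦ ContinuousMultilinearMap.alternatization f
      map_add' := fun f g ↦ map_add _ f g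
      map_smul' := fun c f ↦ by
        ext v
        simp [ContinuousMultilinearMap.alternatization_apply_apply, Finset.smul_sum, smul_comm c] }
    (Nat.factorial q) (fun f ↦ by
      refine ContinuousAlternatingMap.opNorm_le_bound _ (by positivity) fun v ↦ ?_
      simp only [LinearMap.coe_mk, AddHom.coe_mk,
        ContinuousMultilinearMap.alternatization_apply_apply]
      refine (norm_sum_le _ _).trans ?_
      have : ∀ σ ∈ (Finset.univ : Finset (Equiv.Perm (Fin q))),
          ‖Equiv.Perm.sign σ • f (v ∘ σ)‖ ≤ ‖f‖ * ∏ i, ‖v i‖ := by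
        intro σ _
        have h1 : ‖Equiv.Perm.sign σ • f (v ∘ σ)‖ = ‖f (v ∘ σ)‖ := by
          rcases Int.units_eq_one_or (Equiv.Perm.sign σ) with h | h <;> simp [h]
        rw [h1]
        refine (f.le_opNorm _).trans (le_of_eq ?_)
        congr 1
        exact Equiv.prod_comp σ (fun i ↦ ‖v i‖)
      refine (Finset.sum_le_card_nsmul _ _ _ this).trans (le_of_eq ?_)
      simp [Fintype.card_perm, mul_assoc])

theorem altCLM_apply (q : ℕ) (f : ContinuousMultilinearMap ℝ (fun _ : Fin q ↦ E) G)
    (v : Fin q → E) :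
    altCLM q f v = ∑ σ : Equiv.Perm (Fin q), Equiv.Perm.sign σ • f (v ∘ σ) := by
  simp [altCLM, ContinuousMultilinearMap.alternatization_apply_apply]

theorem sum_sign_smul_comp (q : ℕ) (f : E [⋀^Fin q]→L[ℝ] G) (v : Fin q → E) :
    ∑ σ : Equiv.Perm (Fin q), Equiv.Perm.sign σ • f (v ∘ σ) = (Nat.factorial q : ℝ) • f v := by
  have h : ∀ σ : Equiv.Perm (Fin q), Equiv.Perm.sign σ • f (v ∘ σ) = f v := by
    intro σ
    have := f.toAlternatingMap.map_perm v σ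
    simp only [ContinuousAlternatingMap.coe_toAlternatingMap] at this
    rw [this, smul_smul]
    simp
  rw [Finset.sum_congr rfl (fun σ _ ↦ h σ)]
  simp [Fintype.card_perm, Nat.cast_smul_eq_nsmul]

set_option synthInstance.maxHeartbeats 200000 in
theorem contDiff_compCLM (q : ℕ) {n : ℕ∞ω} :
    ContDiff ℝ n (fun g : E →L[ℝ] F ↦
      (ContinuousAlternatingMap.compContinuousLinearMapCLM g :
        (F [⋀^Fin q]→L[ℝ] G) →L[ℝ] (E [⋀^Fin q]→L[ℝ] G))) := by
  have key : (fun g : E →L[ℝ] F ↦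
      (ContinuousAlternatingMap.compContinuousLinearMapCLM g :
        (F [⋀^Fin q]→L[ℝ] G) →L[ℝ] (E [⋀^Fin q]→L[ℝ] G))) =
      fun g ↦ (Nat.factorial q : ℝ)⁻¹ • ((altCLM q).comp
        ((ContinuousMultilinearMap.compContinuousLinearMapContinuousMultilinear ℝ
          (fun _ : Fin q ↦ E) (fun _ ↦ F) G (fun _ ↦ g)).comp
            (ContinuousAlternatingMap.toContinuousMultilinearMapCLM ℝ))) := by
    funext g
    ext f v
    have h := sum_sign_smul_comp q (f.compContinuousLinearMap g) v
    simp only [smul_apply, ContinuousLinearMap.comp_apply,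
      ContinuousAlternatingMap.smul_apply, altCLM_apply]
    have h' : ∀ σ : Equiv.Perm (Fin q),
        (((ContinuousMultilinearMap.compContinuousLinearMapContinuousMultilinear ℝ
          (fun _ : Fin q ↦ E) (fun _ ↦ F) G (fun _ ↦ g))
            (ContinuousAlternatingMap.toContinuousMultilinearMapCLM ℝ f)) (v ∘ σ)) =
          (f.compContinuousLinearMap g) (v ∘ σ) := by
      intro σ; rfl
    simp only [h', h]
    rw [smul_smul, inv_mul_cancel₀ (by positivity), one_smul]
    rfl
  rw [key]
  refine ContDiff.const_smul _ ?_
  refine contDiff_const.clm_comp (ContDiff.clm_comp ?_ contDiff_const)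
  exact (ContinuousMultilinearMap.contDiff _).comp (contDiff_pi.2 fun _ ↦ contDiff_id)

end Alternating

section BundleSmooth
variable {B EB HB : Type*} [NormedAddCommGroup EB] [NormedSpace ℝ EB] [TopologicalSpace HB]
  {IB : ModelWithCorners ℝ EB HB} [TopologicalSpace B] [ChartedSpace HB B]
  {F₁ F₂ : Type*} {E₁ E₂ : B → Type*}
  [NormedAddCommGroup F₁] [NormedSpace ℝ F₁] [NormedAddCommGroup F₂] [NormedSpace ℝ F₂]
  [∀ x, AddCommGroup (E₁ x)] [∀ x, Module ℝ (E₁ x)] [TopologicalSpace (TotalSpace F₁ E₁)]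
  [∀ x, TopologicalSpace (E₁ x)] [FiberBundle F₁ E₁] [VectorBundle ℝ F₁ E₁]
  [∀ x, AddCommGroup (E₂ x)] [∀ x, Module ℝ (E₂ x)] [TopologicalSpace (TotalSpace F₂ E₂)]
  [∀ x, TopologicalSpace (E₂ x)] [FiberBundle F₂ E₂] [VectorBundle ℝ F₂ E₂]
  [∀ x, IsTopologicalAddGroup (E₂ x)] [∀ x, ContinuousSMul ℝ (E₂ x)]

set_option synthInstance.maxHeartbeats 400000 in
set_option maxHeartbeats 800000 in
set_option linter.unusedSectionVars false in
theorem contMDiffOn_altCoordChange {n : ℕ∞ω} (q : ℕ)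
    {e₁ e₁' : Trivialization F₁ (π F₁ E₁)} {e₂ e₂' : Trivialization F₂ (π F₂ E₂)}
    [ContMDiffVectorBundle n F₁ E₁ IB] [ContMDiffVectorBundle n F₂ E₂ IB]
    [MemTrivializationAtlas e₁] [MemTrivializationAtlas e₁']
    [MemTrivializationAtlas e₂] [MemTrivializationAtlas e₂'] :
    ContMDiffOn IB 𝓘(ℝ, (F₁ [⋀^Fin q]→L[ℝ] F₂) →L[ℝ] (F₁ [⋀^Fin q]→L[ℝ] F₂)) n
      (Pretrivialization.continuousAlternatingMapCoordChange ℝ (Fin q) e₁ e₁' e₂ e₂')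
      (e₁.baseSet ∩ e₂.baseSet ∩ (e₁'.baseSet ∩ e₂'.baseSet)) := by
  simp +unfoldPartialApp only [Pretrivialization.continuousAlternatingMapCoordChange,
    ContinuousLinearEquiv.coe_continuousAlternatingMapCongr, ContinuousLinearEquiv.symm_symm]
  have h₁ := contMDiffOn_coordChangeL (IB := IB) e₁' e₁ (n := n)
  have h₂ := contMDiffOn_coordChangeL (IB := IB) e₂ e₂' (n := n)
  refine ContMDiffOn.clm_comp ?_ ?_
  · have hL : ContDiff ℝ n (fun f : F₂ →L[ℝ] F₂ ↦
        ContinuousLinearMap.compContinuousAlternatingMapCLM (ι := Fin q) ℝ F₁ F₂ F₂ f) :=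
      ContinuousLinearMap.contDiff (𝕜 := ℝ) (E := F₂ →L[ℝ] F₂)
        (F := (F₁ [⋀^Fin q]→L[ℝ] F₂) →L[ℝ] (F₁ [⋀^Fin q]→L[ℝ] F₂))
        (ContinuousLinearMap.compContinuousAlternatingMapCLM (ι := Fin q) ℝ F₁ F₂ F₂)
    exact hL.contMDiff.comp_contMDiffOn (h₂.mono (by mfld_set_tac))
  · exact (contDiff_compCLM q).contMDiff.comp_contMDiffOn (h₁.mono (by mfld_set_tac))

instance altBundle_contMDiff {n : ℕ∞ω} (q : ℕ)
    [ContMDiffVectorBundle n F₁ E₁ IB] [ContMDiffVectorBundle n F₂ E₂ IB] :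
    ContMDiffVectorBundle n (F₁ [⋀^Fin q]→L[ℝ] F₂)
      (fun x ↦ E₁ x [⋀^Fin q]→L[ℝ] E₂ x) IB := by
  have : (Bundle.ContinuousAlternatingMap.vectorPrebundle ℝ (Fin q) F₁ E₁ F₂ E₂).IsContMDiff
      IB n :=
    { exists_contMDiffCoordChange := by
        rintro _ ⟨e₁, e₂, he₁, he₂, rfl⟩ _ ⟨e₁', e₂', he₁', he₂', rfl⟩
        exact ⟨_, contMDiffOn_altCoordChange q,
          Pretrivialization.continuousAlternatingMapCoordChange_apply⟩ }
  exact (Bundle.ContinuousAlternatingMap.vectorPrebundle ℝ (Fin q) F₁ E₁ F₂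
    E₂).contMDiffVectorBundle IB

end BundleSmooth

section PiManifold
variable {E : Type*} [NormedAddCommGroup E] [NormedSpace ℝ E] {N : Type*} [TopologicalSpace N]
  [ChartedSpace E N]

/-- The model of the product manifold `N ^ n`. -/
abbrev powModel (E : Type*) [NormedAddCommGroup E] [NormedSpace ℝ E] (n : ℕ) :
    ModelWithCorners ℝ (Fin n → E) (ModelPi fun _ : Fin n ↦ E) :=
  ModelWithCorners.pi fun _ : Fin n ↦ 𝓘(ℝ, E)

instance pow_isManifold (n : ℕ) [IsManifold 𝓘(ℝ, E) ∞ N] :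
    IsManifold (powModel E n) ∞ (Fin n → N) := by
  refine isManifold_of_contDiffOn _ _ _ ?_
  rintro _ _ ⟨e, he, rfl⟩ ⟨e', he', rfl⟩
  refine contDiffOn_pi.2 fun i ↦ ?_
  have h : ContDiffOn ℝ ∞ (𝓘(ℝ, E) ∘ (e i).symm ≫ₕ e' i ∘ 𝓘(ℝ, E).symm)
      (𝓘(ℝ, E).symm ⁻¹' ((e i).symm ≫ₕ e' i).source ∩ Set.range 𝓘(ℝ, E)) :=
    (mem_groupoid_of_pregroupoid.1
      ((contDiffGroupoid ∞ 𝓘(ℝ, E)).compatible (he i trivial) (he' i trivial))).1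
  refine h.comp (contDiff_apply ℝ E i).contDiffOn ?_
  rintro x ⟨⟨hx, hx'⟩, -⟩
  exact ⟨⟨hx i trivial, hx' i trivial⟩, Set.mem_range_self _⟩

theorem contMDiff_eval (n : ℕ) (i : Fin n) {k : ℕ∞ω}:
    ContMDiff (powModel E n) 𝓘(ℝ, E) k (fun g : Fin n → N ↦ g i) := by
  intro g
  rw [contMDiffAt_iff]
  refine ⟨(continuous_apply i).continuousAt, ?_⟩
  refine ((contDiff_apply ℝ E i).contDiffWithinAt (x := _)).congr_of_eventuallyEq_of_mem ?_
    (Set.mem_range_self _)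
  filter_upwards [extChartAt_target_mem_nhdsWithin g] with x hx
  exact (chartAt E (g i)).right_inv (hx.2 i trivial)

theorem contMDiff_pow {n : ℕ} {k : ℕ∞ω} {EP HP P : Type*} [NormedAddCommGroup EP]
    [NormedSpace ℝ EP] [TopologicalSpace HP] {IP : ModelWithCorners ℝ EP HP}
    [TopologicalSpace P] [ChartedSpace HP P] {f : P → Fin n → N}
    (hf : ∀ i, ContMDiff IP 𝓘(ℝ, E) k (fun p ↦ f p i)) :
    ContMDiff IP (powModel E n) k f := by
  intro p
  rw [contMDiffAt_iff]
  refine ⟨continuousAt_pi.2 fun i ↦ (hf i p).continuousAt, ?_⟩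
  refine contDiffWithinAt_pi.2 fun i ↦ ?_
  exact (contMDiffAt_iff.1 (hf i p)).2

end PiManifold

section Forms
variable (E : Type*) [NormedAddCommGroup E] [NormedSpace ℝ E] (M : Type*) [TopologicalSpace M]
  [ChartedSpace E M] [IsManifold 𝓘(ℝ, E) ∞ M]

/-- The fibre at `x` of the bundle `Λ^q T^*M`: alternating `q`-linear forms on the tangent space. -/
abbrev FormFibre (q : ℕ) (x : M) : Type _ :=
  TangentSpace 𝓘(ℝ, E) x [⋀^Fin q]→L[ℝ] Bundle.Trivial M ℝ x

/-- The space `Ω^q(M)` of smooth differential `q`-forms on `M`. -/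
abbrev DForm (q : ℕ) : Type _ :=
  ContMDiffSection 𝓘(ℝ, E) (E [⋀^Fin q]→L[ℝ] ℝ) ∞ (FormFibre E M q)

variable {E M}
variable {EP HP P : Type*} [NormedAddCommGroup EP] [NormedSpace ℝ EP] [TopologicalSpace HP]
  {IP : ModelWithCorners ℝ EP HP} [TopologicalSpace P] [ChartedSpace HP P]
variable {EQ HQ Q : Type*} [NormedAddCommGroup EQ] [NormedSpace ℝ EQ] [TopologicalSpace HQ]
  {IQ : ModelWithCorners ℝ EQ HQ} [TopologicalSpace Q] [ChartedSpace HQ Q]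

/-- A family of (not necessarily continuous) sections of `Λ^q T^*M`, parametrised by a manifold
`P`, is smooth if it is smooth jointly in the parameter and in the point of `M`. -/
def SmoothFamily (IP : ModelWithCorners ℝ EP HP) {q : ℕ} (c : P → ∀ x : M, FormFibre E M q x) :
    Prop :=
  ContMDiff (IP.prod 𝓘(ℝ, E)) (𝓘(ℝ, E).prod 𝓘(ℝ, E [⋀^Fin q]→L[ℝ] ℝ)) ∞
    (fun y : P × M ↦ (TotalSpace.mk' (E [⋀^Fin q]→L[ℝ] ℝ) y.2 (c y.1 y.2) :
      TotalSpace (E [⋀^Fin q]→L[ℝ] ℝ) (FormFibre E M q)))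

/-- A form at `x`, read in the trivialisation of the tangent bundle around `x₀`. -/
def formCoord {q : ℕ} (x₀ x : M) : FormFibre E M q x →ₗ[ℝ] (E [⋀^Fin q]→L[ℝ] ℝ) where
  toFun η := ContinuousAlternatingMap.compContinuousLinearMap (N := ℝ) η
    ((trivializationAt E (TangentSpace 𝓘(ℝ, E)) x₀).symmL ℝ x)
  map_add' _ _ := rfl
  map_smul' _ _ := rfl

theorem formCoord_eq {q : ℕ} (x₀ : M) (v : TotalSpace (E [⋀^Fin q]→L[ℝ] ℝ) (FormFibre E M q)) :
    (trivializationAt (E [⋀^Fin q]→L[ℝ] ℝ) (FormFibre E M q) x₀ v).2 =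
      formCoord x₀ v.1 v.2 := by
  rw [FiberBundle.trivializationAt_continuousAlternatingMap_apply]
  ext w
  simp [ContinuousAlternatingMap.inCoordinates, formCoord]
  rfl

theorem smoothFamily_iff {q : ℕ} {c : P → ∀ x : M, FormFibre E M q x} :
    SmoothFamily IP c ↔ ∀ y : P × M, ContMDiffAt (IP.prod 𝓘(ℝ, E)) 𝓘(ℝ, E [⋀^Fin q]→L[ℝ] ℝ) ∞
      (fun z : P × M ↦ formCoord y.2 z.2 (c z.1 z.2)) y := by
  refine forall_congr' fun y ↦ ?_
  rw [contMDiffAt_totalSpace]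
  simp only [formCoord_eq]
  exact and_iff_right contMDiffAt_snd

theorem SmoothFamily.formCoord_at {q : ℕ} {c : P → ∀ x : M, FormFibre E M q x}
    (hc : SmoothFamily IP c) (x₀ : M) (y : P × M) (hy : y.2 ∈ (chartAt E x₀).source) :
    ContMDiffAt (IP.prod 𝓘(ℝ, E)) 𝓘(ℝ, E [⋀^Fin q]→L[ℝ] ℝ) ∞
      (fun z : P × M ↦ formCoord x₀ z.2 (c z.1 z.2)) y := by
  have h := ((trivializationAt (E [⋀^Fin q]→L[ℝ] ℝ) (FormFibre E M q) x₀).contMDiffAt_iff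
    (IB := 𝓘(ℝ, E)) (IM := IP.prod 𝓘(ℝ, E)) (n := ∞) (x₀ := y)
    (f := fun y : P × M ↦ (TotalSpace.mk' (E [⋀^Fin q]→L[ℝ] ℝ) y.2 (c y.1 y.2) :
      TotalSpace (E [⋀^Fin q]→L[ℝ] ℝ) (FormFibre E M q))) (by
        rw [Trivialization.mem_source]
        simpa using hy)).1 (hc y)
  simpa only [formCoord_eq] using h.2

theorem SmoothFamily.add {q : ℕ} {c c' : P → ∀ x : M, FormFibre E M q x}
    (hc : SmoothFamily IP c) (hc' : SmoothFamily IP c') :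
    SmoothFamily IP (fun p x ↦ c p x + c' p x) := by
  rw [smoothFamily_iff] at *
  intro y
  simp only [map_add]
  exact (hc y).add (hc' y)

theorem SmoothFamily.smul {q : ℕ} {c : P → ∀ x : M, FormFibre E M q x} (r : ℝ)
    (hc : SmoothFamily IP c) : SmoothFamily IP (fun p x ↦ r • c p x) := by
  rw [smoothFamily_iff] at *
  intro y
  simp only [map_smul]
  exact (contDiff_const_smul r).contMDiff.contMDiffAt.comp y (hc y)

theorem SmoothFamily.zero {q : ℕ} :
    SmoothFamily IP (fun (_ : P) (x : M) ↦ (0 : FormFibre E M q x)) := by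
  rw [smoothFamily_iff]
  intro y
  simp only [map_zero]
  exact contMDiffAt_const

theorem SmoothFamily.section {q : ℕ} {c : P → ∀ x : M, FormFibre E M q x}
    (hc : SmoothFamily IP c) (p : P) :
    ContMDiff 𝓘(ℝ, E) (𝓘(ℝ, E).prod 𝓘(ℝ, E [⋀^Fin q]→L[ℝ] ℝ)) ∞
      (fun x : M ↦ (TotalSpace.mk' (E [⋀^Fin q]→L[ℝ] ℝ) x (c p x) :
        TotalSpace (E [⋀^Fin q]→L[ℝ] ℝ) (FormFibre E M q))) :=
  ContMDiff.comp (I' := IP.prod 𝓘(ℝ, E)) hc (contMDiff_const.prodMk contMDiff_id)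

theorem SmoothFamily.pullback [IsManifold IQ ∞ Q] {q : ℕ} {c : P → ∀ x : M, FormFibre E M q x}
    (hc : SmoothFamily IP c) {F : Q → P} (hF : ContMDiff IQ IP ∞ F) {a : Q → M → M}
    (ha : ContMDiff (IQ.prod 𝓘(ℝ, E)) 𝓘(ℝ, E) ∞ (fun y : Q × M ↦ a y.1 y.2)) :
    SmoothFamily IQ (fun s x ↦ ((c (F s) (a s x)).compContinuousLinearMap
      (mfderiv 𝓘(ℝ, E) 𝓘(ℝ, E) (a s) x) : FormFibre E M q x)) := by
  rw [smoothFamily_iff]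
  intro y
  have h1 : ContMDiffAt (IQ.prod 𝓘(ℝ, E)) 𝓘(ℝ, E [⋀^Fin q]→L[ℝ] ℝ) ∞
      (fun z : Q × M ↦ formCoord (a y.1 y.2) (a z.1 z.2) (c (F z.1) (a z.1 z.2))) y :=
    ContMDiffAt.comp (I' := IP.prod 𝓘(ℝ, E)) y
      (hc.formCoord_at (a y.1 y.2) (F y.1, a y.1 y.2) (mem_chart_source E _))
      (((hF.comp contMDiff_fst).prodMk ha) y)
  have h2 : ContMDiffAt (IQ.prod 𝓘(ℝ, E)) 𝓘(ℝ, E →L[ℝ] E) ∞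
      (inTangentCoordinates 𝓘(ℝ, E) 𝓘(ℝ, E) (fun z : Q × M ↦ z.2) (fun z ↦ a z.1 z.2)
        (fun z ↦ mfderiv 𝓘(ℝ, E) 𝓘(ℝ, E) (a z.1) z.2) y) y := by
    refine ContMDiffAt.mfderiv (n := ∞) (fun (z : Q × M) (x : M) ↦ a z.1 x) Prod.snd ?_
      contMDiffAt_snd (by simp)
    exact (ha.comp ((contMDiff_fst.comp contMDiff_fst).prodMk contMDiff_snd)) _
  have h3 := ((contDiff_compCLM (E := E) (F := E) (G := ℝ) q (n := ∞)).contMDiff.contMDiffAt.comp y h2).clm_apply h1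
  refine h3.congr_of_eventuallyEq ?_
  have hn : ∀ᶠ z : Q × M in 𝓝 y, a z.1 z.2 ∈ (chartAt E (a y.1 y.2)).source :=
    ha.continuous.continuousAt.preimage_mem_nhds
      ((chartAt E (a y.1 y.2)).open_source.mem_nhds (mem_chart_source E _))
  filter_upwards [hn] with z hz
  ext w
  change c (F z.1) (a z.1 z.2) _ = c (F z.1) (a z.1 z.2) _
  congr 1
  funext i
  exact (Trivialization.symmL_continuousLinearMapAt
    (trivializationAt E (TangentSpace 𝓘(ℝ, E)) (a y.1 y.2)) (R := ℝ) (b := a z.1 z.2)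
    (by simpa using hz) _).symm

end Forms

section ExteriorDerivative
variable {E : Type*} [NormedAddCommGroup E] [NormedSpace ℝ E] {M : Type*} [TopologicalSpace M]
  [ChartedSpace E M] [IsManifold 𝓘(ℝ, E) ∞ M]
variable {EP HP P : Type*} [NormedAddCommGroup EP] [NormedSpace ℝ EP] [TopologicalSpace HP]
  {IP : ModelWithCorners ℝ EP HP} [TopologicalSpace P] [ChartedSpace HP P]

/-- The local representative of `η` in the preferred chart `φ` at `x₀`: the pullback of `η` along
`φ⁻¹`. -/
def formInChart {q : ℕ} (x₀ : M) (η : ∀ x : M, FormFibre E M q x) (z : E) :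
    E [⋀^Fin q]→L[ℝ] ℝ :=
  ContinuousAlternatingMap.compContinuousLinearMap (N := ℝ)
    (η ((extChartAt 𝓘(ℝ, E) x₀).symm z))
    (mfderiv 𝓘(ℝ, E) 𝓘(ℝ, E) (extChartAt 𝓘(ℝ, E) x₀).symm z)

/-- The exterior derivative of `η` at `x`: the pullback along the preferred chart at `x` of the
exterior derivative of the local representative. -/
def extD {q : ℕ} (η : ∀ x : M, FormFibre E M q x) (x : M) : FormFibre E M (q + 1) x :=
  ContinuousAlternatingMap.compContinuousLinearMap (N := ℝ)
    (extDeriv (formInChart x η) (extChartAt 𝓘(ℝ, E) x x))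
    (mfderiv 𝓘(ℝ, E) 𝓘(ℝ, E) (extChartAt 𝓘(ℝ, E) x) x)

theorem formInChart_eq {q : ℕ} (x₀ : M) (η : ∀ x : M, FormFibre E M q x) {z : E}
    (hz : z ∈ (extChartAt 𝓘(ℝ, E) x₀).target) :
    formInChart x₀ η z = formCoord x₀ _ (η ((extChartAt 𝓘(ℝ, E) x₀).symm z)) := by
  have h := TangentBundle.symmL_trivializationAt (I := 𝓘(ℝ, E)) (x₀ := x₀)
    (x := (extChartAt 𝓘(ℝ, E) x₀).symm z)
    (by simpa [extChartAt_source] using (extChartAt 𝓘(ℝ, E) x₀).map_target hz)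
  rw [(extChartAt 𝓘(ℝ, E) x₀).right_inv hz] at h
  simp only [modelWithCornersSelf_coe, Set.range_id, mfderivWithin_univ] at h
  exact congrArg (fun L : E →L[ℝ] TangentSpace 𝓘(ℝ, E) ((extChartAt 𝓘(ℝ, E) x₀).symm z) ↦
    ContinuousAlternatingMap.compContinuousLinearMap (N := ℝ) (η _) L) h.symm

theorem SmoothFamily.formInChart_at {q : ℕ} {c : P → ∀ x : M, FormFibre E M q x}
    (hc : SmoothFamily IP c) (x₀ : M) (p : P) {z : E}
    (hz : z ∈ (extChartAt 𝓘(ℝ, E) x₀).target) :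
    ContMDiffAt (IP.prod 𝓘(ℝ, E)) 𝓘(ℝ, E [⋀^Fin q]→L[ℝ] ℝ) ∞
      (fun y : P × E ↦ formInChart x₀ (c y.1) y.2) (p, z) := by
  have hs := (contMDiffOn_extChartAt_symm (I := 𝓘(ℝ, E)) (n := ∞) x₀).contMDiffAt
    ((isOpen_extChartAt_target x₀).mem_nhds hz)
  have h1 : ContMDiffAt (IP.prod 𝓘(ℝ, E)) 𝓘(ℝ, E [⋀^Fin q]→L[ℝ] ℝ) ∞
      (fun y : P × E ↦ formCoord x₀ ((extChartAt 𝓘(ℝ, E) x₀).symm y.2)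
        (c y.1 ((extChartAt 𝓘(ℝ, E) x₀).symm y.2))) (p, z) := by
    refine ContMDiffAt.comp (I' := IP.prod 𝓘(ℝ, E)) (p, z)
      (hc.formCoord_at x₀ (p, (extChartAt 𝓘(ℝ, E) x₀).symm z) ?_)
      (contMDiffAt_fst.prodMk (hs.comp (p, z) contMDiffAt_snd))
    simpa [extChartAt_source] using (extChartAt 𝓘(ℝ, E) x₀).map_target hz
  refine h1.congr_of_eventuallyEq ?_
  have : ∀ᶠ y : P × E in 𝓝 (p, z), y.2 ∈ (extChartAt 𝓘(ℝ, E) x₀).target :=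
    continuousAt_snd.preimage_mem_nhds ((isOpen_extChartAt_target x₀).mem_nhds hz)
  filter_upwards [this] with y hy
  exact formInChart_eq x₀ (c y.1) hy

theorem SmoothFamily.of_section {q : ℕ} {η : ∀ x : M, FormFibre E M q x}
    (hη : ContMDiff 𝓘(ℝ, E) (𝓘(ℝ, E).prod 𝓘(ℝ, E [⋀^Fin q]→L[ℝ] ℝ)) ∞
      (fun x : M ↦ (TotalSpace.mk' (E [⋀^Fin q]→L[ℝ] ℝ) x (η x) :
        TotalSpace (E [⋀^Fin q]→L[ℝ] ℝ) (FormFibre E M q)))) :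
    SmoothFamily IP (fun _ : P ↦ η) :=
  hη.comp contMDiff_snd

theorem formInChart_contDiffAt {q : ℕ} (η : DForm E M q) (x₀ : M) {z : E}
    (hz : z ∈ (extChartAt 𝓘(ℝ, E) x₀).target) : ContDiffAt ℝ ∞ (formInChart x₀ η) z := by
  have h := (SmoothFamily.of_section (IP := 𝓘(ℝ, E)) (P := E) η.contMDiff).formInChart_at x₀ 0 hz
  rw [← contMDiffAt_iff_contDiffAt]
  exact ContMDiffAt.comp (I' := 𝓘(ℝ, E).prod 𝓘(ℝ, E)) (f := fun w : E ↦ ((0 : E), w)) z h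
    (contMDiffAt_const.prodMk contMDiffAt_id)

theorem formInChart_change {q : ℕ} (η : ∀ x : M, FormFibre E M q x) (x₀ x₁ : M) {z : E}
    (hz : z ∈ (extChartAt 𝓘(ℝ, E) x₁).target)
    (hz' : (extChartAt 𝓘(ℝ, E) x₁).symm z ∈ (extChartAt 𝓘(ℝ, E) x₀).source) :
    formInChart x₁ η z =
      (formInChart x₀ η ((extChartAt 𝓘(ℝ, E) x₀ ∘ (extChartAt 𝓘(ℝ, E) x₁).symm) z)
        ).compContinuousLinearMap
        (fderiv ℝ (extChartAt 𝓘(ℝ, E) x₀ ∘ (extChartAt 𝓘(ℝ, E) x₁).symm) z) := by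
  set φ₀ := extChartAt 𝓘(ℝ, E) x₀ with hφ₀
  set φ₁ := extChartAt 𝓘(ℝ, E) x₁ with hφ₁
  have d1 : MDifferentiableAt 𝓘(ℝ, E) 𝓘(ℝ, E) φ₁.symm z :=
    ((contMDiffOn_extChartAt_symm (I := 𝓘(ℝ, E)) (n := ∞) x₁).contMDiffAt
      ((isOpen_extChartAt_target x₁).mem_nhds hz)).mdifferentiableAt (by simp)
  have d0 : MDifferentiableAt 𝓘(ℝ, E) 𝓘(ℝ, E) φ₀ (φ₁.symm z) :=
    (contMDiffAt_extChartAt' (n := ∞) (by rwa [hφ₀, extChartAt_source] at hz')).mdifferentiableAt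
      (by simp)
  have d0s : MDifferentiableAt 𝓘(ℝ, E) 𝓘(ℝ, E) φ₀.symm (φ₀ (φ₁.symm z)) :=
    ((contMDiffOn_extChartAt_symm (I := 𝓘(ℝ, E)) (n := ∞) x₀).contMDiffAt
      ((isOpen_extChartAt_target x₀).mem_nhds (φ₀.map_source hz'))).mdifferentiableAt (by simp)
  have e1 : mfderiv 𝓘(ℝ, E) 𝓘(ℝ, E) (φ₀ ∘ φ₁.symm) z = fderiv ℝ (φ₀ ∘ φ₁.symm) z :=
    mfderiv_eq_fderiv
  have dψ : MDifferentiableAt 𝓘(ℝ, E) 𝓘(ℝ, E) (φ₀ ∘ φ₁.symm) z := d0.comp z d1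
  have ev : φ₁.symm =ᶠ[𝓝 z] φ₀.symm ∘ (φ₀ ∘ φ₁.symm) := by
    have : ∀ᶠ w in 𝓝 z, φ₁.symm w ∈ φ₀.source :=
      d1.continuousAt.preimage_mem_nhds ((isOpen_extChartAt_source x₀).mem_nhds hz')
    filter_upwards [this] with w hw
    exact (φ₀.left_inv hw).symm
  have hm : mfderiv 𝓘(ℝ, E) 𝓘(ℝ, E) φ₁.symm z =
      (mfderiv 𝓘(ℝ, E) 𝓘(ℝ, E) φ₀.symm ((φ₀ ∘ φ₁.symm) z)).comp
        (fderiv ℝ (φ₀ ∘ φ₁.symm) z) := by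
    rw [ev.mfderiv_eq, mfderiv_comp z d0s dψ, e1]
    rfl
  ext v
  have hp : φ₀.symm ((φ₀ ∘ φ₁.symm) z) = φ₁.symm z := φ₀.left_inv hz'
  let η' : M → E [⋀^Fin q]→L[ℝ] ℝ := η
  have h1 : η' (φ₁.symm z) = η' (φ₀.symm ((φ₀ ∘ φ₁.symm) z)) := by rw [hp]
  change η' (φ₁.symm z) _ = η' (φ₀.symm ((φ₀ ∘ φ₁.symm) z)) _
  rw [h1]
  refine congrArg (η' (φ₀.symm ((φ₀ ∘ φ₁.symm) z))) (funext fun i ↦ ?_)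
  exact DFunLike.congr_fun hm (v i)

theorem extD_eq {q : ℕ} (η : DForm E M q) (x₀ : M) {x : M}
    (hx : x ∈ (extChartAt 𝓘(ℝ, E) x₀).source) :
    extD η x = ContinuousAlternatingMap.compContinuousLinearMap (N := ℝ)
      (extDeriv (formInChart x₀ η) (extChartAt 𝓘(ℝ, E) x₀ x))
      (mfderiv 𝓘(ℝ, E) 𝓘(ℝ, E) (extChartAt 𝓘(ℝ, E) x₀) x) := by
  set φ₀ := extChartAt 𝓘(ℝ, E) x₀ with hφ₀
  set φ₁ := extChartAt 𝓘(ℝ, E) x with hφ₁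
  have hz : φ₁ x ∈ φ₁.target := mem_extChartAt_target (I := 𝓘(ℝ, E)) x
  have hxx : φ₁.symm (φ₁ x) = x := φ₁.left_inv (mem_extChartAt_source (I := 𝓘(ℝ, E)) x)
  have s1 : ContMDiffAt 𝓘(ℝ, E) 𝓘(ℝ, E) ∞ φ₁.symm (φ₁ x) :=
    (contMDiffOn_extChartAt_symm (I := 𝓘(ℝ, E)) (n := ∞) x).contMDiffAt
      ((isOpen_extChartAt_target x).mem_nhds hz)
  have s0 : ContMDiffAt 𝓘(ℝ, E) 𝓘(ℝ, E) ∞ φ₀ x :=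
    contMDiffAt_extChartAt' (n := ∞) (by rwa [hφ₀, extChartAt_source] at hx)
  have sψ : ContDiffAt ℝ ∞ (φ₀ ∘ φ₁.symm) (φ₁ x) := by
    rw [← contMDiffAt_iff_contDiffAt]
    exact ContMDiffAt.comp (φ₁ x) (by rw [hxx]; exact s0) s1
  have hψ : (φ₀ ∘ φ₁.symm) (φ₁ x) = φ₀ x := by simp [hxx]
  have ev : formInChart x η =ᶠ[𝓝 (φ₁ x)] fun z ↦ (formInChart x₀ η ((φ₀ ∘ φ₁.symm) z)
      ).compContinuousLinearMap (fderiv ℝ (φ₀ ∘ φ₁.symm) z) := by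
    have h1 : ∀ᶠ z in 𝓝 (φ₁ x), φ₁.symm z ∈ φ₀.source :=
      s1.continuousAt.preimage_mem_nhds
        ((isOpen_extChartAt_source x₀).mem_nhds (by rw [hxx]; exact hx))
    filter_upwards [h1, (isOpen_extChartAt_target x).mem_nhds hz] with z hz1 hz2
    exact formInChart_change η x₀ x hz2 hz1
  have hd := ev.extDeriv_eq
  rw [extDeriv_pullback (r := ∞) (by
    rw [hψ]
    exact (formInChart_contDiffAt η x₀ (φ₀.map_source hx)).differentiableAt (by simp)) sψ
    (by rw [minSmoothness_of_isRCLikeNormedField]; exact ENat.LEInfty.out), hψ] at hd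
  have evφ : φ₀ =ᶠ[𝓝 x] (φ₀ ∘ φ₁.symm) ∘ φ₁ := by
    filter_upwards [extChartAt_source_mem_nhds (I := 𝓘(ℝ, E)) x] with w hw
    simp [φ₁.left_inv hw]
  have hm : mfderiv 𝓘(ℝ, E) 𝓘(ℝ, E) φ₀ x = (fderiv ℝ (φ₀ ∘ φ₁.symm) (φ₁ x)).comp
      (mfderiv 𝓘(ℝ, E) 𝓘(ℝ, E) φ₁ x) := by
    rw [evφ.mfderiv_eq, mfderiv_comp x (sψ.differentiableAt (by simp)).mdifferentiableAt
      ((contMDiffAt_extChartAt (n := ∞)).mdifferentiableAt (by simp)), mfderiv_eq_fderiv]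
    rfl
  ext v
  change extDeriv (formInChart x η) (φ₁ x) _ = extDeriv (formInChart x₀ η) (φ₀ x) _
  rw [hd]
  refine congrArg (extDeriv (formInChart x₀ η) (φ₀ x)) (funext fun i ↦ ?_)
  exact (DFunLike.congr_fun hm (v i)).symm

theorem extD_add {q : ℕ} (η η' : DForm E M q) : extD (η + η' : DForm E M q) =
    fun x ↦ extD η x + extD η' x := by
  funext x
  have h : formInChart x (η + η' : DForm E M q) = formInChart x η + formInChart x η' := rfl
  have hz := mem_extChartAt_target (I := 𝓘(ℝ, E)) x
  unfold extD
  rw [h, extDeriv_add ((formInChart_contDiffAt η x hz).differentiableAt (by simp))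
    ((formInChart_contDiffAt η' x hz).differentiableAt (by simp))]
  rfl

theorem extD_smul {q : ℕ} (r : ℝ) (η : DForm E M q) : extD (r • η : DForm E M q) =
    fun x ↦ r • extD η x := by
  funext x
  have h : formInChart x (r • η : DForm E M q) = r • formInChart x η := rfl
  unfold extD
  rw [h, extDeriv_smul]
  rfl

theorem SmoothFamily.extD [IsManifold IP ∞ P] {q : ℕ} {c : P → DForm E M q}
    (hc : SmoothFamily IP (fun p ↦ c p)) : SmoothFamily IP (fun p ↦ extD (c p)) := by
  rw [smoothFamily_iff]
  intro y
  set φ := extChartAt 𝓘(ℝ, E) y.2 with hφ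
  have h1 : ContMDiffAt (IP.prod 𝓘(ℝ, E)) 𝓘(ℝ, E →L[ℝ] (E [⋀^Fin q]→L[ℝ] ℝ)) ∞
      (inTangentCoordinates 𝓘(ℝ, E) 𝓘(ℝ, E [⋀^Fin q]→L[ℝ] ℝ) (fun z : P × M ↦ φ z.2)
        (fun z ↦ formInChart y.2 (c z.1) (φ z.2))
        (fun z ↦ mfderiv 𝓘(ℝ, E) 𝓘(ℝ, E [⋀^Fin q]→L[ℝ] ℝ) (formInChart y.2 (c z.1)) (φ z.2)) y)
      y := by
    refine ContMDiffAt.mfderiv (n := ∞) (fun (z : P × M) (x : E) ↦ formInChart y.2 (c z.1) x)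
      (fun z : P × M ↦ φ z.2) ?_
      (ContMDiffAt.comp (I' := 𝓘(ℝ, E)) y (contMDiffAt_extChartAt (n := ∞)) contMDiffAt_snd)
      (by simp)
    exact ContMDiffAt.comp (I' := IP.prod 𝓘(ℝ, E)) (y, φ y.2)
      (hc.formInChart_at y.2 y.1 (mem_extChartAt_target (I := 𝓘(ℝ, E)) y.2))
      (ContMDiff.contMDiffAt (ContMDiff.prodMk
        (ContMDiff.comp (I' := IP.prod 𝓘(ℝ, E)) contMDiff_fst contMDiff_fst) contMDiff_snd))
  have h1 : ContMDiffAt (IP.prod 𝓘(ℝ, E)) 𝓘(ℝ, E →L[ℝ] (E [⋀^Fin q]→L[ℝ] ℝ)) ∞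
      (fun z : P × M ↦ fderiv ℝ (formInChart y.2 (c z.1)) (φ z.2)) y := by
    refine h1.congr_of_eventuallyEq (Filter.Eventually.of_forall fun z ↦ ?_)
    refine Eq.trans ?_ (congrFun (inTangentCoordinates_model_space _ _ _ _) z).symm
    exact mfderiv_eq_fderiv.symm
  have h2 := (ContinuousAlternatingMap.alternatizeUncurryFinCLM ℝ E ℝ
    (n := q)).contMDiff.contMDiffAt.comp y h1
  refine h2.congr_of_eventuallyEq ?_
  have hn : ∀ᶠ z : P × M in 𝓝 y, z.2 ∈ φ.source :=
    continuousAt_snd.preimage_mem_nhds (extChartAt_source_mem_nhds (I := 𝓘(ℝ, E)) y.2)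
  filter_upwards [hn] with z hz
  rw [extD_eq (c z.1) y.2 hz]
  have hz' : z.2 ∈ (chartAt E y.2).source := by rwa [hφ, extChartAt_source] at hz
  have hT := TangentBundle.continuousLinearMapAt_trivializationAt (I := 𝓘(ℝ, E)) hz'
  ext w
  change (extDeriv (formInChart y.2 (c z.1)) (φ z.2)) _ =
    (extDeriv (formInChart y.2 (c z.1)) (φ z.2)) w
  refine congrArg _ (funext fun i ↦ ?_)
  have h3 := Trivialization.continuousLinearMapAt_symmL
    (trivializationAt E (TangentSpace 𝓘(ℝ, E)) y.2) (R := ℝ) (b := z.2) (by simpa using hz') (w i)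
  rw [hT] at h3
  exact h3

/-- The de Rham differential `d : Ω^q(M) → Ω^{q+1}(M)`. -/
def dForm (q : ℕ) : DForm E M q →ₗ[ℝ] DForm E M (q + 1) where
  toFun η := ⟨extD η, ((SmoothFamily.of_section (IP := 𝓘(ℝ, E)) (P := E)
    η.contMDiff).extD (c := fun _ ↦ η)).section 0⟩
  map_add' η η' := by
    ext x : 1
    exact congrFun (extD_add η η') x
  map_smul' r η := by
    ext x : 1
    exact congrFun (extD_smul r η) x

end ExteriorDerivative

section Wedge
variable {E : Type*} [NormedAddCommGroup E] [NormedSpace ℝ E]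

/-- The exterior product of an `i`-form `a` and a `j`-form `b`, with `q = i + j`:
`(a ∧ b)(v) = (1 / (i! j!)) ∑_σ sgn(σ) a(v_σ(1), …, v_σ(i)) b(v_σ(i+1), …, v_σ(q))`. -/
def wedge {i j q : ℕ} (h : i + j = q) (a : E [⋀^Fin i]→L[ℝ] ℝ) (b : E [⋀^Fin j]→L[ℝ] ℝ) :
    E [⋀^Fin q]→L[ℝ] ℝ :=
  ((Nat.factorial i * Nat.factorial j : ℝ)⁻¹) • altCLM q
    ((a.toContinuousMultilinearMap.smulRight
      b.toContinuousMultilinearMap).uncurrySum.domDomCongr (finSumFinEquiv.trans (finCongr h)))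

theorem wedge_apply {i j q : ℕ} (h : i + j = q) (a : E [⋀^Fin i]→L[ℝ] ℝ)
    (b : E [⋀^Fin j]→L[ℝ] ℝ) (v : Fin q → E) :
    wedge h a b v = ((Nat.factorial i * Nat.factorial j : ℝ)⁻¹) *
      ∑ σ : Equiv.Perm (Fin q), Equiv.Perm.sign σ •
        (a (fun s ↦ v (σ (Fin.cast h (Fin.castAdd j s)))) *
          b (fun s ↦ v (σ (Fin.cast h (Fin.natAdd i s))))) := by
  simp only [wedge, ContinuousAlternatingMap.smul_apply, altCLM_apply, smul_eq_mul]
  rfl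

theorem wedge_comp {i j q : ℕ} (h : i + j = q) (a : E [⋀^Fin i]→L[ℝ] ℝ)
    (b : E [⋀^Fin j]→L[ℝ] ℝ) (L : E →L[ℝ] E) :
    (wedge h a b).compContinuousLinearMap L =
      wedge h (a.compContinuousLinearMap L) (b.compContinuousLinearMap L) := by
  ext v
  simp only [ContinuousAlternatingMap.compContinuousLinearMap_apply, wedge_apply]
  rfl

theorem wedge_add_left {i j q : ℕ} (h : i + j = q) (a a' : E [⋀^Fin i]→L[ℝ] ℝ)
    (b : E [⋀^Fin j]→L[ℝ] ℝ) : wedge h (a + a') b = wedge h a b + wedge h a' b := by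
  ext v
  simp [wedge_apply, add_mul, mul_add, Finset.sum_add_distrib]

theorem contDiff_wedge {i j q : ℕ} (h : i + j = q) {n : ℕ∞ω} :
    ContDiff ℝ n (fun y : (E [⋀^Fin i]→L[ℝ] ℝ) × (E [⋀^Fin j]→L[ℝ] ℝ) ↦ wedge h y.1 y.2) := by
  have hb : IsBoundedBilinearMap ℝ
      (fun y : (E [⋀^Fin i]→L[ℝ] ℝ) × (E [⋀^Fin j]→L[ℝ] ℝ) ↦ wedge h y.1 y.2) :=
    { add_left := fun a a' b ↦ wedge_add_left h a a' b
      smul_left := fun r a b ↦ by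
        ext v
        simp only [wedge_apply, ContinuousAlternatingMap.smul_apply, smul_eq_mul, Units.smul_def,
          zsmul_eq_mul, Finset.mul_sum]
        exact Finset.sum_congr rfl fun σ _ ↦ by ring
      add_right := fun a b b' ↦ by
        ext v
        simp [wedge_apply, mul_add, Finset.sum_add_distrib]
      smul_right := fun r a b ↦ by
        ext v
        simp only [wedge_apply, ContinuousAlternatingMap.smul_apply, smul_eq_mul, Units.smul_def,
          zsmul_eq_mul, Finset.mul_sum]
        exact Finset.sum_congr rfl fun σ _ ↦ by ring
      bound := by
        refine ⟨(Nat.factorial i * Nat.factorial j : ℝ)⁻¹ * Nat.factorial q + 1, by positivity,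
          fun a b ↦ ?_⟩
        refine ContinuousAlternatingMap.opNorm_le_bound _ (by positivity) fun v ↦ ?_
        rw [wedge_apply, norm_mul, norm_inv]
        have hσ : ∀ σ ∈ (Finset.univ : Finset (Equiv.Perm (Fin q))),
            ‖Equiv.Perm.sign σ • (a (fun s ↦ v (σ (Fin.cast h (Fin.castAdd j s)))) *
              b (fun s ↦ v (σ (Fin.cast h (Fin.natAdd i s)))))‖ ≤ ‖a‖ * ‖b‖ * ∏ s, ‖v s‖ := by
          intro σ _
          have h1 : ∀ t : ℝ, ‖Equiv.Perm.sign σ • t‖ = ‖t‖ := fun t ↦ by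
            rcases Int.units_eq_one_or (Equiv.Perm.sign σ) with h | h <;> simp [h]
          rw [h1, norm_mul]
          have h2 := mul_le_mul (a.le_opNorm (fun s ↦ v (σ (Fin.cast h (Fin.castAdd j s)))))
            (b.le_opNorm (fun s ↦ v (σ (Fin.cast h (Fin.natAdd i s))))) (norm_nonneg _)
            (by positivity)
          refine h2.trans (le_of_eq ?_)
          have h3 : (∏ s, ‖v (σ (Fin.cast h (Fin.castAdd j s)))‖) *
              (∏ s, ‖v (σ (Fin.cast h (Fin.natAdd i s)))‖) = ∏ s, ‖v s‖ := by
            subst h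
            rw [← Equiv.prod_comp σ (fun s ↦ ‖v s‖), Fin.prod_univ_add]
            rfl
          rw [← h3]
          ring
        have h4 := (norm_sum_le _ _).trans (Finset.sum_le_card_nsmul _ _ _ hσ)
        simp only [Finset.card_univ, Fintype.card_perm, Fintype.card_fin, nsmul_eq_mul] at h4
        have h5 : ‖(Nat.factorial i * Nat.factorial j : ℝ)‖⁻¹ =
            (Nat.factorial i * Nat.factorial j : ℝ)⁻¹ := by
          rw [Real.norm_of_nonneg (by positivity)]
        rw [h5]
        refine (mul_le_mul_of_nonneg_left h4 (by positivity)).trans ?_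
        have h6 : 0 ≤ ‖a‖ * ‖b‖ * ∏ s, ‖v s‖ := by positivity
        nlinarith [h6] }
  exact hb.contDiff

theorem one_wedge {i j : ℕ} (h : i + j = j) (a : E [⋀^Fin i]→L[ℝ] ℝ)
    (b : E [⋀^Fin j]→L[ℝ] ℝ) (ha : ∀ v, a v = 1) : wedge h a b = b := by
  obtain rfl : i = 0 := by omega
  ext v
  rw [wedge_apply]
  simp only [ha, one_mul, Nat.factorial_zero, Nat.cast_one]
  have h2 : ∀ σ : Equiv.Perm (Fin j), (fun s ↦ v (σ (Fin.cast h (Fin.natAdd 0 s)))) = v ∘ σ := by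
    intro σ
    funext s
    simp only [Function.comp_apply]
    congr 2
    ext
    simp
  simp only [h2]
  rw [sum_sign_smul_comp, smul_eq_mul, ← mul_assoc, inv_mul_cancel₀ (by positivity), one_mul]

theorem zero_wedge {i j q : ℕ} (h : i + j = q) (b : E [⋀^Fin j]→L[ℝ] ℝ) :
    wedge h (0 : E [⋀^Fin i]→L[ℝ] ℝ) b = 0 := by
  ext v
  simp [wedge_apply]

end Wedge

section WedgeForms
variable {E : Type*} [NormedAddCommGroup E] [NormedSpace ℝ E] {M : Type*} [TopologicalSpace M]
  [ChartedSpace E M] [IsManifold 𝓘(ℝ, E) ∞ M]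
variable {EP HP P : Type*} [NormedAddCommGroup EP] [NormedSpace ℝ EP] [TopologicalSpace HP]
  {IP : ModelWithCorners ℝ EP HP} [TopologicalSpace P] [ChartedSpace HP P]

theorem SmoothFamily.wedge {i j q : ℕ} (h : i + j = q) {c : P → ∀ x : M, FormFibre E M i x}
    {c' : P → ∀ x : M, FormFibre E M j x} (hc : SmoothFamily IP c) (hc' : SmoothFamily IP c') :
    SmoothFamily IP (fun p x ↦ (wedge (E := E) h (c p x) (c' p x) : FormFibre E M q x)) := by
  rw [smoothFamily_iff] at hc hc'
  refine smoothFamily_iff.2 fun y ↦ ?_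
  have h1 := (contDiff_wedge (E := E) h (n := ∞)).contMDiff.contMDiffAt.comp y
    ((hc y).prodMk_space (hc' y))
  refine h1.congr_of_eventuallyEq (Filter.Eventually.of_forall fun z ↦ ?_)
  exact wedge_comp (E := E) h (c z.1 z.2) (c' z.1 z.2)
    ((trivializationAt E (TangentSpace 𝓘(ℝ, E)) y.2).symmL ℝ z.2)

end WedgeForms

section Families
variable {E : Type*} [NormedAddCommGroup E] [NormedSpace ℝ E] {M : Type*} [TopologicalSpace M]
  [ChartedSpace E M] [IsManifold 𝓘(ℝ, E) ∞ M]
variable {EP HP P : Type*} [NormedAddCommGroup EP] [NormedSpace ℝ EP] [TopologicalSpace HP]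
  {IP : ModelWithCorners ℝ EP HP} [TopologicalSpace P] [ChartedSpace HP P]
variable {EQ HQ Q : Type*} [NormedAddCommGroup EQ] [NormedSpace ℝ EQ] [TopologicalSpace HQ]
  {IQ : ModelWithCorners ℝ EQ HQ} [TopologicalSpace Q] [ChartedSpace HQ Q]

variable (E M) in
/-- `C^∞(P; Ω^q(M))`, the space of smooth functions on the manifold `P` with values in `Ω^q(M)`. -/
@[ext]
structure FormFamily (IP : ModelWithCorners ℝ EP HP) (P : Type*) [TopologicalSpace P]
    [ChartedSpace HP P] (q : ℕ) where
  /-- The function. -/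
  toFun : P → DForm E M q
  /-- It is smooth. -/
  smooth : SmoothFamily IP (fun p ↦ toFun p)

instance FormFamily.instAdd {q : ℕ} : Add (FormFamily E M IP P q) :=
  ⟨fun c e ↦ ⟨fun p ↦ c.1 p + e.1 p, SmoothFamily.add c.2 e.2⟩⟩

instance FormFamily.instZero {q : ℕ} : Zero (FormFamily E M IP P q) :=
  ⟨⟨fun _ ↦ 0, SmoothFamily.zero⟩⟩

instance FormFamily.instNeg {q : ℕ} : Neg (FormFamily E M IP P q) :=
  ⟨fun c ↦ ⟨fun p ↦ -c.1 p, by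
    refine (congrArg (SmoothFamily IP) (funext fun p ↦ funext fun x ↦ ?_)).mp
      (SmoothFamily.smul (-1) c.2)
    exact neg_one_smul ℝ (c.1 p x)⟩⟩

instance FormFamily.addCommGroup {q : ℕ} : AddCommGroup (FormFamily E M IP P q) where
  nsmul := nsmulRec
  zsmul := zsmulRec
  add_assoc a b c := FormFamily.ext (funext fun p ↦ add_assoc (a.1 p) (b.1 p) (c.1 p))
  zero_add a := FormFamily.ext (funext fun p ↦ zero_add (a.1 p))
  add_zero a := FormFamily.ext (funext fun p ↦ add_zero (a.1 p))
  neg_add_cancel a := FormFamily.ext (funext fun p ↦ neg_add_cancel (a.1 p))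
  add_comm a b := FormFamily.ext (funext fun p ↦ add_comm (a.1 p) (b.1 p))

instance FormFamily.module {q : ℕ} : Module ℝ (FormFamily E M IP P q) where
  smul r c := ⟨fun p ↦ r • c.1 p, SmoothFamily.smul r c.2⟩
  one_smul a := FormFamily.ext (funext fun p ↦ one_smul ℝ (a.1 p))
  mul_smul r s a := FormFamily.ext (funext fun p ↦ mul_smul r s (a.1 p))
  smul_zero r := FormFamily.ext (funext fun _ ↦ smul_zero (A := DForm E M q) r)
  smul_add r a b := FormFamily.ext (funext fun p ↦ smul_add r (a.1 p) (b.1 p))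
  add_smul r s a := FormFamily.ext (funext fun p ↦ add_smul r s (a.1 p))
  zero_smul a := FormFamily.ext (funext fun p ↦ zero_smul ℝ (a.1 p))

/-- The pullback `a^* : Ω^q(M) → Ω^q(M)` along a smooth map `a : M → M`. -/
def formPullback (a : M → M) (ha : ContMDiff 𝓘(ℝ, E) 𝓘(ℝ, E) ∞ a) (q : ℕ) :
    DForm E M q →ₗ[ℝ] DForm E M q where
  toFun η := ⟨fun x ↦ ((η (a x)).compContinuousLinearMap (mfderiv 𝓘(ℝ, E) 𝓘(ℝ, E) a x) :
      FormFibre E M q x),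
    ((SmoothFamily.of_section (IP := 𝓘(ℝ, E)) (P := E) η.contMDiff).pullback (IQ := 𝓘(ℝ, E))
      (F := fun y : E ↦ y) contMDiff_id (a := fun _ ↦ a) (ha.comp contMDiff_snd)).section 0⟩
  map_add' _ _ := by ext x : 1; rfl
  map_smul' _ _ := by ext x : 1; rfl

/-- The exterior product `Ω^i(M) × Ω^j(M) → Ω^q(M)`, `q = i + j`. -/
def DForm.wedge {i j q : ℕ} (h : i + j = q) (η : DForm E M i) (θ : DForm E M j) : DForm E M q :=
  ⟨fun x ↦ (HopfCyclic.wedge (E := E) h (η x) (θ x) : FormFibre E M q x),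
    ((SmoothFamily.of_section (IP := 𝓘(ℝ, E)) (P := E) η.contMDiff).wedge h
      (SmoothFamily.of_section θ.contMDiff)).section 0⟩

/-- The constant function `1`, as a `0`-form. -/
def DForm.one : DForm E M 0 :=
  ⟨fun x ↦ (ContinuousAlternatingMap.constOfIsEmpty ℝ E (Fin 0) (1 : ℝ) : FormFibre E M 0 x), by
    refine SmoothFamily.section (IP := 𝓘(ℝ, E)) (P := E)
      (c := fun _ x ↦ (ContinuousAlternatingMap.constOfIsEmpty ℝ E (Fin 0) (1 : ℝ) :
        FormFibre E M 0 x)) ?_ 0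
    refine smoothFamily_iff.2 fun y ↦ ?_
    refine (contMDiffAt_const (c := ContinuousAlternatingMap.constOfIsEmpty ℝ E (Fin 0)
      (1 : ℝ))).congr_of_eventuallyEq (Filter.Eventually.of_forall fun z ↦ ?_)
    ext v
    rfl⟩

/-- The differential of a family, `(d c)(p) = d (c(p))`. -/
def dFamily [IsManifold IP ∞ P] (q : ℕ) :
    FormFamily E M IP P q →ₗ[ℝ] FormFamily E M IP P (q + 1) where
  toFun c := ⟨fun p ↦ dForm q (c.1 p), SmoothFamily.extD c.2⟩
  map_add' c c' := FormFamily.ext (funext fun p ↦ map_add (dForm q) (c.1 p) (c'.1 p))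
  map_smul' r c := FormFamily.ext (funext fun p ↦ map_smul (dForm q) r (c.1 p))

/-- Reparametrisation `c ↦ c ∘ F` of families. -/
def compFamily [IsManifold IQ ∞ Q] {F : Q → P} (hF : ContMDiff IQ IP ∞ F) (q : ℕ) :
    FormFamily E M IP P q →ₗ[ℝ] FormFamily E M IQ Q q where
  toFun c := ⟨fun s ↦ c.1 (F s), by
    exact ContMDiff.comp (I' := IP.prod 𝓘(ℝ, E)) c.2
      ((hF.comp contMDiff_fst).prodMk contMDiff_snd)⟩
  map_add' _ _ := rfl
  map_smul' _ _ := rfl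

/-- The pointwise exterior product of two families. -/
def FormFamily.wedge {i j q : ℕ} (h : i + j = q) (c : FormFamily E M IP P i)
    (e : FormFamily E M IP P j) : FormFamily E M IP P q :=
  ⟨fun p ↦ DForm.wedge h (c.1 p) (e.1 p),
    SmoothFamily.wedge (c := fun p ↦ c.1 p) (c' := fun p ↦ e.1 p) h c.2 e.2⟩

/-- The constant family. -/
def constFamily {q : ℕ} (b : DForm E M q) : FormFamily E M IP P q :=
  ⟨fun _ ↦ b, SmoothFamily.of_section b.contMDiff⟩

end Families

section Action
variable {EG : Type*} [NormedAddCommGroup EG] [NormedSpace ℝ EG] {G : Type*} [TopologicalSpace G]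
  [ChartedSpace EG G] [Group G]
  {E : Type*} [NormedAddCommGroup E] [NormedSpace ℝ E] {M : Type*} [TopologicalSpace M]
  [ChartedSpace E M] [IsManifold 𝓘(ℝ, E) ∞ M] [MulAction G M]
  [ContMDiffSMul 𝓘(ℝ, EG) 𝓘(ℝ, E) ∞ G M]
variable {EP HP P : Type*} [NormedAddCommGroup EP] [NormedSpace ℝ EP] [TopologicalSpace HP]
  {IP : ModelWithCorners ℝ EP HP} [TopologicalSpace P] [ChartedSpace HP P]
variable {EQ HQ Q : Type*} [NormedAddCommGroup EQ] [NormedSpace ℝ EQ] [TopologicalSpace HQ]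
  {IQ : ModelWithCorners ℝ EQ HQ} [TopologicalSpace Q] [ChartedSpace HQ Q]

variable (EG) in
/-- The left action `g^*` of `g ∈ G` on forms: pullback along `x ↦ g⁻¹ x`, so that on functions
`(g^* a)(x) = a(g⁻¹ x)` and `(g h)^* = g^* h^*`. -/
def act (g : G) (q : ℕ) : DForm E M q →ₗ[ℝ] DForm E M q :=
  formPullback (fun x ↦ g⁻¹ • x)
    (ContMDiffSMul.contMDiff_const_smul (I := 𝓘(ℝ, EG)) (I' := 𝓘(ℝ, E)) g⁻¹) q

/-- The operator `c ↦ (s ↦ k(s)^* c(F(s)))` on smooth families of forms, for smooth maps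
`F : Q → P` and `k : Q → G`. -/
def twistFamily [LieGroup 𝓘(ℝ, EG) ∞ G] [IsManifold IQ ∞ Q] {F : Q → P}
    (hF : ContMDiff IQ IP ∞ F) {k : Q → G} (hk : ContMDiff IQ 𝓘(ℝ, EG) ∞ k) (q : ℕ) :
    FormFamily E M IP P q →ₗ[ℝ] FormFamily E M IQ Q q where
  toFun c := ⟨fun s ↦ act EG (k s) q (c.1 (F s)), by
    refine SmoothFamily.pullback (c := fun p ↦ c.1 p) c.2 hF (a := fun s x ↦ (k s)⁻¹ • x) ?_
    exact ContMDiff.smul (I := 𝓘(ℝ, EG)) ((hk.comp contMDiff_fst).inv) contMDiff_snd⟩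
  map_add' c c' := FormFamily.ext (funext fun s ↦ map_add (act EG (k s) q) (c.1 (F s)) (c'.1 (F s)))
  map_smul' r c := FormFamily.ext (funext fun s ↦ map_smul (act EG (k s) q) r (c.1 (F s)))

end Action

section HopfAlgebroid
variable (EG : Type*) [NormedAddCommGroup EG] [NormedSpace ℝ EG] (G : Type*) [TopologicalSpace G]
  [ChartedSpace EG G] [Group G] [LieGroup 𝓘(ℝ, EG) ∞ G]
  (E : Type*) [NormedAddCommGroup E] [NormedSpace ℝ E] (M : Type*) [TopologicalSpace M]
  [ChartedSpace E M] [IsManifold 𝓘(ℝ, E) ∞ M] [MulAction G M]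
  [ContMDiffSMul 𝓘(ℝ, EG) 𝓘(ℝ, E) ∞ G M]

/-- The degree `q` part of the algebra `A = C^∞(G; Ω^*(M))` of form-valued functions on `G`. -/
abbrev AlgA (q : ℕ) : Type _ := FormFamily E M 𝓘(ℝ, EG) G q

/-- `C^n`, degree `q` part: for `n = 0` this is the algebra `B = Ω^*(M)`, and for `n ≥ 1` it is the
(completed, projective) tensor power `A ⊗_B ⋯ ⊗_B A` with `n` factors, realised as the space of
smooth `Ω^*(M)`-valued functions on `G^n`. -/
abbrev Coch (n q : ℕ) : Type _ := FormFamily E M (powModel EG n) (Fin n → G) q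

variable {EG G E M}

set_option linter.unusedSectionVars false in
theorem contMDiff_tail (n : ℕ) :
    ContMDiff (powModel EG (n + 1)) (powModel EG n) ∞ (fun g : Fin (n + 1) → G ↦ Fin.tail g) :=
  contMDiff_pow fun i ↦ contMDiff_eval (n + 1) i.succ

theorem contMDiff_contractNth (n : ℕ) (j : Fin (n + 1)) :
    ContMDiff (powModel EG (n + 1)) (powModel EG n) ∞
      (fun g : Fin (n + 1) → G ↦ Fin.contractNth j (· * ·) g) := by
  refine contMDiff_pow fun i ↦ ?_
  unfold Fin.contractNth
  split_ifs
  · exact contMDiff_eval (n + 1) _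
  · exact (contMDiff_eval (n + 1) _).mul (contMDiff_eval (n + 1) _)
  · exact contMDiff_eval (n + 1) _

set_option linter.unusedSectionVars false in
theorem contMDiff_insertOne (n : ℕ) (j : Fin (n + 1)) :
    ContMDiff (powModel EG n) (powModel EG (n + 1)) ∞
      (fun g : Fin n → G ↦ (Fin.insertNth j (1 : G) g : Fin (n + 1) → G)) := by
  refine contMDiff_pow fun i ↦ ?_
  refine Fin.succAboveCases j ?_ (fun i ↦ ?_) i
  · simpa using contMDiff_const
  · simpa using contMDiff_eval n i

theorem contMDiff_listProd (n : ℕ) :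
    ContMDiff (powModel EG n) 𝓘(ℝ, EG) ∞ (fun g : Fin n → G ↦ (List.ofFn g).prod) := by
  induction n with
  | zero => simpa using contMDiff_const
  | succ n ih =>
    simp only [List.ofFn_succ, List.prod_cons]
    exact (contMDiff_eval (n + 1) 0).mul (ih.comp (contMDiff_tail n))

/-- `(g_1, …, g_n) ↦ ((g_1 ⋯ g_n)⁻¹, g_1, …, g_{n-1})`. -/
def cycShift : (n : ℕ) → (Fin n → G) → Fin n → G
  | 0, g => g
  | _ + 1, g => Fin.cons (α := fun _ ↦ G) (List.ofFn g).prod⁻¹ (Fin.init g)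

theorem contMDiff_cycShift (n : ℕ) :
    ContMDiff (powModel EG n) (powModel EG n) ∞ (cycShift (G := G) n) := by
  refine contMDiff_pow fun i ↦ ?_
  cases n with
  | zero => exact i.elim0
  | succ n =>
    refine Fin.cases ?_ (fun i ↦ ?_) i
    · exact (contMDiff_listProd (n + 1)).inv
    · exact contMDiff_eval (n + 1) i.castSucc

/-! ### The cyclic module -/

/-- The cofaces of the cyclic module: `δ_0 c = 1 ⊗ c`, that is
`(δ_0 c)(g_1, …, g_{n+1}) = g_1^* c(g_2, …, g_{n+1})`; for `1 ≤ i ≤ n`, `δ_i` applies `Δ` to the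
`i`-th factor, that is `(δ_i c)(g_1, …, g_{n+1}) = c(…, g_i g_{i+1}, …)`; and `δ_{n+1} c = c ⊗ 1`,
that is `(δ_{n+1} c)(g_1, …, g_{n+1}) = c(g_1, …, g_n)` (`Fin.contractNth j` multiplies the entries
number `j` and `j + 1`, counted from `0`, and drops the last entry when `j = n`). -/
def coface (n q : ℕ) (i : Fin (n + 2)) : Coch EG G E M n q →ₗ[ℝ] Coch EG G E M (n + 1) q :=
  Fin.cases (twistFamily (contMDiff_tail n) (contMDiff_eval (n + 1) 0) q)
    (fun j ↦ compFamily (contMDiff_contractNth n j) q) i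

/-- The codegeneracies: `σ_i` applies `ε` to the `(i+1)`-st factor, that is
`(σ_i c)(g_1, …, g_n) = c(g_1, …, g_i, 1, g_{i+1}, …, g_n)`. -/
def codeg (n q : ℕ) (i : Fin (n + 1)) : Coch EG G E M (n + 1) q →ₗ[ℝ] Coch EG G E M n q :=
  compFamily (contMDiff_insertOne n i) q

/-- The cyclic operator: `τ_n (a^1 ⊗ ⋯ ⊗ a^n) = (Δ^{n-1} S(a^1)) (a^2 ⊗ ⋯ ⊗ a^n ⊗ 1)`, that is
`(τ_n c)(g_1, …, g_n) = (g_1 ⋯ g_n)^* c((g_1 ⋯ g_n)⁻¹, g_1, …, g_{n-1})`. -/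
def cyc (n q : ℕ) : Coch EG G E M n q →ₗ[ℝ] Coch EG G E M n q :=
  twistFamily (contMDiff_cycShift n) (contMDiff_listProd n) q

/-! ### The Hopf algebroid -/

/-- The source map `α : B → A`, `α(b)(g) = b`. -/
def srcMap (q : ℕ) (b : DForm E M q) : AlgA EG G E M q := constFamily b

/-- The target map `β : B → A`, `β(b)(g) = g^* b`. -/
def tgtMap (q : ℕ) (b : DForm E M q) : AlgA EG G E M q :=
  twistFamily (F := fun g : G ↦ g) contMDiff_id (k := fun g : G ↦ g) contMDiff_id q (srcMap q b)

/-- The coproduct `Δ : A → A ⊗_B A`, `Δ(φ)(g_1, g_2) = φ(g_1 g_2)`. -/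
def coprod (q : ℕ) : AlgA EG G E M q →ₗ[ℝ] Coch EG G E M 2 q :=
  compFamily (F := fun g : Fin 2 → G ↦ g 0 * g 1)
    ((contMDiff_eval 2 0).mul (contMDiff_eval 2 1)) q

/-- The iterated coproduct `Δ^{n-1} : A → A ⊗_B ⋯ ⊗_B A`,
`Δ^{n-1}(φ)(g_1, …, g_n) = φ(g_1 ⋯ g_n)`. -/
def iterCoprod (n q : ℕ) : AlgA EG G E M q →ₗ[ℝ] Coch EG G E M n q :=
  compFamily (contMDiff_listProd n) q

/-- The counit `ε : A → B`, `ε(φ) = φ(1)`. -/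
def counit (q : ℕ) (φ : AlgA EG G E M q) : DForm E M q := φ.1 1

/-- The antipode `S : A → A`, `S(φ)(g) = g^* φ(g⁻¹)`. -/
def antipode (q : ℕ) : AlgA EG G E M q →ₗ[ℝ] AlgA EG G E M q :=
  twistFamily (F := fun g : G ↦ g⁻¹) (contMDiff_inv 𝓘(ℝ, EG) ∞) (k := fun g : G ↦ g)
    contMDiff_id q

/-- The unit `1` of `A`. -/
def AlgA.one : AlgA EG G E M 0 := srcMap 0 DForm.one

/-- The product of `A ⊗_B ⋯ ⊗_B A` on homogeneous elements: the pointwise exterior product. -/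
def Coch.mul (n : ℕ) {i j q : ℕ} (h : i + j = q) (c : Coch EG G E M n i) (e : Coch EG G E M n j) :
    Coch EG G E M n q := FormFamily.wedge h c e

/-- The product of a homogeneous element of `B` with one of `A ⊗_B ⋯ ⊗_B A`, from the left. -/
def Coch.lmul (n : ℕ) {i j q : ℕ} (h : i + j = q) (b : DForm E M i) (e : Coch EG G E M n j) :
    Coch EG G E M n q := FormFamily.wedge h (constFamily b) e

/-- The tensor product `φ ⊗_B c` of homogeneous elements `φ ∈ A` and `c ∈ C^n`:
`(φ ⊗_B c)(g_1, …, g_{n+1}) = φ(g_1) ∧ g_1^* c(g_2, …, g_{n+1})`. -/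
def tmul (n : ℕ) {i j q : ℕ} (h : i + j = q) (φ : AlgA EG G E M i) (c : Coch EG G E M n j) :
    Coch EG G E M (n + 1) q :=
  FormFamily.wedge h
    (compFamily (IP := 𝓘(ℝ, EG)) (contMDiff_eval (N := G) (E := EG) (n + 1) 0) i φ)
    (twistFamily (contMDiff_tail n) (contMDiff_eval (E := EG) (N := G) (n + 1) 0) j c)

set_option linter.unusedSectionVars false in
theorem contMDiff_firstTwo (n : ℕ) :
    ContMDiff (powModel EG (n + 2)) (powModel EG 2) ∞
      (fun g : Fin (n + 2) → G ↦ (![g 0, g 1] : Fin 2 → G)) :=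
  contMDiff_pow fun s ↦ by
    fin_cases s
    · exact contMDiff_eval (n + 2) 0
    · exact contMDiff_eval (n + 2) 1

/-- The tensor product `e ⊗_B c` of homogeneous elements `e ∈ A ⊗_B A` and `c ∈ C^n`. -/
def tmul₂ (n : ℕ) {i j q : ℕ} (h : i + j = q) (e : Coch EG G E M 2 i) (c : Coch EG G E M n j) :
    Coch EG G E M (n + 2) q :=
  FormFamily.wedge h
    (compFamily (contMDiff_firstTwo n) i e)
    (twistFamily (F := fun g : Fin (n + 2) → G ↦ Fin.tail (Fin.tail g))
      ((contMDiff_tail n).comp (contMDiff_tail (n + 1))) (k := fun g : Fin (n + 2) → G ↦ g 0 * g 1)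
      ((contMDiff_eval (E := EG) (N := G) (n + 2) 0).mul (contMDiff_eval (n + 2) 1)) j c)

end HopfAlgebroid

section HopfFormulas
variable {EG : Type*} [NormedAddCommGroup EG] [NormedSpace ℝ EG] {G : Type*} [TopologicalSpace G]
  [ChartedSpace EG G] [Group G] [LieGroup 𝓘(ℝ, EG) ∞ G]
  {E : Type*} [NormedAddCommGroup E] [NormedSpace ℝ E] {M : Type*} [TopologicalSpace M]
  [ChartedSpace E M] [IsManifold 𝓘(ℝ, E) ∞ M] [MulAction G M]
  [ContMDiffSMul 𝓘(ℝ, EG) 𝓘(ℝ, E) ∞ G M]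

set_option linter.unusedSectionVars false in
theorem act_mul (g h : G) (q : ℕ) (η : DForm E M q) :
    act EG (g * h) q η = act EG g q (act EG h q η) := by
  have e : (fun x : M ↦ (g * h)⁻¹ • x) = (fun x ↦ h⁻¹ • x) ∘ (fun x ↦ g⁻¹ • x) := by
    funext x
    simp [mul_smul]
  have dd : ∀ (k : G) (x : M), MDifferentiableAt 𝓘(ℝ, E) 𝓘(ℝ, E) (fun x : M ↦ k • x) x :=
    fun k x ↦ (ContMDiffSMul.contMDiff_const_smul (I := 𝓘(ℝ, EG)) (I' := 𝓘(ℝ, E)) (n := ∞)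
      k).mdifferentiableAt (by simp)
  ext x : 1
  have hm : mfderiv 𝓘(ℝ, E) 𝓘(ℝ, E) (fun x : M ↦ (g * h)⁻¹ • x) x =
      (mfderiv 𝓘(ℝ, E) 𝓘(ℝ, E) (fun x : M ↦ h⁻¹ • x) (g⁻¹ • x)).comp
        (mfderiv 𝓘(ℝ, E) 𝓘(ℝ, E) (fun x : M ↦ g⁻¹ • x) x) := by
    rw [e]
    exact mfderiv_comp x (dd h⁻¹ (g⁻¹ • x)) (dd g⁻¹ x)
  have hp : (g * h)⁻¹ • x = h⁻¹ • g⁻¹ • x := by simp [mul_smul]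
  ext v
  let η' : M → E [⋀^Fin q]→L[ℝ] ℝ := η
  change η' ((g * h)⁻¹ • x) _ = η' (h⁻¹ • g⁻¹ • x) _
  rw [hp]
  refine congrArg (η' (h⁻¹ • g⁻¹ • x)) (funext fun i ↦ ?_)
  exact DFunLike.congr_fun hm (v i)

set_option linter.unusedSectionVars false in
theorem act_wedge (g : G) {i j q : ℕ} (h : i + j = q) (η : DForm E M i) (θ : DForm E M j) :
    act EG g q (DForm.wedge h η θ) = DForm.wedge h (act EG g i η) (act EG g j θ) := by
  ext x : 1
  exact wedge_comp (E := E) h (η (g⁻¹ • x)) (θ (g⁻¹ • x))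
    (mfderiv 𝓘(ℝ, E) 𝓘(ℝ, E) (fun x : M ↦ g⁻¹ • x) x)

set_option linter.unusedSectionVars false in
theorem act_one {q : ℕ} (η : DForm E M q) : act EG (1 : G) q η = η := by
  ext x : 1
  ext v
  let η' : M → E [⋀^Fin q]→L[ℝ] ℝ := η
  change η' ((1 : G)⁻¹ • x) _ = η' x _
  have hp : (1 : G)⁻¹ • x = x := by simp
  rw [hp]
  refine congrArg (η' x) (funext fun s ↦ ?_)
  have e : (fun x : M ↦ (1 : G)⁻¹ • x) = id := by
    funext x
    simp
  have hm : mfderiv 𝓘(ℝ, E) 𝓘(ℝ, E) (fun x : M ↦ (1 : G)⁻¹ • x) x =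
      mfderiv 𝓘(ℝ, E) 𝓘(ℝ, E) (id : M → M) x := by rw [e]
  rw [mfderiv_id] at hm
  exact DFunLike.congr_fun hm (v s)

theorem DForm.one_wedge {q : ℕ} (η : DForm E M q) :
    DForm.wedge (zero_add q) DForm.one η = η := by
  ext x : 1
  exact HopfCyclic.one_wedge (E := E) (zero_add q) _ (η x) fun v ↦ rfl

/-- `β(b) = δ_0 b` and `α(b) = δ_1 b` for `b ∈ C^0 = B`. -/
theorem coface_zero_apply (q : ℕ) (c : Coch EG G E M 0 q) (g : Fin 1 → G) :
    (coface 0 q 0 c).1 g = (tgtMap (EG := EG) q (c.1 ![])).1 (g 0) ∧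
      (coface 0 q 1 c).1 g = (srcMap (EG := EG) q (c.1 ![])).1 (g 0) := by
  refine ⟨?_, ?_⟩
  · change act EG (g 0) q (c.1 (Fin.tail g)) = act EG (g 0) q (c.1 ![])
    exact congrArg (fun r : Fin 0 → G ↦ act EG (g 0) q (c.1 r)) (Subsingleton.elim _ _)
  · change c.1 _ = c.1 ![]
    exact congrArg c.1 (Subsingleton.elim _ _)

/-- `δ_0 c = 1 ⊗ c`. -/
theorem coface_zero_eq (n q : ℕ) (c : Coch EG G E M n q) :
    coface n q 0 c = tmul n (zero_add q) AlgA.one c :=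
  FormFamily.ext <| funext fun g ↦ (DForm.one_wedge (act EG (g 0) q (c.1 (Fin.tail g)))).symm

theorem coface_succ_apply (n q : ℕ) (c : Coch EG G E M n q) (j : Fin (n + 1))
    (g : Fin (n + 1) → G) : (coface n q j.succ c).1 g = c.1 (Fin.contractNth j (· * ·) g) := rfl

/-- `δ_{n+1} c = c ⊗ 1`, the function `(g_1, …, g_{n+1}) ↦ c(g_1, …, g_n)`. -/
theorem coface_last_apply (n q : ℕ) (c : Coch EG G E M n q) (g : Fin (n + 1) → G) :
    (coface n q (Fin.last (n + 1)) c).1 g = c.1 (Fin.init g) := by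
  rw [← Fin.succ_last, coface_succ_apply]
  refine congrArg c.1 (funext fun i ↦ ?_)
  exact Fin.contractNth_apply_of_lt _ _ _ _ i.isLt

theorem tmul_apply (n : ℕ) {i j q : ℕ} (h : i + j = q) (φ : AlgA EG G E M i)
    (c : Coch EG G E M n j) (g : Fin (n + 1) → G) : (tmul n h φ c).1 g =
      DForm.wedge h (φ.1 (g 0)) (act EG (g 0) j (c.1 (Fin.tail g))) := rfl

set_option linter.unusedSectionVars false in
theorem codeg_apply (n q : ℕ) (c : Coch EG G E M (n + 1) q) (s : Fin (n + 1)) (g : Fin n → G) :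
    (codeg n q s c).1 g = c.1 (Fin.insertNth s (1 : G) g) := rfl

/-- `δ_1 (φ ⊗ c) = Δ(φ) ⊗ c`. -/
theorem coface_one_tmul (n : ℕ) {i j q : ℕ} (h : i + j = q) (φ : AlgA EG G E M i)
    (c : Coch EG G E M n j) :
    coface (n + 1) q 1 (tmul n h φ c) = tmul₂ n h (coprod i φ) c := by
  refine FormFamily.ext (funext fun g ↦ ?_)
  have h0 : Fin.contractNth 0 (· * ·) g 0 = g 0 * g 1 := by
    simp [Fin.contractNth]
  have ht : Fin.tail (Fin.contractNth 0 (· * ·) g) = Fin.tail (Fin.tail g) := by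
    funext s
    simp [Fin.contractNth, Fin.tail]
  change DForm.wedge h (φ.1 (Fin.contractNth 0 (· * ·) g 0))
    (act EG (Fin.contractNth 0 (· * ·) g 0) j (c.1 (Fin.tail (Fin.contractNth 0 (· * ·) g)))) =
    DForm.wedge h (φ.1 (g 0 * g 1)) (act EG (g 0 * g 1) j (c.1 (Fin.tail (Fin.tail g))))
  rw [h0, ht]

/-- `δ_{s+1} (φ ⊗ c) = φ ⊗ δ_s c` for `s ≥ 1`. -/
theorem coface_succ_tmul (n : ℕ) {i j q : ℕ} (h : i + j = q) (φ : AlgA EG G E M i)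
    (c : Coch EG G E M n j) (s : Fin (n + 1)) :
    coface (n + 1) q s.succ.succ (tmul n h φ c) = tmul (n + 1) h φ (coface n j s.succ c) := by
  refine FormFamily.ext (funext fun g ↦ ?_)
  have h0 : Fin.contractNth s.succ (· * ·) g 0 = g 0 := by
    simp [Fin.contractNth]
  have ht : Fin.tail (Fin.contractNth s.succ (· * ·) g) =
      Fin.contractNth s (· * ·) (Fin.tail g) := by
    funext r
    simp [Fin.contractNth, Fin.tail]
  change DForm.wedge h (φ.1 (Fin.contractNth s.succ (· * ·) g 0))
    (act EG (Fin.contractNth s.succ (· * ·) g 0) j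
      (c.1 (Fin.tail (Fin.contractNth s.succ (· * ·) g)))) =
    DForm.wedge h (φ.1 (g 0)) (act EG (g 0) j (c.1 (Fin.contractNth s (· * ·) (Fin.tail g))))
  rw [h0, ht]

/-- `σ_0 (φ ⊗ c) = ε(φ) c`. -/
theorem codeg_zero_tmul (n : ℕ) {i j q : ℕ} (h : i + j = q) (φ : AlgA EG G E M i)
    (c : Coch EG G E M n j) :
    codeg n q 0 (tmul n h φ c) = Coch.lmul n h (counit i φ) c := by
  refine FormFamily.ext (funext fun g ↦ ?_)
  rw [codeg_apply, tmul_apply]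
  have h0 : Fin.insertNth (α := fun _ ↦ G) 0 (1 : G) g 0 = 1 := by simp
  have ht : Fin.tail (Fin.insertNth (α := fun _ ↦ G) 0 (1 : G) g) = g := by simp
  rw [h0, ht, act_one]
  rfl

/-- `σ_{s+1} (φ ⊗ c) = φ ⊗ σ_s c`. -/
theorem codeg_succ_tmul (n : ℕ) {i j q : ℕ} (h : i + j = q) (φ : AlgA EG G E M i)
    (c : Coch EG G E M (n + 1) j) (s : Fin (n + 1)) :
    codeg (n + 1) q s.succ (tmul (n + 1) h φ c) = tmul n h φ (codeg n j s c) := by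
  refine FormFamily.ext (funext fun g ↦ ?_)
  rw [codeg_apply, tmul_apply, tmul_apply, codeg_apply]
  have h0 : Fin.insertNth (α := fun _ ↦ G) s.succ (1 : G) g 0 = g 0 := by
    have := Fin.insertNth_apply_succAbove (α := fun _ ↦ G) s.succ (1 : G) g 0
    simpa using this
  have ht : Fin.tail (Fin.insertNth (α := fun _ ↦ G) s.succ (1 : G) g) =
      Fin.insertNth (α := fun _ ↦ G) s (1 : G) (Fin.tail g) := by
    funext r
    refine Fin.succAboveCases s ?_ (fun r ↦ ?_) r
    · simp [Fin.tail]
    · have := Fin.insertNth_apply_succAbove (α := fun _ ↦ G) s.succ (1 : G) g r.succ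
      rw [Fin.succ_succAbove_succ] at this
      simpa [Fin.tail] using this
  rw [h0, ht]

/-- `τ_{n+1} (φ ⊗ c) = Δ^n(S(φ)) (c ⊗ 1)`. -/
theorem cyc_tmul (n : ℕ) {i j q : ℕ} (h : i + j = q) (φ : AlgA EG G E M i)
    (c : Coch EG G E M n j) :
    cyc (n + 1) q (tmul n h φ c) =
      Coch.mul (n + 1) h (iterCoprod (n + 1) i (antipode i φ))
        (coface n j (Fin.last (n + 1)) c) := by
  refine FormFamily.ext (funext fun g ↦ ?_)
  change act EG (List.ofFn g).prod q (DForm.wedge h (φ.1 (List.ofFn g).prod⁻¹)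
      (act EG (List.ofFn g).prod⁻¹ j (c.1 (Fin.init g)))) =
    DForm.wedge h (act EG (List.ofFn g).prod i (φ.1 (List.ofFn g).prod⁻¹))
      ((coface n j (Fin.last (n + 1)) c).1 g)
  rw [coface_last_apply, act_wedge, ← act_mul, mul_inv_cancel]
  congr 1
  exact act_one _

end HopfFormulas

section CyclicCohomology
variable {EG : Type*} [NormedAddCommGroup EG] [NormedSpace ℝ EG] {G : Type*} [TopologicalSpace G]
  [ChartedSpace EG G] [Group G] [LieGroup 𝓘(ℝ, EG) ∞ G]
  {E : Type*} [NormedAddCommGroup E] [NormedSpace ℝ E] {M : Type*} [TopologicalSpace M]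
  [ChartedSpace E M] [IsManifold 𝓘(ℝ, E) ∞ M] [MulAction G M]
  [ContMDiffSMul 𝓘(ℝ, EG) 𝓘(ℝ, E) ∞ G M]

/-! ### The `(b, B)`-bicomplex of the cyclic module -/

/-- The Hochschild coboundary `b = ∑_i (-1)^i δ_i : C^n → C^{n+1}`. -/
def hochschild (n q : ℕ) : Coch EG G E M n q →ₗ[ℝ] Coch EG G E M (n + 1) q :=
  ∑ i : Fin (n + 2), (-1 : ℝ) ^ (i : ℕ) • coface n q i

/-- The signed cyclic operator `λ = (-1)^n τ_n` on `C^n`. -/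
def cycSigned (n q : ℕ) : Coch EG G E M n q →ₗ[ℝ] Coch EG G E M n q :=
  (-1 : ℝ) ^ n • cyc n q

/-- The norm operator `N = 1 + λ + ⋯ + λ^n` on `C^n`. -/
def cycNorm (n q : ℕ) : Coch EG G E M n q →ₗ[ℝ] Coch EG G E M n q :=
  ∑ j ∈ Finset.range (n + 1), (cycSigned n q) ^ j

/-- The Connes boundary `B = N σ_n τ_{n+1} (1 - λ) : C^{n+1} → C^n`; here `σ_n τ_{n+1}` is the
extra degeneracy of the cyclic module. -/
def connesB (n q : ℕ) : Coch EG G E M (n + 1) q →ₗ[ℝ] Coch EG G E M n q :=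
  cycNorm n q ∘ₗ codeg n q (Fin.last n) ∘ₗ cyc (n + 1) q ∘ₗ
    (LinearMap.id - cycSigned (n + 1) q)

variable (EG G E M)

/-- Families of cochains `c^{p,q,k} ∈ C^p`, of form degree `q`, in the `k`-th column of the
`(b, B)`-bicomplex; `c^{p,q,k}` has total degree `p + q + 2k`. -/
abbrev Bicomplex : Type _ := ∀ p q : ℕ, ∀ _ : ℕ, Coch EG G E M p q

/-- The component `c^{p,q,k}` of `c`. -/
def bicomplexProj (p q k : ℕ) : Bicomplex EG G E M →ₗ[ℝ] Coch EG G E M p q :=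
  LinearMap.proj k ∘ₗ LinearMap.proj q ∘ₗ LinearMap.proj p

/-- The summand `b c^{p-1,q,k}` of the total differential. -/
def totalPartHochschild : (p q k : ℕ) → Bicomplex EG G E M →ₗ[ℝ] Coch EG G E M p q
  | 0, _, _ => 0
  | p + 1, q, k => hochschild p q ∘ₗ bicomplexProj EG G E M p q k

/-- The summand `(-1)^p d c^{p,q-1,k}` of the total differential. -/
def totalPartForm : (p q k : ℕ) → Bicomplex EG G E M →ₗ[ℝ] Coch EG G E M p q
  | _, 0, _ => 0
  | p, q + 1, k => (-1 : ℝ) ^ p • (dFamily q ∘ₗ bicomplexProj EG G E M p q k)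

/-- The summand `B c^{p+1,q,k-1}` of the total differential. -/
def totalPartConnes : (p q k : ℕ) → Bicomplex EG G E M →ₗ[ℝ] Coch EG G E M p q
  | _, _, 0 => 0
  | p, q, k + 1 => connesB p q ∘ₗ bicomplexProj EG G E M (p + 1) q k

/-- The total differential `b + (-1)^p d + B` of the `(b, B)`-bicomplex of the cyclic differential
graded module `C^•`. -/
def hcD : Bicomplex EG G E M →ₗ[ℝ] Bicomplex EG G E M :=
  LinearMap.pi fun p ↦ LinearMap.pi fun q ↦ LinearMap.pi fun k ↦
    totalPartHochschild EG G E M p q k + totalPartForm EG G E M p q k +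
      totalPartConnes EG G E M p q k

/-- The cochains of total degree `m`. -/
def hcCochains (m : ℕ) : Submodule ℝ (Bicomplex EG G E M) where
  carrier := {c | ∀ p q k, p + q + 2 * k ≠ m → c p q k = 0}
  add_mem' {a b} ha hb p q k h := by
    change a p q k + b p q k = 0
    rw [ha p q k h, hb p q k h, add_zero]
  zero_mem' _ _ _ _ := rfl
  smul_mem' r c hc p q k h := by
    change r • c p q k = 0
    rw [hc p q k h, smul_zero]

/-- The cocycles of degree `m`. -/
def hcCocycles (m : ℕ) : Submodule ℝ (Bicomplex EG G E M) :=
  hcCochains EG G E M m ⊓ LinearMap.ker (hcD EG G E M)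

/-- The coboundaries of degree `m`. -/
def hcCoboundaries : ℕ → Submodule ℝ (Bicomplex EG G E M)
  | 0 => ⊥
  | m + 1 => (hcCochains EG G E M m).map (hcD EG G E M)

/-- The cyclic cohomology `HC^m(H(G, M))`: the degree `m` cohomology of the total complex of the
`(b, B)`-bicomplex. -/
abbrev HC (m : ℕ) : Type _ :=
  ↥(hcCocycles EG G E M m) ⧸ (hcCoboundaries EG G E M m).submoduleOf (hcCocycles EG G E M m)

/-! ### Differentiable cohomology -/

/-- The differential of differentiable group cochains `c : G^p → Ω^q(M)`,
`(∂c)(g_1, …, g_{p+1}) = g_1^* c(g_2, …, g_{p+1}) + ∑_{i=1}^p (-1)^i c(…, g_i g_{i+1}, …) +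
(-1)^{p+1} c(g_1, …, g_p)`; the last term is the summand `j = p` of the sum. -/
def groupD (p q : ℕ) : Coch EG G E M p q →ₗ[ℝ] Coch EG G E M (p + 1) q :=
  twistFamily (contMDiff_tail p) (contMDiff_eval (E := EG) (N := G) (p + 1) 0) q +
    ∑ j : Fin (p + 1), (-1 : ℝ) ^ ((j : ℕ) + 1) • compFamily (contMDiff_contractNth p j) q

/-- Families of differentiable cochains `c^{p,q} : G^p → Ω^q(M)`, with `c^{p,q}` of total degree
`p + q`. -/
abbrev DiffCochains : Type _ := ∀ p q : ℕ, Coch EG G E M p q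

/-- The component `c^{p,q}` of `c`. -/
def diffProj (p q : ℕ) : DiffCochains EG G E M →ₗ[ℝ] Coch EG G E M p q :=
  LinearMap.proj q ∘ₗ LinearMap.proj p

/-- The summand `∂ c^{p-1,q}` of the total differential. -/
def diffPartGroup : (p q : ℕ) → DiffCochains EG G E M →ₗ[ℝ] Coch EG G E M p q
  | 0, _ => 0
  | p + 1, q => groupD EG G E M p q ∘ₗ diffProj EG G E M p q

/-- The summand `(-1)^p d c^{p,q-1}` of the total differential. -/
def diffPartForm : (p q : ℕ) → DiffCochains EG G E M →ₗ[ℝ] Coch EG G E M p q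
  | _, 0 => 0
  | p, q + 1 => (-1 : ℝ) ^ p • (dFamily q ∘ₗ diffProj EG G E M p q)

/-- The total differential `∂ + (-1)^p d`. -/
def diffD : DiffCochains EG G E M →ₗ[ℝ] DiffCochains EG G E M :=
  LinearMap.pi fun p ↦ LinearMap.pi fun q ↦ diffPartGroup EG G E M p q + diffPartForm EG G E M p q

/-- The differentiable cochains of total degree `m`. -/
def diffCochains (m : ℕ) : Submodule ℝ (DiffCochains EG G E M) where
  carrier := {c | ∀ p q, p + q ≠ m → c p q = 0}
  add_mem' {a b} ha hb p q h := by
    change a p q + b p q = 0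
    rw [ha p q h, hb p q h, add_zero]
  zero_mem' _ _ _ := rfl
  smul_mem' r c hc p q h := by
    change r • c p q = 0
    rw [hc p q h, smul_zero]

/-- The differentiable cocycles of degree `m`. -/
def diffCocycles (m : ℕ) : Submodule ℝ (DiffCochains EG G E M) :=
  diffCochains EG G E M m ⊓ LinearMap.ker (diffD EG G E M)

/-- The differentiable coboundaries of degree `m`. -/
def diffCoboundaries : ℕ → Submodule ℝ (DiffCochains EG G E M)
  | 0 => ⊥
  | m + 1 => (diffCochains EG G E M m).map (diffD EG G E M)

/-- The differentiable cohomology `H^m(G; (Ω^*(M), d))` of `G` with coefficients in the de Rham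
complex of `M`. -/
abbrev HDiff (m : ℕ) : Type _ :=
  ↥(diffCocycles EG G E M m) ⧸ (diffCoboundaries EG G E M m).submoduleOf (diffCocycles EG G E M m)

/-! ### The maps `S` and `I` -/

/-- The periodicity operator on cochains, `(S c)^{p,q,k} = c^{p,q,k-1}`. -/
def shiftS : Bicomplex EG G E M →ₗ[ℝ] Bicomplex EG G E M :=
  LinearMap.pi fun p ↦ LinearMap.pi fun q ↦ LinearMap.pi fun k ↦
    match k with
    | 0 => 0
    | k + 1 => bicomplexProj EG G E M p q k

/-- The map `I` on cochains, the projection onto the column `k = 0`. -/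
def projI : Bicomplex EG G E M →ₗ[ℝ] DiffCochains EG G E M :=
  LinearMap.pi fun p ↦ LinearMap.pi fun q ↦ bicomplexProj EG G E M p q 0

theorem hochschild_eq_groupD (p q : ℕ) :
    (hochschild p q : Coch EG G E M p q →ₗ[ℝ] _) = groupD EG G E M p q := by
  rw [hochschild, groupD, Fin.sum_univ_succ]
  simp [coface]

theorem hcD_shiftS (c : Bicomplex EG G E M) :
    hcD EG G E M (shiftS EG G E M c) = shiftS EG G E M (hcD EG G E M c) := by
  funext p q k
  change totalPartHochschild EG G E M p q k _ + totalPartForm EG G E M p q k _ +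
    totalPartConnes EG G E M p q k _ = _
  cases k with
  | zero =>
    have h1 : totalPartHochschild EG G E M p q 0 (shiftS EG G E M c) = 0 := by
      cases p with
      | zero => rfl
      | succ p => exact map_zero (hochschild p q)
    have h2 : totalPartForm EG G E M p q 0 (shiftS EG G E M c) = 0 := by
      cases q with
      | zero => rfl
      | succ q =>
        change (-1 : ℝ) ^ p • dFamily q 0 = 0
        rw [map_zero, smul_zero]
    rw [h1, h2, add_zero, zero_add]
    rfl
  | succ k =>
    have h1 : totalPartHochschild EG G E M p q (k + 1) (shiftS EG G E M c) =
        totalPartHochschild EG G E M p q k c := by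
      cases p <;> rfl
    have h2 : totalPartForm EG G E M p q (k + 1) (shiftS EG G E M c) =
        totalPartForm EG G E M p q k c := by
      cases q <;> rfl
    have h3 : totalPartConnes EG G E M p q (k + 1) (shiftS EG G E M c) =
        totalPartConnes EG G E M p q k c := by
      cases k with
      | zero => exact map_zero (connesB p q)
      | succ k => rfl
    rw [h1, h2, h3]
    rfl

theorem diffD_projI (c : Bicomplex EG G E M) :
    diffD EG G E M (projI EG G E M c) = projI EG G E M (hcD EG G E M c) := by
  funext p q
  change diffPartGroup EG G E M p q _ + diffPartForm EG G E M p q _ =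
    totalPartHochschild EG G E M p q 0 c + totalPartForm EG G E M p q 0 c + 0
  rw [add_zero]
  congr 1
  · cases p with
    | zero => rfl
    | succ p =>
      change groupD EG G E M p q _ = hochschild p q _
      rw [hochschild_eq_groupD]
      rfl
  · cases q <;> rfl

set_option linter.unusedSectionVars false in
theorem shiftS_mem_cochains {m : ℕ} {c : Bicomplex EG G E M} (hc : c ∈ hcCochains EG G E M m) :
    shiftS EG G E M c ∈ hcCochains EG G E M (m + 2) := by
  intro p q k h
  cases k with
  | zero => rfl
  | succ k => exact hc p q k (by omega)

set_option linter.unusedSectionVars false in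
theorem projI_mem_cochains {m : ℕ} {c : Bicomplex EG G E M} (hc : c ∈ hcCochains EG G E M m) :
    projI EG G E M c ∈ diffCochains EG G E M m :=
  fun p q h ↦ hc p q 0 (by omega)

theorem shiftS_mem_cocycles {m : ℕ} {c : Bicomplex EG G E M} (hc : c ∈ hcCocycles EG G E M m) :
    shiftS EG G E M c ∈ hcCocycles EG G E M (m + 2) := by
  refine ⟨shiftS_mem_cochains EG G E M hc.1, ?_⟩
  rw [SetLike.mem_coe, LinearMap.mem_ker, hcD_shiftS, LinearMap.mem_ker.1 hc.2, map_zero]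

theorem projI_mem_cocycles {m : ℕ} {c : Bicomplex EG G E M} (hc : c ∈ hcCocycles EG G E M m) :
    projI EG G E M c ∈ diffCocycles EG G E M m := by
  refine ⟨projI_mem_cochains EG G E M hc.1, ?_⟩
  rw [SetLike.mem_coe, LinearMap.mem_ker, diffD_projI, LinearMap.mem_ker.1 hc.2, map_zero]

theorem shiftS_mem_coboundaries {m : ℕ} {c : Bicomplex EG G E M}
    (hc : c ∈ hcCoboundaries EG G E M m) :
    shiftS EG G E M c ∈ hcCoboundaries EG G E M (m + 2) := by
  cases m with
  | zero =>
    rw [hcCoboundaries, Submodule.mem_bot] at hc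
    rw [hc, map_zero]
    exact Submodule.zero_mem _
  | succ m =>
    obtain ⟨e, he, rfl⟩ := hc
    exact ⟨shiftS EG G E M e, shiftS_mem_cochains EG G E M he, hcD_shiftS EG G E M e⟩

theorem projI_mem_coboundaries {m : ℕ} {c : Bicomplex EG G E M}
    (hc : c ∈ hcCoboundaries EG G E M m) :
    projI EG G E M c ∈ diffCoboundaries EG G E M m := by
  cases m with
  | zero =>
    rw [hcCoboundaries, Submodule.mem_bot] at hc
    rw [hc, map_zero]
    exact Submodule.zero_mem _
  | succ m =>
    obtain ⟨e, he, rfl⟩ := hc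
    exact ⟨projI EG G E M e, projI_mem_cochains EG G E M he, diffD_projI EG G E M e⟩

/-- The periodicity operator `S : HC^m → HC^{m+2}`. -/
def HC.S (m : ℕ) : HC EG G E M m →ₗ[ℝ] HC EG G E M (m + 2) :=
  Submodule.mapQ _ _
    ((shiftS EG G E M).restrict (p := hcCocycles EG G E M m) (q := hcCocycles EG G E M (m + 2))
      fun _ hc ↦ shiftS_mem_cocycles EG G E M hc)
    fun _ hc ↦ shiftS_mem_coboundaries EG G E M hc

/-- The map `I : HC^m → H^m(G; (Ω^*(M), d))`; its target is the Hochschild cohomology of the cyclic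
module, whose cochain complex is that of differentiable group cochains. -/
def HC.I (m : ℕ) : HC EG G E M m →ₗ[ℝ] HDiff EG G E M m :=
  Submodule.mapQ _ _
    ((projI EG G E M).restrict (p := hcCocycles EG G E M m) (q := diffCocycles EG G E M m)
      fun _ hc ↦ projI_mem_cocycles EG G E M hc)
    fun _ hc ↦ projI_mem_coboundaries EG G E M hc

end CyclicCohomology

end
end HopfCyclic

/-! Put `x_i = g_1 ⋯ g_i`. A cochain `c` on `G^n` is the same as a homogeneous cochain `F(x_0, …,
x_n) = x_0^* c(x_0⁻¹ x_1, …, x_{n-1}⁻¹ x_n)`, equivariant under `G`. In these terms cofaces omit a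
vertex, codegeneracies repeat one and `τ` rotates the vertices, so every structure map is a
substitution of vertices (`simplexMap`), and substitutions by arbitrary maps of vertices, in
particular by all permutations, act as well. The Hochschild complex with `d` is literally the
complex of differentiable cochains.

The decisive point is that antisymmetrization over all vertices is a cochain map homotopic to the
identity. The homotopy is universal: it is constructed on ordered chains of simplices by the method
of acyclic models, with cones as contractions (`OrdChain.bd_homotopy`). The cyclic rotation of `n +
1` points has sign `(-1)^n`, so an antisymmetric cochain is fixed by `λ = (-1)^n τ`, and therefore
`B`, which begins with `1 - λ`, kills it (`connesB_antisym`). Hence an antisymmetrized cocycle,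
placed in column `0`, is already a cocycle of the total complex, and `I` is surjective on cohomology
(`exists_hcCocycle_lift`).

The columns give a short exact sequence of complexes: shift, then projection to column `0`.
Surjectivity of `I` in every degree breaks its long exact sequence into `0 → HC^m → HC^{m+2} →
H^{m+2} → 0` with maps `S` and `I`. Over a field this splits (`exists_splitting_of_shortExact`), and
`I` is bijective for `m < 2`. Recursion in steps of two yields the decomposition, with compatibility
with `I` and `S` built in. That the total differential squares to zero rests on the cyclic
identities and on `d² = 0` together with naturality of `d` under pullback. -/

namespace HopfCyclic
noncomputable section

/-! ### Homogeneous coordinates on `G^n` -/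

section Tuples
variable {G : Type*} [Group G]

/-- The inhomogeneous coordinates of the tuple `(x_{φ 0}, …, x_{φ n})`, where
`x_i = g_1 ⋯ g_i`. -/
def pullTuple {n m : ℕ} (φ : Fin (n + 1) → Fin (m + 1)) (g : Fin m → G) (i : Fin n) : G :=
  (Fin.partialProd g (φ i.castSucc))⁻¹ * Fin.partialProd g (φ i.succ)

/-- The partial products telescope: the new tuple has vertices `x_{φ j}`, translated so that the
first one becomes `1`. -/
theorem partialProd_pullTuple {n m : ℕ} (φ : Fin (n + 1) → Fin (m + 1)) (g : Fin m → G)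
    (j : Fin (n + 1)) : Fin.partialProd (pullTuple φ g) j =
      (Fin.partialProd g (φ 0))⁻¹ * Fin.partialProd g (φ j) := by
  induction j using Fin.induction with
  | zero => simp
  | succ j ih => rw [Fin.partialProd_succ, ih, pullTuple, mul_assoc, mul_inv_cancel_left]

theorem pullTuple_id {n : ℕ} (g : Fin n → G) : pullTuple id g = g :=
  funext fun i ↦ Fin.partialProd_right_inv g i

end Tuples

/-! ### Structure maps of the cyclic module as substitutions of vertices -/

section SimplexMaps
variable {EG : Type*} [NormedAddCommGroup EG] [NormedSpace ℝ EG] {G : Type*} [TopologicalSpace G]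
  [ChartedSpace EG G] [Group G] [LieGroup 𝓘(ℝ, EG) ∞ G]
  {E : Type*} [NormedAddCommGroup E] [NormedSpace ℝ E] {M : Type*} [TopologicalSpace M]
  [ChartedSpace E M] [IsManifold 𝓘(ℝ, E) ∞ M] [MulAction G M]
  [ContMDiffSMul 𝓘(ℝ, EG) 𝓘(ℝ, E) ∞ G M]

theorem contMDiff_partialProd (m : ℕ) (i : Fin (m + 1)) :
    ContMDiff (powModel EG m) 𝓘(ℝ, EG) ∞ (fun g : Fin m → G ↦ Fin.partialProd g i) := by
  induction i using Fin.induction with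
  | zero => simpa only [Fin.partialProd_zero] using contMDiff_const
  | succ i ih => simpa only [Fin.partialProd_succ] using! ih.mul (contMDiff_eval m i)

theorem contMDiff_pullTuple {n m : ℕ} (φ : Fin (n + 1) → Fin (m + 1)) :
    ContMDiff (powModel EG m) (powModel EG n) ∞ (pullTuple (G := G) φ) :=
  contMDiff_pow fun _ ↦ ((contMDiff_partialProd m _).inv).mul (contMDiff_partialProd m _)

/-- The operator `C^n → C^m` given by a map of vertices `φ`. In terms of homogeneous cochains it is
`F ↦ ((x_0, …, x_m) ↦ F(x_{φ 0}, …, x_{φ n}))`. -/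
def simplexMap {n m : ℕ} (q : ℕ) (φ : Fin (n + 1) → Fin (m + 1)) :
    Coch EG G E M n q →ₗ[ℝ] Coch EG G E M m q :=
  twistFamily (contMDiff_pullTuple φ) (contMDiff_partialProd m (φ 0)) q

theorem simplexMap_apply {n m : ℕ} (q : ℕ) (φ : Fin (n + 1) → Fin (m + 1))
    (c : Coch EG G E M n q) (g : Fin m → G) :
    (simplexMap q φ c).1 g = act EG (Fin.partialProd g (φ 0)) q (c.1 (pullTuple φ g)) := rfl

theorem simplexMap_id (n q : ℕ) :
    (simplexMap q id : Coch EG G E M n q →ₗ[ℝ] _) = LinearMap.id := by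
  refine LinearMap.ext fun c ↦ FormFamily.ext (funext fun g ↦ ?_)
  rw [simplexMap_apply, pullTuple_id, id, Fin.partialProd_zero, act_one]
  rfl

/-- Substitutions compose. The twist by the outer base vertex `x_{φ 0}` cancels the translation in
`partialProd_pullTuple`, so only the twist by `x_{φ (ψ 0)}` remains. -/
theorem simplexMap_comp {l n m : ℕ} (q : ℕ) (φ : Fin (n + 1) → Fin (m + 1))
    (ψ : Fin (l + 1) → Fin (n + 1)) :
    (simplexMap q φ ∘ₗ simplexMap q ψ : Coch EG G E M l q →ₗ[ℝ] _) = simplexMap q (φ ∘ ψ) := by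
  refine LinearMap.ext fun c ↦ FormFamily.ext (funext fun g ↦ ?_)
  rw [LinearMap.comp_apply, simplexMap_apply, simplexMap_apply, simplexMap_apply, ← act_mul,
    partialProd_pullTuple, mul_inv_cancel_left]
  have h : pullTuple ψ (pullTuple φ g) = pullTuple (φ ∘ ψ) g := by
    funext i
    rw [pullTuple, partialProd_pullTuple, partialProd_pullTuple, pullTuple, mul_inv_rev, inv_inv,
      mul_assoc, mul_inv_cancel_left]
    rfl
  rw [h]
  rfl

/-- Omitting `x_i` multiplies `g_i` and `g_{i+1}`, or drops the last entry. Only for `i = 0` does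
the base vertex move, from `1` to `x_1 = g_1`; this accounts for the action `g_1^*` in `δ_0`. -/
theorem coface_eq (n q : ℕ) (i : Fin (n + 2)) :
    (coface n q i : Coch EG G E M n q →ₗ[ℝ] _) = simplexMap q i.succAbove := by
  refine LinearMap.ext fun c ↦ FormFamily.ext (funext fun g ↦ ?_)
  rw [simplexMap_apply]
  refine Fin.cases ?_ (fun j ↦ ?_) i
  · have h : pullTuple (Fin.succAbove 0) g = Fin.tail g := by
      funext k
      rw [pullTuple, Fin.succAbove_zero, ← Fin.castSucc_succ]
      exact Fin.partialProd_right_inv g k.succ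
    have h0 : Fin.partialProd g (Fin.succAbove 0 0) = g 0 := by
      rw [Fin.succAbove_zero, Fin.partialProd_succ]
      simp
    rw [h, h0]
    rfl
  · have h : pullTuple (Fin.succAbove j.succ) g = Fin.contractNth j (· * ·) g := by
      funext k
      rw [pullTuple, ← Fin.inv_partialProd_mul_eq_contractNth, Fin.succ_succAbove_succ]
    rw [h, Fin.succ_succAbove_zero, Fin.partialProd_zero, act_one]
    rfl

/-- Inserting `1` into the tuple of group elements repeats a vertex. -/
theorem codeg_eq (n q : ℕ) (i : Fin (n + 1)) :
    (codeg n q i : Coch EG G E M (n + 1) q →ₗ[ℝ] _) = simplexMap q i.predAbove := by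
  refine LinearMap.ext fun c ↦ FormFamily.ext (funext fun g ↦ ?_)
  rw [simplexMap_apply, codeg_apply]
  have h0 : i.predAbove 0 = 0 := by simp
  have h : pullTuple i.predAbove g = Fin.insertNth i (1 : G) g := by
    funext k
    rw [pullTuple]
    refine Fin.succAboveCases i ?_ (fun k ↦ ?_) k
    · rw [Fin.insertNth_apply_same, Fin.predAbove_castSucc_self, Fin.predAbove_succ_self,
        inv_mul_cancel]
    · rw [Fin.insertNth_apply_succAbove, ← Fin.partialProd_right_inv g k]
      rcases lt_or_ge k.castSucc i with hk | hk
      · rw [Fin.succAbove_of_castSucc_lt _ _ hk, Fin.predAbove_castSucc_of_le _ _ hk.le,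
          Fin.succ_castSucc, Fin.predAbove_castSucc_of_le _ _ (Nat.succ_le_of_lt hk)]
      · rw [Fin.succAbove_of_le_castSucc _ _ hk, ← Fin.succ_castSucc,
          Fin.predAbove_succ_of_le _ _ hk,
          Fin.predAbove_succ_of_le _ _ (hk.trans (Fin.castSucc_le_succ k))]
  rw [h, h0, Fin.partialProd_zero, act_one]

/-- The cyclic rotation `0 ↦ n`, `i ↦ i - 1` of the vertices. -/
def rot (n : ℕ) (i : Fin (n + 1)) : Fin (n + 1) := (finRotate (n + 1)).symm i

theorem rot_zero (n : ℕ) : rot n 0 = Fin.last n := by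
  rw [rot, Equiv.symm_apply_eq, finRotate_last]

theorem rot_succ (n : ℕ) (i : Fin n) : rot n i.succ = i.castSucc := by
  rw [rot, Equiv.symm_apply_eq, finRotate_apply, Fin.coeSucc_eq_succ]

/-- After rotation the vertices are `x_n, x_0, …, x_{n-1}`. Their consecutive quotients are `(g_1 ⋯
g_n)⁻¹, g_1, …, g_{n-1}`, and the base vertex is `x_n = g_1 ⋯ g_n`. -/
theorem cyc_eq (n q : ℕ) :
    (cyc n q : Coch EG G E M n q →ₗ[ℝ] _) = simplexMap q (rot n) := by
  refine LinearMap.ext fun c ↦ FormFamily.ext (funext fun g ↦ ?_)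
  have hl : Fin.partialProd g (Fin.last n) = (List.ofFn g).prod := by
    simp [Fin.partialProd, List.take_of_length_le]
  have h : pullTuple (rot n) g = cycShift n g := by
    cases n with
    | zero => exact Subsingleton.elim _ _
    | succ n =>
      funext k
      rw [pullTuple, rot_succ]
      refine Fin.cases ?_ (fun k ↦ ?_) k
      · rw [Fin.castSucc_zero, rot_zero, hl, Fin.partialProd_zero, mul_one]
        rfl
      · rw [← Fin.succ_castSucc, rot_succ]
        exact Fin.partialProd_right_inv g k.castSucc
  rw [simplexMap_apply, h, rot_zero, hl]
  rfl

end SimplexMaps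

/-! ### `d² = 0` and naturality of the de Rham differential -/

section Naturality
variable {E : Type*} [NormedAddCommGroup E] [NormedSpace ℝ E] {M : Type*} [TopologicalSpace M]
  [ChartedSpace E M] [IsManifold 𝓘(ℝ, E) ∞ M]

/-- Near the base point, the representative of `dη` in a fixed chart is the exterior derivative of
the representative of `η`, which reduces the claim to `d² = 0` on the model space. -/
theorem dForm_dForm (q : ℕ) (η : DForm E M q) : dForm (q + 1) (dForm q η) = 0 := by
  ext x : 1
  set φ := extChartAt 𝓘(ℝ, E) x with hφ
  have hz : φ x ∈ φ.target := mem_extChartAt_target (I := 𝓘(ℝ, E)) x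
  have ev : formInChart x (dForm q η) =ᶠ[𝓝 (φ x)] extDeriv (formInChart x η) := by
    filter_upwards [(isOpen_extChartAt_target x).mem_nhds hz] with z hz
    have hs := φ.map_target hz
    have d1 : MDifferentiableAt 𝓘(ℝ, E) 𝓘(ℝ, E) φ.symm z :=
      ((contMDiffOn_extChartAt_symm (I := 𝓘(ℝ, E)) (n := ∞) x).contMDiffAt
        ((isOpen_extChartAt_target x).mem_nhds hz)).mdifferentiableAt (by simp)
    have d0 : MDifferentiableAt 𝓘(ℝ, E) 𝓘(ℝ, E) φ (φ.symm z) :=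
      (contMDiffAt_extChartAt' (n := ∞) (by rwa [hφ, extChartAt_source] at hs)).mdifferentiableAt
        (by simp)
    -- The derivatives of the chart and of its inverse cancel. They appear because `extD` pulls back
    -- along the chart and `formInChart` along its inverse.
    have hm : (mfderiv 𝓘(ℝ, E) 𝓘(ℝ, E) φ (φ.symm z)).comp (mfderiv 𝓘(ℝ, E) 𝓘(ℝ, E) φ.symm z) =
        ContinuousLinearMap.id ℝ E := by
      rw [← mfderiv_comp z d0 d1]
      have e : φ ∘ φ.symm =ᶠ[𝓝 z] id := by
        filter_upwards [(isOpen_extChartAt_target x).mem_nhds hz] with w hw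
        exact φ.right_inv hw
      rw [e.mfderiv_eq, mfderiv_id]
      rfl
    ext v
    change extD η (φ.symm z) _ = _
    rw [extD_eq η x hs]
    change extDeriv (formInChart x η) (φ (φ.symm z)) _ = _
    rw [φ.right_inv hz]
    exact congrArg _ (funext fun i ↦ DFunLike.congr_fun hm (v i))
  change extD (dForm q η) x = 0
  unfold extD
  rw [ev.extDeriv_eq, extDeriv_extDeriv_apply (r := ∞) (formInChart_contDiffAt η x hz)
    (by rw [minSmoothness_of_isRCLikeNormedField]; exact ENat.LEInfty.out)]
  rfl

/-- The chain rule for `φ₀ ∘ a ∘ φ₁⁻¹`; for `a = id` this is the change of charts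
`formInChart_change`. -/
theorem formInChart_pullback {q : ℕ} (a : M → M) (ha : ContMDiff 𝓘(ℝ, E) 𝓘(ℝ, E) ∞ a)
    (η : DForm E M q) (x₀ x₁ : M) {z : E} (hz : z ∈ (extChartAt 𝓘(ℝ, E) x₁).target)
    (hz' : a ((extChartAt 𝓘(ℝ, E) x₁).symm z) ∈ (extChartAt 𝓘(ℝ, E) x₀).source) :
    formInChart x₁ (formPullback a ha q η) z =
      (formInChart x₀ η ((extChartAt 𝓘(ℝ, E) x₀ ∘ a ∘ (extChartAt 𝓘(ℝ, E) x₁).symm) z)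
        ).compContinuousLinearMap
        (fderiv ℝ (extChartAt 𝓘(ℝ, E) x₀ ∘ a ∘ (extChartAt 𝓘(ℝ, E) x₁).symm) z) := by
  set φ₀ := extChartAt 𝓘(ℝ, E) x₀ with hφ₀
  set φ₁ := extChartAt 𝓘(ℝ, E) x₁ with hφ₁
  have d1 : MDifferentiableAt 𝓘(ℝ, E) 𝓘(ℝ, E) φ₁.symm z :=
    ((contMDiffOn_extChartAt_symm (I := 𝓘(ℝ, E)) (n := ∞) x₁).contMDiffAt
      ((isOpen_extChartAt_target x₁).mem_nhds hz)).mdifferentiableAt (by simp)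
  have da : MDifferentiableAt 𝓘(ℝ, E) 𝓘(ℝ, E) a (φ₁.symm z) :=
    (ha _).mdifferentiableAt (by simp)
  have d1a : MDifferentiableAt 𝓘(ℝ, E) 𝓘(ℝ, E) (a ∘ φ₁.symm) z := da.comp z d1
  have d0 : MDifferentiableAt 𝓘(ℝ, E) 𝓘(ℝ, E) φ₀ ((a ∘ φ₁.symm) z) :=
    (contMDiffAt_extChartAt' (n := ∞) (by rwa [hφ₀, extChartAt_source] at hz')).mdifferentiableAt
      (by simp)
  have d0s : MDifferentiableAt 𝓘(ℝ, E) 𝓘(ℝ, E) φ₀.symm (φ₀ ((a ∘ φ₁.symm) z)) :=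
    ((contMDiffOn_extChartAt_symm (I := 𝓘(ℝ, E)) (n := ∞) x₀).contMDiffAt
      ((isOpen_extChartAt_target x₀).mem_nhds (φ₀.map_source hz'))).mdifferentiableAt (by simp)
  have e1 : mfderiv 𝓘(ℝ, E) 𝓘(ℝ, E) (φ₀ ∘ a ∘ φ₁.symm) z = fderiv ℝ (φ₀ ∘ a ∘ φ₁.symm) z :=
    mfderiv_eq_fderiv
  have dψ : MDifferentiableAt 𝓘(ℝ, E) 𝓘(ℝ, E) (φ₀ ∘ a ∘ φ₁.symm) z := d0.comp z d1a
  have ev : a ∘ φ₁.symm =ᶠ[𝓝 z] φ₀.symm ∘ (φ₀ ∘ a ∘ φ₁.symm) := by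
    have : ∀ᶠ w in 𝓝 z, (a ∘ φ₁.symm) w ∈ φ₀.source :=
      d1a.continuousAt.preimage_mem_nhds ((isOpen_extChartAt_source x₀).mem_nhds hz')
    filter_upwards [this] with w hw
    exact (φ₀.left_inv hw).symm
  have hm : (mfderiv 𝓘(ℝ, E) 𝓘(ℝ, E) a (φ₁.symm z)).comp (mfderiv 𝓘(ℝ, E) 𝓘(ℝ, E) φ₁.symm z) =
      (mfderiv 𝓘(ℝ, E) 𝓘(ℝ, E) φ₀.symm ((φ₀ ∘ a ∘ φ₁.symm) z)).comp
        (fderiv ℝ (φ₀ ∘ a ∘ φ₁.symm) z) := by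
    rw [← mfderiv_comp z da d1, ev.mfderiv_eq, mfderiv_comp z d0s dψ, e1]
    rfl
  ext v
  have hp : φ₀.symm ((φ₀ ∘ a ∘ φ₁.symm) z) = a (φ₁.symm z) := φ₀.left_inv hz'
  let η' : M → E [⋀^Fin q]→L[ℝ] ℝ := η
  change η' (a (φ₁.symm z)) _ = η' (φ₀.symm ((φ₀ ∘ a ∘ φ₁.symm) z)) _
  rw [hp]
  refine congrArg (η' (a (φ₁.symm z))) (funext fun i ↦ ?_)
  exact DFunLike.congr_fun hm (v i)

/-- In charts at `x` and at `a x` this is the naturality of `extDeriv` under the smooth map `φ₀ ∘ a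
∘ φ₁⁻¹`; the remaining chart derivatives are matched by the chain rule. -/
theorem dForm_formPullback (a : M → M) (ha : ContMDiff 𝓘(ℝ, E) 𝓘(ℝ, E) ∞ a) (q : ℕ)
    (η : DForm E M q) :
    dForm q (formPullback a ha q η) = formPullback a ha (q + 1) (dForm q η) := by
  ext x : 1
  set φ₀ := extChartAt 𝓘(ℝ, E) (a x) with hφ₀
  set φ₁ := extChartAt 𝓘(ℝ, E) x with hφ₁
  have hz : φ₁ x ∈ φ₁.target := mem_extChartAt_target (I := 𝓘(ℝ, E)) x
  have hxx : φ₁.symm (φ₁ x) = x := φ₁.left_inv (mem_extChartAt_source (I := 𝓘(ℝ, E)) x)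
  have hax : a x ∈ φ₀.source := mem_extChartAt_source (I := 𝓘(ℝ, E)) (a x)
  have s1 : ContMDiffAt 𝓘(ℝ, E) 𝓘(ℝ, E) ∞ φ₁.symm (φ₁ x) :=
    (contMDiffOn_extChartAt_symm (I := 𝓘(ℝ, E)) (n := ∞) x).contMDiffAt
      ((isOpen_extChartAt_target x).mem_nhds hz)
  have s1a : ContMDiffAt 𝓘(ℝ, E) 𝓘(ℝ, E) ∞ (a ∘ φ₁.symm) (φ₁ x) := (ha _).comp (φ₁ x) s1
  have s0 : ContMDiffAt 𝓘(ℝ, E) 𝓘(ℝ, E) ∞ φ₀ (a x) := contMDiffAt_extChartAt (n := ∞)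
  have sψ : ContDiffAt ℝ ∞ (φ₀ ∘ a ∘ φ₁.symm) (φ₁ x) := by
    rw [← contMDiffAt_iff_contDiffAt]
    exact ContMDiffAt.comp (φ₁ x) (by rw [Function.comp_apply, hxx]; exact s0) s1a
  have hψ : (φ₀ ∘ a ∘ φ₁.symm) (φ₁ x) = φ₀ (a x) := by simp [hxx]
  have ev : formInChart x (formPullback a ha q η) =ᶠ[𝓝 (φ₁ x)]
      fun z ↦ (formInChart (a x) η ((φ₀ ∘ a ∘ φ₁.symm) z)
        ).compContinuousLinearMap (fderiv ℝ (φ₀ ∘ a ∘ φ₁.symm) z) := by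
    have h1 : ∀ᶠ z in 𝓝 (φ₁ x), (a ∘ φ₁.symm) z ∈ φ₀.source :=
      s1a.continuousAt.preimage_mem_nhds
        ((isOpen_extChartAt_source (a x)).mem_nhds (by rw [Function.comp_apply, hxx]; exact hax))
    filter_upwards [h1, (isOpen_extChartAt_target x).mem_nhds hz] with z hz1 hz2
    exact formInChart_pullback a ha η (a x) x hz2 hz1
  have hd := ev.extDeriv_eq
  rw [extDeriv_pullback (r := ∞) (by
    rw [hψ]
    exact (formInChart_contDiffAt η (a x) (φ₀.map_source hax)).differentiableAt (by simp)) sψ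
    (by rw [minSmoothness_of_isRCLikeNormedField]; exact ENat.LEInfty.out), hψ] at hd
  have evφ : φ₀ ∘ a =ᶠ[𝓝 x] (φ₀ ∘ a ∘ φ₁.symm) ∘ φ₁ := by
    filter_upwards [extChartAt_source_mem_nhds (I := 𝓘(ℝ, E)) x] with w hw
    simp [φ₁.left_inv hw]
  have hm : (mfderiv 𝓘(ℝ, E) 𝓘(ℝ, E) φ₀ (a x)).comp (mfderiv 𝓘(ℝ, E) 𝓘(ℝ, E) a x) =
      (fderiv ℝ (φ₀ ∘ a ∘ φ₁.symm) (φ₁ x)).comp (mfderiv 𝓘(ℝ, E) 𝓘(ℝ, E) φ₁ x) := by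
    rw [← mfderiv_comp x (s0.mdifferentiableAt (by simp)) ((ha x).mdifferentiableAt (by simp)),
      evφ.mfderiv_eq, mfderiv_comp x (sψ.differentiableAt (by simp)).mdifferentiableAt
      ((contMDiffAt_extChartAt (n := ∞)).mdifferentiableAt (by simp)), mfderiv_eq_fderiv]
    rfl
  ext v
  change extDeriv (formInChart x (formPullback a ha q η)) (φ₁ x) _ =
    extDeriv (formInChart (a x) η) (φ₀ (a x)) _
  rw [hd]
  refine congrArg (extDeriv (formInChart (a x) η) (φ₀ (a x))) (funext fun i ↦ ?_)
  exact (DFunLike.congr_fun hm (v i)).symm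

end Naturality

/-! ### Ordered chains of simplices: antisymmetrization is homotopic to the identity -/

section OrderedChains

/-- The ordered chains of the simplex with `m` vertices: formal combinations of `n`-tuples of
vertices. -/
abbrev OrdChain (n m : ℕ) : Type := (Fin n → Fin m) →₀ ℝ

namespace OrdChain

/-- The map of ordered chains induced by a map of vertices. -/
def push {m m' : ℕ} (n : ℕ) (φ : Fin m → Fin m') : OrdChain n m →ₗ[ℝ] OrdChain n m' :=
  Finsupp.lmapDomain ℝ ℝ (φ ∘ ·)

/-- Reindexing of tuples. -/
def pull {n n' : ℕ} (m : ℕ) (ψ : Fin n' → Fin n) : OrdChain n m →ₗ[ℝ] OrdChain n' m :=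
  Finsupp.lmapDomain ℝ ℝ (· ∘ ψ)

/-- The boundary operator. -/
def bd (n m : ℕ) : OrdChain (n + 1) m →ₗ[ℝ] OrdChain n m :=
  ∑ i : Fin (n + 1), (-1 : ℝ) ^ (i : ℕ) • pull m i.succAbove

/-- The alternating sum of the inclusions of the faces of the simplex. -/
def cobd (n m : ℕ) : OrdChain n m →ₗ[ℝ] OrdChain n (m + 1) :=
  ∑ i : Fin (m + 1), (-1 : ℝ) ^ (i : ℕ) • push n i.succAbove

/-- The cone with apex `v`. -/
def cone {m : ℕ} (n : ℕ) (v : Fin m) : OrdChain n m →ₗ[ℝ] OrdChain (n + 1) m :=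
  Finsupp.lmapDomain ℝ ℝ (fun φ ↦ (Fin.cons v φ : Fin (n + 1) → Fin m))

theorem push_single {m m' n : ℕ} (φ : Fin m → Fin m') (ψ : Fin n → Fin m) (r : ℝ) :
    push n φ (Finsupp.single ψ r) = Finsupp.single (φ ∘ ψ) r := Finsupp.mapDomain_single

theorem pull_single {n n' m : ℕ} (ψ : Fin n' → Fin n) (φ : Fin n → Fin m) (r : ℝ) :
    pull m ψ (Finsupp.single φ r) = Finsupp.single (φ ∘ ψ) r := Finsupp.mapDomain_single

theorem cone_single {n m : ℕ} (v : Fin m) (φ : Fin n → Fin m) (r : ℝ) :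
    cone n v (Finsupp.single φ r) =
      Finsupp.single (Fin.cons v φ : Fin (n + 1) → Fin m) r := Finsupp.mapDomain_single

theorem bd_single {n m : ℕ} (φ : Fin (n + 1) → Fin m) (r : ℝ) :
    bd n m (Finsupp.single φ r) =
      ∑ i : Fin (n + 1), (-1 : ℝ) ^ (i : ℕ) • Finsupp.single (φ ∘ i.succAbove) r := by
  simp only [bd, LinearMap.sum_apply, LinearMap.smul_apply, pull_single]

theorem cobd_single {n m : ℕ} (φ : Fin n → Fin m) (r : ℝ) :
    cobd n m (Finsupp.single φ r) =
      ∑ i : Fin (m + 1), (-1 : ℝ) ^ (i : ℕ) • Finsupp.single (i.succAbove ∘ φ) r := by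
  simp only [cobd, LinearMap.sum_apply, LinearMap.smul_apply, push_single]

theorem push_pull {m m' n n' : ℕ} (φ : Fin m → Fin m') (ψ : Fin n' → Fin n) (x : OrdChain n m) :
    push n' φ (pull m ψ x) = pull m' ψ (push n φ x) := by
  induction x using Finsupp.induction_linear with
  | zero => simp only [map_zero]
  | add x y hx hy => simp only [map_add, hx, hy]
  | single χ r => simp only [pull_single, push_single, Function.comp_assoc]

theorem bd_push {m m' n : ℕ} (φ : Fin m → Fin m') (x : OrdChain (n + 1) m) :
    bd n m' (push (n + 1) φ x) = push n φ (bd n m x) := by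
  simp only [bd, LinearMap.sum_apply, LinearMap.smul_apply, map_sum, map_smul, push_pull]

theorem cobd_pull {m n n' : ℕ} (ψ : Fin n' → Fin n) (x : OrdChain n m) :
    cobd n' m (pull m ψ x) = pull (m + 1) ψ (cobd n m x) := by
  simp only [cobd, LinearMap.sum_apply, LinearMap.smul_apply, map_sum, map_smul, push_pull]

theorem bd_cobd {m n : ℕ} (x : OrdChain (n + 1) m) :
    bd n (m + 1) (cobd (n + 1) m x) = cobd n m (bd n m x) := by
  rw [cobd, cobd]
  simp only [LinearMap.sum_apply, LinearMap.smul_apply, map_sum, map_smul, bd_push]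

theorem bd_cone_zero {m : ℕ} (v : Fin m) (x : OrdChain 0 m) : bd 0 m (cone 0 v x) = x := by
  induction x using Finsupp.induction_linear with
  | zero => simp only [map_zero]
  | add x y hx hy => simp only [map_add, hx, hy]
  | single φ r =>
    rw [cone_single, bd_single, Fin.sum_univ_one, Fin.val_zero, pow_zero, one_smul]
    exact congrArg (Finsupp.single · r) (Subsingleton.elim _ _)

/-- Omitting the apex gives `x` back; every other face is the cone over a face of `x` with index
raised by one, whence the sign. Cones thus contract the augmented complex, in which the empty tuple
is allowed. -/
theorem bd_cone_succ {n m : ℕ} (v : Fin m) (x : OrdChain (n + 1) m) :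
    bd (n + 1) m (cone (n + 1) v x) = x - cone n v (bd n m x) := by
  induction x using Finsupp.induction_linear with
  | zero => simp only [map_zero, sub_zero]
  | add x y hx hy =>
    simp only [map_add, hx, hy]
    abel
  | single φ r =>
    rw [cone_single, bd_single, Fin.sum_univ_succ, bd_single, map_sum, sub_eq_add_neg,
      ← Finset.sum_neg_distrib]
    congr 1
    · rw [Fin.val_zero, pow_zero, one_smul]
      exact congrArg (Finsupp.single · r) (funext fun i ↦ by simp)
    · refine Finset.sum_congr rfl fun i _ ↦ ?_
      rw [map_smul, cone_single, Fin.val_succ, pow_succ, mul_neg_one, neg_smul]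
      refine congrArg (fun f ↦ -((-1 : ℝ) ^ (i : ℕ) • Finsupp.single f r)) (funext fun j ↦ ?_)
      refine Fin.cases ?_ (fun j ↦ ?_) j
      · simp
      · simp

/-- Chains of nonempty tuples are spanned by cones, and on a cone `bd_cone_succ` reduces the claim
to one degree lower. This replaces the usual cancellation of pairs of faces. -/
theorem bd_bd (n m : ℕ) (x : OrdChain (n + 2) m) : bd n m (bd (n + 1) m x) = 0 := by
  have hspan : ∀ k (x : OrdChain (k + 1) m), ∀ p : OrdChain (k + 1) m → Prop, p 0 →
      (∀ x y, p x → p y → p (x + y)) → (∀ v y, p (cone k v y)) → p x := by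
    intro k x p h0 ha hc
    induction x using Finsupp.induction_linear with
    | zero => exact h0
    | add x y hx hy => exact ha x y hx hy
    | single φ r =>
      have := hc (φ 0) (Finsupp.single (Fin.tail φ) r)
      rwa [cone_single, Fin.cons_self_tail] at this
  induction n with
  | zero =>
    refine hspan 1 x (fun x ↦ bd 0 m (bd 1 m x) = 0) (by simp only [map_zero])
      (fun x y hx hy ↦ by simp only [map_add, hx, hy, add_zero]) fun v y ↦ ?_
    rw [bd_cone_succ, map_sub, bd_cone_zero, sub_self]
  | succ n ih =>
    refine hspan _ x (fun x ↦ bd (n + 1) m (bd (n + 2) m x) = 0) (by simp only [map_zero])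
      (fun x y hx hy ↦ by simp only [map_add, hx, hy, add_zero]) fun v y ↦ ?_
    rw [bd_cone_succ, map_sub, bd_cone_succ, ih, map_zero, sub_zero, sub_self]

/-- The tautological simplex. -/
def fundamental (n : ℕ) : OrdChain n n := Finsupp.single id 1

theorem pull_fundamental {n m : ℕ} (φ : Fin n → Fin m) :
    pull m φ (fundamental m) = Finsupp.single φ 1 := pull_single _ _ _

/-- For the tautological simplex, omitting an entry and including a face both give the tuple
`i.succAbove`. -/
theorem bd_fundamental (n : ℕ) :
    bd n (n + 1) (fundamental (n + 1)) = cobd n n (fundamental n) := by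
  rw [fundamental, bd_single, fundamental, cobd_single]
  rfl

/-- Every simplex is a reindexing of the tautological one, where `cobd` can be traded for `bd`
twice; the claim becomes `bd_bd`. -/
theorem cobd_cobd (n m : ℕ) (x : OrdChain n m) : cobd n (m + 1) (cobd n m x) = 0 := by
  induction x using Finsupp.induction_linear with
  | zero => simp only [map_zero]
  | add x y hx hy => simp only [map_add, hx, hy, add_zero]
  | single φ r =>
    have h : (Finsupp.single φ r : OrdChain n m) = r • pull m φ (fundamental m) := by
      rw [pull_fundamental, Finsupp.smul_single, smul_eq_mul, mul_one]
    rw [h, map_smul, map_smul, cobd_pull, cobd_pull, ← bd_fundamental, ← bd_cobd,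
      ← bd_fundamental, bd_bd, map_zero, smul_zero]

/-- The antisymmetrized simplex. -/
def alt (n : ℕ) : OrdChain n n :=
  (Nat.factorial n : ℝ)⁻¹ • ∑ σ : Equiv.Perm (Fin n),
    ((Equiv.Perm.sign σ : ℤ) : ℝ) • Finsupp.single (σ : Fin n → Fin n) 1

/-- Left translation by `σ` permutes the summands and multiplies each sign by `sign σ`. -/
theorem push_alt {n : ℕ} (σ : Equiv.Perm (Fin n)) :
    push n σ (alt n) = ((Equiv.Perm.sign σ : ℤ) : ℝ) • alt n := by
  rw [alt, map_smul, smul_comm, map_sum]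
  refine congrArg ((Nat.factorial n : ℝ)⁻¹ • ·) ?_
  rw [Finset.smul_sum]
  rw [← Equiv.sum_comp (Equiv.mulLeft σ) (fun ρ : Equiv.Perm (Fin n) ↦
    ((Equiv.Perm.sign σ : ℤ) : ℝ) • ((Equiv.Perm.sign ρ : ℤ) : ℝ) •
      (Finsupp.single (ρ : Fin n → Fin n) 1 : OrdChain n n))]
  refine Finset.sum_congr rfl fun ρ _ ↦ ?_
  rw [map_smul, push_single, smul_smul, Equiv.coe_mulLeft, Equiv.Perm.sign_mul, Units.val_mul,
    Int.cast_mul, ← mul_assoc, ← Int.cast_mul, ← Units.val_mul, Int.units_mul_self, Units.val_one,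
    Int.cast_one, one_mul]
  rfl

/-- The permutation which maps `i` to `j`, and whose restriction to the complements of `i` and `j`
is `ρ`. -/
def extendPerm {n : ℕ} (i j : Fin (n + 1)) (ρ : Equiv.Perm (Fin n)) : Equiv.Perm (Fin (n + 1)) :=
  j.cycleRange.symm * Equiv.Perm.decomposeFin.symm (0, ρ) * i.cycleRange

theorem extendPerm_comp {n : ℕ} (i j : Fin (n + 1)) (ρ : Equiv.Perm (Fin n)) :
    (extendPerm i j ρ : Fin (n + 1) → Fin (n + 1)) ∘ i.succAbove = j.succAbove ∘ ρ := by
  funext k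
  simp [extendPerm, Fin.cycleRange_succAbove,
    Equiv.Perm.decomposeFin_symm_apply_succ, Fin.cycleRange_symm_succ]

theorem extendPerm_apply_self {n : ℕ} (i j : Fin (n + 1)) (ρ : Equiv.Perm (Fin n)) :
    extendPerm i j ρ i = j := by
  simp [extendPerm, Fin.cycleRange_self,
    Equiv.Perm.decomposeFin_symm_apply_zero]

/-- The cycles that move `i` and `j` to position `0` have signs `(-1)^i` and `(-1)^j`, and adding a
fixed point to `ρ` leaves its sign unchanged. -/
theorem sign_extendPerm {n : ℕ} (i j : Fin (n + 1)) (ρ : Equiv.Perm (Fin n)) :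
    ((Equiv.Perm.sign (extendPerm i j ρ) : ℤ) : ℝ) * (-1) ^ (i : ℕ) =
      (-1) ^ (j : ℕ) * ((Equiv.Perm.sign ρ : ℤ) : ℝ) := by
  simp only [extendPerm, Equiv.Perm.sign_mul, Equiv.Perm.sign_symm, Fin.sign_cycleRange,
    Equiv.Perm.decomposeFin.symm_sign, if_true, one_mul]
  push_cast
  rw [mul_assoc, ← pow_add, ← two_mul, pow_mul]
  simp

/-- A permutation is determined by the image `j` of `i` and by the induced permutation of the
complements; injectivity and the count `(n + 1)! = (n + 1) · n!` suffice. -/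
theorem extendPerm_bijective {n : ℕ} (i : Fin (n + 1)) :
    Function.Bijective fun x : Fin (n + 1) × Equiv.Perm (Fin n) ↦ extendPerm i x.1 x.2 := by
  rw [Fintype.bijective_iff_injective_and_card]
  refine ⟨fun x y h ↦ ?_, ?_⟩
  · have h1 : x.1 = y.1 := by
      rw [← extendPerm_apply_self i x.1 x.2, ← extendPerm_apply_self i y.1 y.2]
      exact DFunLike.congr_fun h i
    refine Prod.ext h1 (Equiv.ext fun k ↦ ?_)
    have h2 := congrFun (extendPerm_comp i x.1 x.2) k
    rw [show extendPerm i x.1 x.2 = extendPerm i y.1 y.2 from h, extendPerm_comp, h1] at h2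
    exact (Fin.succAbove_right_injective h2).symm
  · simp [Fintype.card_perm, Nat.factorial_succ]

/-- Parametrize the permutations by the image `j` of the omitted index `i` and by the rest `ρ`. By
`sign_extendPerm` the sum no longer depends on `i`, so the `n + 1` faces contribute equally and turn
`1 / (n + 1)!` into `1 / n!`. -/
theorem bd_alt (n : ℕ) : bd n (n + 1) (alt (n + 1)) = cobd n n (alt n) := by
  have h : ∀ i : Fin (n + 1), ∑ σ : Equiv.Perm (Fin (n + 1)),
      ((Equiv.Perm.sign σ : ℤ) : ℝ) • (-1 : ℝ) ^ (i : ℕ) •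
        (Finsupp.single ((σ : Fin (n + 1) → Fin (n + 1)) ∘ i.succAbove) 1 : OrdChain n (n + 1)) =
      ∑ j : Fin (n + 1), ∑ ρ : Equiv.Perm (Fin n), (-1 : ℝ) ^ (j : ℕ) •
        ((Equiv.Perm.sign ρ : ℤ) : ℝ) •
        (Finsupp.single (j.succAbove ∘ (ρ : Fin n → Fin n)) 1 : OrdChain n (n + 1)) := by
    intro i
    rw [← Fintype.sum_prod_type' (fun (j : Fin (n + 1)) (ρ : Equiv.Perm (Fin n)) ↦
      (-1 : ℝ) ^ (j : ℕ) • ((Equiv.Perm.sign ρ : ℤ) : ℝ) •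
        (Finsupp.single (j.succAbove ∘ (ρ : Fin n → Fin n)) 1 : OrdChain n (n + 1)))]
    refine (Fintype.sum_bijective _ (extendPerm_bijective i) _ _ fun x ↦ ?_).symm
    rw [smul_smul, smul_smul, sign_extendPerm, extendPerm_comp]
  rw [alt, map_smul, map_sum]
  simp only [map_smul, bd_single, Finset.smul_sum]
  rw [Finset.sum_comm]
  simp only [← Finset.smul_sum]
  rw [Finset.sum_congr rfl fun i _ ↦ h i, Finset.sum_const, Finset.card_univ, Fintype.card_fin,
    alt, map_smul, map_sum]
  simp only [map_smul, cobd_single, Finset.smul_sum]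
  rw [Finset.sum_comm]
  have hf : ((Nat.factorial (n + 1) : ℝ))⁻¹ * ((n + 1 : ℕ) : ℝ) = (Nat.factorial n : ℝ)⁻¹ := by
    rw [Nat.factorial_succ, Nat.cast_mul, mul_inv_rev, mul_assoc, inv_mul_cancel₀, mul_one]
    positivity
  refine Finset.sum_congr rfl fun ρ _ ↦ Finset.sum_congr rfl fun j _ ↦ ?_
  rw [← Nat.cast_smul_eq_nsmul ℝ, smul_smul, hf, smul_comm ((-1 : ℝ) ^ (j : ℕ))]

/-- The contracting homotopy for `fundamental - alt`, built from cones. -/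
def homotopy : (n : ℕ) → OrdChain (n + 1) n
  | 0 => 0
  | n + 1 => cone (n + 1) 0 (fundamental (n + 1) - alt (n + 1) - cobd (n + 1) n (homotopy n))

/-- This allows the recursion for `homotopy` to start with `0`. -/
theorem fundamental_zero : fundamental 0 = alt 0 := by
  rw [alt, fundamental]
  simp

/-- Acyclic models: the chain coned off in the definition of `homotopy` is a cycle, hence the
boundary of its own cone. -/
theorem bd_homotopy (n : ℕ) :
    bd (n + 1) (n + 1) (homotopy (n + 1)) + cobd (n + 1) n (homotopy n) =
      fundamental (n + 1) - alt (n + 1) := by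
  -- Since `fundamental` and `alt` both intertwine `bd` with `cobd`, the boundary equals `cobd` of
  -- the defect of the previous stage. That defect vanishes for `n = 0`, and is itself a `cobd`
  -- otherwise.
  have h : bd n (n + 1) (fundamental (n + 1) - alt (n + 1) - cobd (n + 1) n (homotopy n)) = 0 := by
    rw [map_sub, map_sub, bd_fundamental, bd_alt, bd_cobd, ← map_sub, ← map_sub]
    cases n with
    | zero => rw [homotopy, map_zero, fundamental_zero, sub_self, sub_zero, map_zero]
    | succ n =>
      rw [← bd_homotopy n, add_sub_cancel_left, cobd_cobd]
  rw [homotopy, bd_cone_succ, h, map_zero, sub_zero, sub_add_cancel]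

end OrdChain
end OrderedChains

theorem castSucc_succAbove_last {n : ℕ} (i : Fin (n + 1)) :
    i.castSucc.succAbove (Fin.last n) = Fin.last (n + 1) := by
  rw [Fin.succAbove_of_le_castSucc _ _ (Fin.castSucc_le_castSucc_iff.2 (Fin.le_last i)),
    Fin.succ_last]

/-! ### Cyclic identities: `B² = 0` and `bB + Bb = 0` -/

section CyclicIdentities
variable {EG : Type*} [NormedAddCommGroup EG] [NormedSpace ℝ EG] {G : Type*} [TopologicalSpace G]
  [ChartedSpace EG G] [Group G] [LieGroup 𝓘(ℝ, EG) ∞ G]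
  {E : Type*} [NormedAddCommGroup E] [NormedSpace ℝ E] {M : Type*} [TopologicalSpace M]
  [ChartedSpace E M] [IsManifold 𝓘(ℝ, E) ∞ M] [MulAction G M]
  [ContMDiffSMul 𝓘(ℝ, EG) 𝓘(ℝ, E) ∞ G M]

theorem cyc_coface_succ (n q : ℕ) (i : Fin (n + 1)) (c : Coch EG G E M n q) :
    cyc (n + 1) q (coface n q i.succ c) = coface n q i.castSucc (cyc n q c) := by
  rw [cyc_eq, coface_eq, cyc_eq, coface_eq, ← LinearMap.comp_apply, simplexMap_comp,
    ← LinearMap.comp_apply, simplexMap_comp]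
  congr 2
  funext k
  refine Fin.cases ?_ (fun k ↦ ?_) k
  · rw [Function.comp_apply, Function.comp_apply, Fin.succ_succAbove_zero, rot_zero, rot_zero,
      castSucc_succAbove_last]
  · rw [Function.comp_apply, Function.comp_apply, Fin.succ_succAbove_succ, rot_succ, rot_succ,
      Fin.castSucc_succAbove_castSucc]

theorem cyc_coface_zero (n q : ℕ) (c : Coch EG G E M n q) :
    cyc (n + 1) q (coface n q 0 c) = coface n q (Fin.last (n + 1)) c := by
  rw [cyc_eq, coface_eq, coface_eq, ← LinearMap.comp_apply, simplexMap_comp]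
  congr 2
  funext k
  rw [Function.comp_apply, Fin.succAbove_zero, rot_succ, Fin.succAbove_last]

/-- The extra codegeneracy. -/
def extraDegeneracy (n q : ℕ) : Coch EG G E M (n + 1) q →ₗ[ℝ] Coch EG G E M n q :=
  codeg n q (Fin.last n) ∘ₗ cyc (n + 1) q

theorem extraDegeneracy_eq (n q : ℕ) :
    (extraDegeneracy n q : Coch EG G E M (n + 1) q →ₗ[ℝ] _) =
      simplexMap q ((Fin.last n).predAbove ∘ rot (n + 1)) := by
  rw [extraDegeneracy, codeg_eq, cyc_eq, simplexMap_comp]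

theorem extraDegeneracy_coface_zero (n q : ℕ) (c : Coch EG G E M n q) :
    extraDegeneracy n q (coface n q 0 c) = c := by
  rw [extraDegeneracy_eq, coface_eq, ← LinearMap.comp_apply, simplexMap_comp]
  have h : ((Fin.last n).predAbove ∘ rot (n + 1)) ∘ Fin.succAbove 0 = id := by
    funext k
    rw [Function.comp_apply, Function.comp_apply, Fin.succAbove_zero, rot_succ,
      Fin.predAbove_last_castSucc]
    rfl
  rw [h, simplexMap_id]
  rfl

/-- Together with `extraDegeneracy_coface_zero` this covers all cofaces except the last one, so the
extra codegeneracy contracts the truncated coboundary `b'`. -/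
theorem extraDegeneracy_coface_succ (n q : ℕ) (i : Fin (n + 1)) (c : Coch EG G E M (n + 1) q) :
    extraDegeneracy (n + 1) q (coface (n + 1) q i.succ.castSucc c) =
      coface n q i.castSucc (extraDegeneracy n q c) := by
  rw [extraDegeneracy_eq, extraDegeneracy_eq, coface_eq, coface_eq, ← LinearMap.comp_apply,
    simplexMap_comp, ← LinearMap.comp_apply, simplexMap_comp]
  congr 2
  funext k
  simp only [Function.comp_apply, ← Fin.succ_castSucc]
  refine Fin.cases ?_ (fun k ↦ ?_) k
  · rw [Fin.succ_succAbove_zero, rot_zero, rot_zero, Fin.predAbove_right_last,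
      Fin.predAbove_right_last, castSucc_succAbove_last]
  · rw [Fin.succ_succAbove_succ, rot_succ, rot_succ, Fin.predAbove_last_castSucc,
      Fin.predAbove_last_castSucc]

theorem simplexMap_pow {n : ℕ} (q : ℕ) (φ : Fin (n + 1) → Fin (n + 1)) (k : ℕ) :
    (simplexMap q φ : Coch EG G E M n q →ₗ[ℝ] _) ^ k = simplexMap q φ^[k] := by
  induction k with
  | zero => exact (simplexMap_id n q).symm
  | succ k ih =>
    rw [pow_succ, ih, Function.iterate_succ, Module.End.mul_eq_comp, simplexMap_comp]

theorem rot_iterate (n : ℕ) : (rot n)^[n + 1] = id := by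
  -- In the cyclic group `Fin (n + 1)` the rotation is subtraction of `1`, so its order divides `n +
  -- 1`.
  have h : ∀ i, rot n i = i - 1 := fun i ↦ by
    rw [rot, Equiv.symm_apply_eq, finRotate_apply, sub_add_cancel]
  have h' : ∀ (k : ℕ) (i : Fin (n + 1)), (rot n)^[k] i = i - k • 1 := by
    intro k
    induction k with
    | zero => simp
    | succ k ih =>
      intro i
      rw [Function.iterate_succ_apply, ih, h, succ_nsmul', sub_sub]
  funext i
  have h0 := card_nsmul_eq_zero (x := (1 : Fin (n + 1)))
  rw [Fintype.card_fin] at h0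
  rw [h', h0, sub_zero]
  rfl

/-- The total sign is `(-1)^(n(n+1)) = 1`. -/
theorem cycSigned_pow (n q : ℕ) :
    (cycSigned n q : Coch EG G E M n q →ₗ[ℝ] _) ^ (n + 1) = 1 := by
  rw [cycSigned, smul_pow, cyc_eq, simplexMap_pow, rot_iterate, simplexMap_id, ← pow_mul,
    Even.neg_one_pow (Nat.even_mul_succ_self n), one_smul]
  rfl

/-- The geometric sum gives `N (1 - λ) = 1 - λ^(n+1) = 0`. -/
theorem cycNorm_cycSigned (n q : ℕ) (c : Coch EG G E M n q) :
    cycNorm n q (cycSigned n q c) = cycNorm n q c := by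
  have h := geom_sum_mul_neg (cycSigned n q : Module.End ℝ (Coch EG G E M n q)) (n + 1)
  rw [cycSigned_pow, sub_self] at h
  have := DFunLike.congr_fun h c
  rw [Module.End.mul_apply, LinearMap.sub_apply, map_sub] at this
  exact (sub_eq_zero.1 this).symm

theorem cycSigned_cycNorm (n q : ℕ) (c : Coch EG G E M n q) :
    cycSigned n q (cycNorm n q c) = cycNorm n q c := by
  have h := mul_neg_geom_sum (cycSigned n q : Module.End ℝ (Coch EG G E M n q)) (n + 1)
  rw [cycSigned_pow, sub_self] at h
  have := DFunLike.congr_fun h c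
  exact (sub_eq_zero.1 this).symm

theorem connesB_apply (n q : ℕ) (c : Coch EG G E M (n + 1) q) :
    connesB n q c = cycNorm n q (extraDegeneracy n q (c - cycSigned (n + 1) q c)) := rfl

/-- The product contains `(1 - λ) N = 0`. -/
theorem connesB_connesB (n q : ℕ) (c : Coch EG G E M (n + 2) q) :
    connesB n q (connesB (n + 1) q c) = 0 := by
  rw [connesB_apply n, connesB_apply (n + 1), cycSigned_cycNorm, sub_self, map_zero, map_zero]

/-- The summand `(-1)^i δ_i` of the Hochschild coboundary. -/
def signedFace (n q : ℕ) (i : Fin (n + 2)) : Coch EG G E M n q →ₗ[ℝ] Coch EG G E M (n + 1) q :=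
  (-1 : ℝ) ^ (i : ℕ) • coface n q i

theorem signedFace_apply (n q : ℕ) (i : Fin (n + 2)) (c : Coch EG G E M n q) :
    signedFace n q i c = (-1 : ℝ) ^ (i : ℕ) • coface n q i c := rfl

/-- The sign of `λ` changes by one between the two degrees, and so does the sign of the face; hence
no sign is left over. -/
theorem cycSigned_signedFace_succ (n q : ℕ) (i : Fin (n + 1)) (c : Coch EG G E M n q) :
    cycSigned (n + 1) q (signedFace n q i.succ c) =
      signedFace n q i.castSucc (cycSigned n q c) := by
  simp only [cycSigned, signedFace, LinearMap.smul_apply, map_smul, cyc_coface_succ, smul_smul,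
    Fin.val_succ, Fin.val_castSucc]
  congr 1
  ring_nf

theorem cycSigned_signedFace_zero (n q : ℕ) (c : Coch EG G E M n q) :
    cycSigned (n + 1) q (signedFace n q 0 c) = signedFace n q (Fin.last (n + 1)) c := by
  simp only [cycSigned, signedFace, LinearMap.smul_apply, map_smul, cyc_coface_zero, smul_smul,
    Fin.val_zero, Fin.val_last, pow_zero, one_mul]

theorem hochschild_apply (n q : ℕ) (c : Coch EG G E M n q) :
    hochschild n q c = ∑ i : Fin (n + 2), signedFace n q i c := LinearMap.sum_apply _ _ _

/-- The truncated coboundary `b' = ∑_{i ≤ n} (-1)^i δ_i : C^n → C^{n+1}`. -/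
def truncHochschild (n q : ℕ) : Coch EG G E M n q →ₗ[ℝ] Coch EG G E M (n + 1) q :=
  ∑ i : Fin (n + 1), signedFace n q i.castSucc

theorem truncHochschild_apply (n q : ℕ) (c : Coch EG G E M n q) :
    truncHochschild n q c = ∑ i : Fin (n + 1), signedFace n q i.castSucc c :=
  LinearMap.sum_apply _ _ _

/-- The relation `(1 - λ) b = b' (1 - λ)`: `λ` lowers the index of each signed face by one and
carries face `0` to the last face, which then cancels against the last term of `b`. -/
theorem hochschild_sub_cycSigned (n q : ℕ) (c : Coch EG G E M n q) :
    hochschild n q c - cycSigned (n + 1) q (hochschild n q c) =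
      truncHochschild n q (c - cycSigned n q c) := by
  have h : cycSigned (n + 1) q (hochschild n q c) =
      truncHochschild n q (cycSigned n q c) + signedFace n q (Fin.last (n + 1)) c := by
    rw [hochschild_apply, Fin.sum_univ_succ, map_add, map_sum, cycSigned_signedFace_zero,
      truncHochschild_apply]
    simp only [cycSigned_signedFace_succ]
    exact add_comm _ _
  rw [h, hochschild_apply, Fin.sum_univ_castSucc, ← truncHochschild_apply, map_sub]
  abel

theorem extraDegeneracy_truncHochschild_zero (q : ℕ) (c : Coch EG G E M 0 q) :
    extraDegeneracy 0 q (truncHochschild 0 q c) = c := by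
  rw [truncHochschild_apply, Fin.sum_univ_one]
  rw [signedFace_apply, Fin.castSucc_zero, Fin.val_zero, pow_zero, one_smul,
    extraDegeneracy_coface_zero]

/-- Face `0` yields the identity. The other faces pass through the extra codegeneracy with index
lowered by one, hence with opposite sign, and cancel against the second term. -/
theorem extraDegeneracy_truncHochschild (n q : ℕ) (c : Coch EG G E M (n + 1) q) :
    extraDegeneracy (n + 1) q (truncHochschild (n + 1) q c) +
      truncHochschild n q (extraDegeneracy n q c) = c := by
  have h : ∀ i : Fin (n + 1), extraDegeneracy (n + 1) q (signedFace (n + 1) q i.succ.castSucc c) =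
      -signedFace n q i.castSucc (extraDegeneracy n q c) := fun i ↦ by
    rw [signedFace_apply, signedFace_apply, map_smul, extraDegeneracy_coface_succ,
      Fin.val_castSucc, Fin.val_succ, Fin.val_castSucc, pow_succ, mul_neg_one, neg_smul]
  rw [truncHochschild_apply, truncHochschild_apply, Fin.sum_univ_succ, map_add, map_sum,
    Finset.sum_congr rfl fun i _ ↦ h i, Finset.sum_neg_distrib, neg_add_cancel_right]
  rw [signedFace_apply, Fin.castSucc_zero, Fin.val_zero, pow_zero, one_smul,
    extraDegeneracy_coface_zero]

theorem cycNorm_apply (n q : ℕ) (c : Coch EG G E M n q) :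
    cycNorm n q c = ∑ i : Fin (n + 1), (cycSigned n q ^ (i : ℕ)) c := by
  rw [cycNorm, LinearMap.sum_apply, Finset.sum_range]

/-- The relation `N b' = b N`: with `d_0` denoting the signed face `0`, both sides equal `N d_0 N`.
-/
theorem cycNorm_truncHochschild (n q : ℕ) (c : Coch EG G E M n q) :
    cycNorm (n + 1) q (truncHochschild n q c) = hochschild n q (cycNorm n q c) := by
  -- Under `N` a factor `λ` on the left is free; each one lowers the face index and passes to the
  -- argument.
  have h1 : ∀ (i : Fin (n + 2)) (e : Coch EG G E M n q), cycNorm (n + 1) q (signedFace n q i e) =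
      cycNorm (n + 1) q (signedFace n q 0 ((cycSigned n q ^ (i : ℕ)) e)) := by
    intro i
    induction i using Fin.induction with
    | zero => exact fun e ↦ rfl
    | succ i ih =>
      intro e
      rw [← cycNorm_cycSigned, cycSigned_signedFace_succ, ih]
      rfl
  -- On invariant cochains all signed faces are `λ`-translates of face `0`. The induction descends
  -- from the last face, which is `λ` applied to face `0`.
  have h2 : ∀ (i : Fin (n + 2)) (e : Coch EG G E M n q), cycSigned n q e = e →
      signedFace n q i e = (cycSigned (n + 1) q ^ (n + 2 - (i : ℕ))) (signedFace n q 0 e) := by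
    intro i e he
    induction i using Fin.reverseInduction with
    | last =>
      rw [← cycSigned_signedFace_zero, Fin.val_last, Nat.add_sub_add_left, pow_one]
    | cast i ih =>
      conv_lhs => rw [← he]
      rw [← cycSigned_signedFace_succ, ih, Fin.val_succ, Fin.val_castSucc,
        show n + 2 - (i : ℕ) = (n + 2 - ((i : ℕ) + 1)) + 1 by omega, pow_succ']
      rfl
  rw [truncHochschild_apply, map_sum, Finset.sum_congr rfl fun i _ ↦ h1 i.castSucc c]
  simp only [Fin.val_castSucc]
  -- The exponents `n + 2 - i` run through `1, …, n + 2`. Reversing the order of summation and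
  -- inserting one free `λ` after `N` makes the two sums agree term by term.
  rw [← map_sum, ← map_sum, ← cycNorm_apply, hochschild_apply,
    Finset.sum_congr rfl fun i _ ↦ h2 i _ (cycSigned_cycNorm n q c), ← Equiv.sum_comp Fin.revPerm,
    ← cycNorm_cycSigned, cycNorm_apply]
  refine Finset.sum_congr rfl fun i _ ↦ ?_
  rw [Fin.revPerm_apply, Fin.val_rev, show n + 2 - (n + 2 - ((i : ℕ) + 1)) = (i : ℕ) + 1 by omega,
    pow_succ]
  rfl

theorem connesB_hochschild_zero (q : ℕ) (c : Coch EG G E M 0 q) :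
    connesB 0 q (hochschild 0 q c) = 0 := by
  rw [connesB_apply, hochschild_sub_cycSigned, extraDegeneracy_truncHochschild_zero, map_sub,
    cycNorm_cycSigned, sub_self]

/-- With `s` the extra codegeneracy, `Bb = N s b' (1 - λ)` and `bB = N b' s (1 - λ)`. Since `s b' +
b' s = 1`, the sum is `N (1 - λ) = 0`. -/
theorem connesB_hochschild (n q : ℕ) (c : Coch EG G E M (n + 1) q) :
    connesB (n + 1) q (hochschild (n + 1) q c) + hochschild n q (connesB n q c) = 0 := by
  rw [connesB_apply, connesB_apply, hochschild_sub_cycSigned, ← cycNorm_truncHochschild, ← map_add,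
    extraDegeneracy_truncHochschild, map_sub, cycNorm_cycSigned, sub_self]

end CyclicIdentities

/-! ### Antisymmetrized cochains, the homotopy, and compatibility with `d` -/

section Antisymmetrization
variable {EG : Type*} [NormedAddCommGroup EG] [NormedSpace ℝ EG] {G : Type*} [TopologicalSpace G]
  [ChartedSpace EG G] [Group G] [LieGroup 𝓘(ℝ, EG) ∞ G]
  {E : Type*} [NormedAddCommGroup E] [NormedSpace ℝ E] {M : Type*} [TopologicalSpace M]
  [ChartedSpace E M] [IsManifold 𝓘(ℝ, E) ∞ M] [MulAction G M]
  [ContMDiffSMul 𝓘(ℝ, EG) 𝓘(ℝ, E) ∞ G M]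

/-- The operator `C^n → C^m` given by an ordered chain of dimension `n` in the `m`-simplex. -/
def chainOp {n m : ℕ} (q : ℕ) :
    OrdChain (n + 1) (m + 1) →ₗ[ℝ] Coch EG G E M n q →ₗ[ℝ] Coch EG G E M m q :=
  Finsupp.linearCombination ℝ (simplexMap q)

theorem chainOp_single {n m : ℕ} (q : ℕ) (φ : Fin (n + 1) → Fin (m + 1)) (r : ℝ) :
    (chainOp q (Finsupp.single φ r) : Coch EG G E M n q →ₗ[ℝ] _) = r • simplexMap q φ :=
  Finsupp.linearCombination_single ℝ r φ

theorem hochschild_apply_simplexMap (n q : ℕ) (c : Coch EG G E M n q) :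
    hochschild n q c = ∑ i : Fin (n + 2), (-1 : ℝ) ^ (i : ℕ) • simplexMap q i.succAbove c := by
  simp only [hochschild_apply, signedFace_apply, coface_eq]

/-- This and `hochschild_chainOp` translate composition with `b` on either side into `bd` and
`cobd`, so identities between ordered chains become identities between operators on cochains. -/
theorem chainOp_hochschild {n m : ℕ} (q : ℕ) (x : OrdChain (n + 2) (m + 1))
    (c : Coch EG G E M n q) :
    chainOp q x (hochschild n q c) = chainOp q (OrdChain.bd (n + 1) (m + 1) x) c := by
  induction x using Finsupp.induction_linear with
  | zero => simp only [map_zero, LinearMap.zero_apply]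
  | add x y hx hy => simp only [map_add, LinearMap.add_apply, hx, hy]
  | single φ r =>
    rw [OrdChain.bd_single, map_sum, LinearMap.sum_apply, hochschild_apply_simplexMap, map_sum]
    refine Finset.sum_congr rfl fun i _ ↦ ?_
    rw [map_smul, map_smul, LinearMap.smul_apply, chainOp_single, chainOp_single,
      LinearMap.smul_apply, LinearMap.smul_apply, ← simplexMap_comp]
    rfl

theorem hochschild_chainOp {n m : ℕ} (q : ℕ) (x : OrdChain (n + 1) (m + 1))
    (c : Coch EG G E M n q) :
    hochschild m q (chainOp q x c) = chainOp q (OrdChain.cobd (n + 1) (m + 1) x) c := by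
  induction x using Finsupp.induction_linear with
  | zero => simp only [map_zero, LinearMap.zero_apply]
  | add x y hx hy => simp only [map_add, LinearMap.add_apply, hx, hy]
  | single φ r =>
    rw [OrdChain.cobd_single, map_sum, LinearMap.sum_apply, hochschild_apply_simplexMap]
    refine Finset.sum_congr rfl fun i _ ↦ ?_
    rw [map_smul, LinearMap.smul_apply, chainOp_single, chainOp_single,
      LinearMap.smul_apply, LinearMap.smul_apply, map_smul, ← simplexMap_comp]
    rfl

theorem chainOp_fundamental (n q : ℕ) (c : Coch EG G E M n q) :
    chainOp q (OrdChain.fundamental (n + 1)) c = c := by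
  rw [OrdChain.fundamental, chainOp_single, simplexMap_id, one_smul, LinearMap.id_apply]

theorem hochschild_hochschild (n q : ℕ) (c : Coch EG G E M n q) :
    hochschild (n + 1) q (hochschild n q c) = 0 := by
  rw [← chainOp_fundamental n q c, hochschild_chainOp, hochschild_chainOp, OrdChain.cobd_cobd,
    map_zero, LinearMap.zero_apply]

/-- Antisymmetrization of cochains. -/
def antisym (n q : ℕ) : Coch EG G E M n q →ₗ[ℝ] Coch EG G E M n q :=
  chainOp q (OrdChain.alt (n + 1))

/-- The homotopy between the identity and the antisymmetrization. -/
def antisymHomotopy (n q : ℕ) : Coch EG G E M (n + 1) q →ₗ[ℝ] Coch EG G E M n q :=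
  chainOp q (OrdChain.homotopy (n + 1))

theorem hochschild_antisym (n q : ℕ) (c : Coch EG G E M n q) :
    hochschild n q (antisym n q c) = antisym (n + 1) q (hochschild n q c) := by
  rw [antisym, antisym, hochschild_chainOp, chainOp_hochschild, OrdChain.bd_alt]

theorem antisymHomotopy_hochschild_zero (q : ℕ) (c : Coch EG G E M 0 q) :
    antisymHomotopy 0 q (hochschild 0 q c) = c - antisym 0 q c := by
  have h := OrdChain.bd_homotopy 0
  rw [show OrdChain.homotopy 0 = 0 from rfl, map_zero, add_zero] at h
  rw [antisymHomotopy, chainOp_hochschild, h, map_sub, LinearMap.sub_apply, chainOp_fundamental,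
    antisym]

theorem antisymHomotopy_hochschild (n q : ℕ) (c : Coch EG G E M (n + 1) q) :
    antisymHomotopy (n + 1) q (hochschild (n + 1) q c) + hochschild n q (antisymHomotopy n q c) =
      c - antisym (n + 1) q c := by
  rw [antisymHomotopy, antisymHomotopy, chainOp_hochschild, hochschild_chainOp,
    ← LinearMap.add_apply, ← map_add, OrdChain.bd_homotopy, map_sub, LinearMap.sub_apply,
    chainOp_fundamental, antisym]

theorem simplexMap_chainOp {n m m' : ℕ} (q : ℕ) (φ : Fin (m + 1) → Fin (m' + 1))
    (x : OrdChain (n + 1) (m + 1)) (c : Coch EG G E M n q) :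
    simplexMap q φ (chainOp q x c) = chainOp q (OrdChain.push (n + 1) φ x) c := by
  induction x using Finsupp.induction_linear with
  | zero => simp only [map_zero, LinearMap.zero_apply]
  | add x y hx hy => simp only [map_add, LinearMap.add_apply, hx, hy]
  | single ψ r =>
    rw [OrdChain.push_single, chainOp_single, chainOp_single, LinearMap.smul_apply,
      LinearMap.smul_apply, map_smul, ← simplexMap_comp]
    rfl

/-- The rotation of `n + 1` vertices has sign `(-1)^n`, which cancels the sign in `λ`. -/
theorem cycSigned_antisym (n q : ℕ) (c : Coch EG G E M n q) :
    cycSigned n q (antisym n q c) = antisym n q c := by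
  have h := OrdChain.push_alt (finRotate (n + 1)).symm
  rw [Equiv.Perm.sign_symm, sign_finRotate, Nat.add_sub_cancel] at h
  rw [cycSigned, cyc_eq, antisym, LinearMap.smul_apply, simplexMap_chainOp,
    show OrdChain.push (n + 1) (rot n) (OrdChain.alt (n + 1)) = _ from h, map_smul,
    LinearMap.smul_apply, smul_smul]
  push_cast
  rw [← mul_pow, neg_one_mul, neg_neg, one_pow, one_smul]

/-- `B` begins with `1 - λ`, which vanishes on antisymmetric cochains. -/
theorem connesB_antisym (n q : ℕ) (c : Coch EG G E M (n + 1) q) :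
    connesB n q (antisym (n + 1) q c) = 0 := by
  rw [connesB_apply, cycSigned_antisym, sub_self, map_zero, map_zero]

/-- A substitution of vertices acts on forms only by pullbacks, with which `d` commutes. All
operators below are built from such substitutions and therefore commute with `d`. -/
theorem dFamily_simplexMap {n m : ℕ} (q : ℕ) (φ : Fin (n + 1) → Fin (m + 1))
    (c : Coch EG G E M n q) :
    dFamily q (simplexMap q φ c) = simplexMap (q + 1) φ (dFamily q c) :=
  FormFamily.ext (funext fun g ↦ dForm_formPullback _ _ q (c.1 (pullTuple φ g)))

set_option linter.unusedSectionVars false in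
theorem dFamily_dFamily {n : ℕ} (q : ℕ) (c : Coch EG G E M n q) :
    dFamily (q + 1) (dFamily q c) = 0 :=
  FormFamily.ext (funext fun g ↦ dForm_dForm q (c.1 g))

theorem dFamily_chainOp {n m : ℕ} (q : ℕ) (x : OrdChain (n + 1) (m + 1))
    (c : Coch EG G E M n q) :
    dFamily q (chainOp q x c) = chainOp (q + 1) x (dFamily q c) := by
  induction x using Finsupp.induction_linear with
  | zero => simp only [map_zero, LinearMap.zero_apply]
  | add x y hx hy => simp only [map_add, LinearMap.add_apply, hx, hy]
  | single ψ r =>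
    rw [chainOp_single, chainOp_single, LinearMap.smul_apply, LinearMap.smul_apply, map_smul,
      dFamily_simplexMap]

theorem dFamily_hochschild (n q : ℕ) (c : Coch EG G E M n q) :
    dFamily q (hochschild n q c) = hochschild n (q + 1) (dFamily q c) := by
  simp only [hochschild_apply_simplexMap, map_sum, map_smul, dFamily_simplexMap]

theorem dFamily_cycSigned (n q : ℕ) (c : Coch EG G E M n q) :
    dFamily q (cycSigned n q c) = cycSigned n (q + 1) (dFamily q c) := by
  simp only [cycSigned, cyc_eq, LinearMap.smul_apply, map_smul, dFamily_simplexMap]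

theorem dFamily_cycNorm (n q : ℕ) (c : Coch EG G E M n q) :
    dFamily q (cycNorm n q c) = cycNorm n (q + 1) (dFamily q c) := by
  rw [cycNorm_apply, cycNorm_apply, map_sum]
  refine Finset.sum_congr rfl fun i _ ↦ ?_
  induction (i : ℕ) with
  | zero => rfl
  | succ k ih =>
    rw [pow_succ', pow_succ', Module.End.mul_apply, Module.End.mul_apply, dFamily_cycSigned, ih]

theorem dFamily_connesB (n q : ℕ) (c : Coch EG G E M (n + 1) q) :
    dFamily q (connesB n q c) = connesB n (q + 1) (dFamily q c) := by
  rw [connesB_apply, connesB_apply, dFamily_cycNorm, extraDegeneracy_eq, extraDegeneracy_eq,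
    dFamily_simplexMap, map_sub, dFamily_cycSigned]

end Antisymmetrization

/-! ### The total complex: lifting cocycles and exactness of the columns -/

section TotalComplex
set_option linter.unusedSectionVars false
variable {EG : Type*} [NormedAddCommGroup EG] [NormedSpace ℝ EG] {G : Type*} [TopologicalSpace G]
  [ChartedSpace EG G] [Group G] [LieGroup 𝓘(ℝ, EG) ∞ G]
  {E : Type*} [NormedAddCommGroup E] [NormedSpace ℝ E] {M : Type*} [TopologicalSpace M]
  [ChartedSpace E M] [IsManifold 𝓘(ℝ, E) ∞ M] [MulAction G M]
  [ContMDiffSMul 𝓘(ℝ, EG) 𝓘(ℝ, E) ∞ G M]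

variable (EG G E M)

/-- The part `b` of the total differential. -/
def hcHochschild : Bicomplex EG G E M →ₗ[ℝ] Bicomplex EG G E M :=
  LinearMap.pi fun p ↦ LinearMap.pi fun q ↦ LinearMap.pi fun k ↦ totalPartHochschild EG G E M p q k

/-- The part `±d` of the total differential. -/
def hcForm : Bicomplex EG G E M →ₗ[ℝ] Bicomplex EG G E M :=
  LinearMap.pi fun p ↦ LinearMap.pi fun q ↦ LinearMap.pi fun k ↦ totalPartForm EG G E M p q k

/-- The part `B` of the total differential. -/
def hcConnes : Bicomplex EG G E M →ₗ[ℝ] Bicomplex EG G E M :=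
  LinearMap.pi fun p ↦ LinearMap.pi fun q ↦ LinearMap.pi fun k ↦ totalPartConnes EG G E M p q k

variable {EG G E M}

theorem hcD_apply (c : Bicomplex EG G E M) :
    hcD EG G E M c = hcHochschild EG G E M c + hcForm EG G E M c + hcConnes EG G E M c := rfl

theorem hcHochschild_zero (c : Bicomplex EG G E M) (q k : ℕ) :
    hcHochschild EG G E M c 0 q k = 0 := rfl

theorem hcHochschild_succ (c : Bicomplex EG G E M) (p q k : ℕ) :
    hcHochschild EG G E M c (p + 1) q k = hochschild p q (c p q k) := rfl

theorem hcForm_zero (c : Bicomplex EG G E M) (p k : ℕ) : hcForm EG G E M c p 0 k = 0 := by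
  cases p <;> rfl

theorem hcForm_succ (c : Bicomplex EG G E M) (p q k : ℕ) :
    hcForm EG G E M c p (q + 1) k = (-1 : ℝ) ^ p • dFamily q (c p q k) := by
  cases p <;> rfl

theorem hcConnes_zero (c : Bicomplex EG G E M) (p q : ℕ) : hcConnes EG G E M c p q 0 = 0 := by
  cases p <;> cases q <;> rfl

theorem hcConnes_succ (c : Bicomplex EG G E M) (p q k : ℕ) :
    hcConnes EG G E M c p q (k + 1) = connesB p q (c (p + 1) q k) := by
  cases p <;> cases q <;> rfl

theorem hcHochschild_hcHochschild (c : Bicomplex EG G E M) :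
    hcHochschild EG G E M (hcHochschild EG G E M c) = 0 := by
  funext p q k
  match p with
  | 0 => rfl
  | 1 => rw [hcHochschild_succ, hcHochschild_zero, map_zero]; rfl
  | p + 2 => rw [hcHochschild_succ, hcHochschild_succ, hochschild_hochschild]; rfl

theorem hcForm_hcForm (c : Bicomplex EG G E M) : hcForm EG G E M (hcForm EG G E M c) = 0 := by
  funext p q k
  match q with
  | 0 => exact hcForm_zero _ p k
  | 1 => rw [hcForm_succ, hcForm_zero, map_zero, smul_zero]; rfl
  | q + 2 => rw [hcForm_succ, hcForm_succ, map_smul, dFamily_dFamily, smul_zero, smul_zero]; rfl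

theorem hcConnes_hcConnes (c : Bicomplex EG G E M) :
    hcConnes EG G E M (hcConnes EG G E M c) = 0 := by
  funext p q k
  match k with
  | 0 => exact hcConnes_zero _ p q
  | 1 => rw [hcConnes_succ, hcConnes_zero, map_zero]; rfl
  | k + 2 => rw [hcConnes_succ, hcConnes_succ, connesB_connesB]; rfl

theorem hcHochschild_hcForm (c : Bicomplex EG G E M) :
    hcHochschild EG G E M (hcForm EG G E M c) = -hcForm EG G E M (hcHochschild EG G E M c) := by
  funext p q k
  rw [Pi.neg_apply, Pi.neg_apply, Pi.neg_apply]
  match p, q with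
  | 0, 0 => rw [hcHochschild_zero, hcForm_zero, neg_zero]
  | 0, q + 1 => rw [hcHochschild_zero, hcForm_succ, hcHochschild_zero, map_zero, smul_zero, neg_zero]
  | p + 1, 0 => rw [hcHochschild_succ, hcForm_zero, map_zero, hcForm_zero, neg_zero]
  | p + 1, q + 1 =>
    rw [hcHochschild_succ, hcForm_succ, hcForm_succ, hcHochschild_succ, map_smul,
      dFamily_hochschild, pow_succ, mul_neg_one, neg_smul, neg_neg]

theorem hcHochschild_hcConnes (c : Bicomplex EG G E M) :
    hcHochschild EG G E M (hcConnes EG G E M c) =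
      -hcConnes EG G E M (hcHochschild EG G E M c) := by
  funext p q k
  rw [Pi.neg_apply, Pi.neg_apply, Pi.neg_apply]
  match p, k with
  | 0, 0 => rw [hcHochschild_zero, hcConnes_zero, neg_zero]
  | p + 1, 0 => rw [hcHochschild_succ, hcConnes_zero, map_zero, hcConnes_zero, neg_zero]
  | 0, k + 1 =>
    rw [hcHochschild_zero, hcConnes_succ, hcHochschild_succ, connesB_hochschild_zero, neg_zero]
  | p + 1, k + 1 =>
    rw [hcHochschild_succ, hcConnes_succ, hcConnes_succ, hcHochschild_succ]
    exact eq_neg_of_add_eq_zero_right (connesB_hochschild p q _)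

theorem hcForm_hcConnes (c : Bicomplex EG G E M) :
    hcForm EG G E M (hcConnes EG G E M c) = -hcConnes EG G E M (hcForm EG G E M c) := by
  funext p q k
  rw [Pi.neg_apply, Pi.neg_apply, Pi.neg_apply]
  match q, k with
  | 0, 0 => rw [hcForm_zero, hcConnes_zero, neg_zero]
  | q + 1, 0 => rw [hcForm_succ, hcConnes_zero, map_zero, smul_zero, hcConnes_zero, neg_zero]
  | 0, k + 1 => rw [hcForm_zero, hcConnes_succ, hcForm_zero, map_zero, neg_zero]
  | q + 1, k + 1 =>
    rw [hcForm_succ, hcConnes_succ, hcConnes_succ, hcForm_succ, map_smul, dFamily_connesB, pow_succ,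
      mul_neg_one, neg_smul, neg_neg]

/-- The three parts `b`, `±d` and `B` square to zero and anticommute pairwise. The sign `(-1)^p`
makes `d` anticommute with `b` and `B`, both of which change `p` by one. -/
theorem hcD_hcD (c : Bicomplex EG G E M) : hcD EG G E M (hcD EG G E M c) = 0 := by
  rw [hcD_apply, hcD_apply]
  simp only [map_add]
  rw [hcHochschild_hcHochschild, hcForm_hcForm, hcConnes_hcConnes, hcHochschild_hcForm,
    hcHochschild_hcConnes, hcForm_hcConnes]
  abel

theorem hcD_mem_cochains {m : ℕ} {c : Bicomplex EG G E M} (hc : c ∈ hcCochains EG G E M m) :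
    hcD EG G E M c ∈ hcCochains EG G E M (m + 1) := by
  intro p q k h
  have h1 : hcHochschild EG G E M c p q k = 0 := by
    cases p with
    | zero => rfl
    | succ p => rw [hcHochschild_succ, hc p q k (by omega), map_zero]
  have h2 : hcForm EG G E M c p q k = 0 := by
    cases q with
    | zero => exact hcForm_zero c p k
    | succ q => rw [hcForm_succ, hc p q k (by omega), map_zero, smul_zero]
  have h3 : hcConnes EG G E M c p q k = 0 := by
    cases k with
    | zero => exact hcConnes_zero c p q
    | succ k => rw [hcConnes_succ, hc (p + 1) q k (by omega), map_zero]
  rw [hcD_apply, Pi.add_apply, Pi.add_apply, Pi.add_apply, Pi.add_apply, Pi.add_apply,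
    Pi.add_apply, h1, h2, h3, add_zero, add_zero]

/-- The inclusion of the column `k = 0`. -/
def columnZero (c : DiffCochains EG G E M) : Bicomplex EG G E M
  | p, q, 0 => c p q
  | _, _, _ + 1 => 0

theorem columnZero_mem_cochains {m : ℕ} {c : DiffCochains EG G E M}
    (hc : c ∈ diffCochains EG G E M m) : columnZero c ∈ hcCochains EG G E M m
  | p, q, 0, h => hc p q h
  | _, _, _ + 1, _ => rfl

theorem projI_columnZero (c : DiffCochains EG G E M) : projI EG G E M (columnZero c) = c := rfl

/-- Antisymmetrization of all components. -/
def totalAntisym : DiffCochains EG G E M →ₗ[ℝ] DiffCochains EG G E M :=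
  LinearMap.pi fun p ↦ LinearMap.pi fun q ↦ antisym p q ∘ₗ diffProj EG G E M p q

/-- The homotopy between the identity and the antisymmetrization on the total complex. -/
def totalHomotopy : DiffCochains EG G E M →ₗ[ℝ] DiffCochains EG G E M :=
  LinearMap.pi fun p ↦ LinearMap.pi fun q ↦ antisymHomotopy p q ∘ₗ diffProj EG G E M (p + 1) q

theorem totalAntisym_apply (c : DiffCochains EG G E M) (p q : ℕ) :
    totalAntisym c p q = antisym p q (c p q) := rfl

theorem totalHomotopy_apply (c : DiffCochains EG G E M) (p q : ℕ) :
    totalHomotopy c p q = antisymHomotopy p q (c (p + 1) q) := rfl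

theorem diffD_apply (c : DiffCochains EG G E M) (p q : ℕ) :
    diffD EG G E M c p q = diffPartGroup EG G E M p q c + diffPartForm EG G E M p q c := rfl

theorem diffPartGroup_succ (c : DiffCochains EG G E M) (p q : ℕ) :
    diffPartGroup EG G E M (p + 1) q c = hochschild p q (c p q) := by
  rw [hochschild_eq_groupD]
  rfl

theorem diffPartForm_zero (c : DiffCochains EG G E M) (p : ℕ) :
    diffPartForm EG G E M p 0 c = 0 := by
  cases p <;> rfl

theorem diffPartForm_succ (c : DiffCochains EG G E M) (p q : ℕ) :
    diffPartForm EG G E M p (q + 1) c = (-1 : ℝ) ^ p • dFamily q (c p q) := by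
  cases p <;> rfl

theorem diffPartGroup_totalAntisym (c : DiffCochains EG G E M) (p q : ℕ) :
    diffPartGroup EG G E M p q (totalAntisym c) = antisym p q (diffPartGroup EG G E M p q c) := by
  cases p with
  | zero => exact (map_zero (antisym 0 q)).symm
  | succ p => rw [diffPartGroup_succ, diffPartGroup_succ, totalAntisym_apply, hochschild_antisym]

theorem diffPartForm_totalAntisym (c : DiffCochains EG G E M) (p q : ℕ) :
    diffPartForm EG G E M p q (totalAntisym c) = antisym p q (diffPartForm EG G E M p q c) := by
  cases q with
  | zero => rw [diffPartForm_zero, diffPartForm_zero, map_zero]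
  | succ q =>
    rw [diffPartForm_succ, diffPartForm_succ, totalAntisym_apply, map_smul, antisym, antisym,
      dFamily_chainOp]

theorem diffD_totalAntisym (c : DiffCochains EG G E M) :
    diffD EG G E M (totalAntisym c) = totalAntisym (diffD EG G E M c) := by
  funext p q
  rw [totalAntisym_apply, diffD_apply, diffD_apply, map_add, diffPartGroup_totalAntisym,
    diffPartForm_totalAntisym]

/-- The homotopy lowers `p` by one and commutes with `d`, so it anticommutes with `(-1)^p d`; only
the homotopy formula for `b` survives. -/
theorem diffD_totalHomotopy (c : DiffCochains EG G E M) :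
    diffD EG G E M (totalHomotopy c) + totalHomotopy (diffD EG G E M c) = c - totalAntisym c := by
  funext p q
  have h1 : diffPartGroup EG G E M p q (totalHomotopy c) +
      antisymHomotopy p q (diffPartGroup EG G E M (p + 1) q c) = c p q - antisym p q (c p q) := by
    cases p with
    | zero =>
      rw [diffPartGroup_succ, antisymHomotopy_hochschild_zero]
      exact zero_add _
    | succ p =>
      rw [diffPartGroup_succ, diffPartGroup_succ, totalHomotopy_apply]
      exact (add_comm _ _).trans (antisymHomotopy_hochschild p q _)
  have h2 : diffPartForm EG G E M p q (totalHomotopy c) +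
      antisymHomotopy p q (diffPartForm EG G E M (p + 1) q c) = 0 := by
    cases q with
    | zero => rw [diffPartForm_zero, diffPartForm_zero, map_zero, add_zero]
    | succ q =>
      rw [diffPartForm_succ, diffPartForm_succ, totalHomotopy_apply, map_smul, antisymHomotopy,
        antisymHomotopy, dFamily_chainOp, pow_succ, mul_neg_one, neg_smul, add_neg_cancel]
  change diffD EG G E M (totalHomotopy c) p q + totalHomotopy (diffD EG G E M c) p q =
    c p q - antisym p q (c p q)
  rw [totalHomotopy_apply, diffD_apply, diffD_apply, map_add, add_add_add_comm, h1, h2, add_zero]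

/-- Antisymmetrization into column `0` is a cochain map to the total complex: the only part of the
differential leaving that column is `B`, which vanishes on antisymmetric cochains. -/
theorem hcD_columnZero_totalAntisym (c : DiffCochains EG G E M) :
    hcD EG G E M (columnZero (totalAntisym c)) =
      columnZero (totalAntisym (diffD EG G E M c)) := by
  funext p q k
  cases k with
  | zero =>
    rw [← diffD_totalAntisym, ← projI_columnZero (totalAntisym c), diffD_projI]
    rfl
  | succ k =>
    have h1 : hcHochschild EG G E M (columnZero (totalAntisym c)) p q (k + 1) = 0 := by
      cases p with
      | zero => rfl
      | succ p => exact map_zero (hochschild p q)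
    have h2 : hcForm EG G E M (columnZero (totalAntisym c)) p q (k + 1) = 0 := by
      cases q with
      | zero => exact hcForm_zero _ p _
      | succ q =>
        rw [hcForm_succ]
        exact (congrArg _ (map_zero (dFamily q))).trans (smul_zero _)
    have h3 : hcConnes EG G E M (columnZero (totalAntisym c)) p q (k + 1) = 0 := by
      rw [hcConnes_succ]
      cases k with
      | zero => exact connesB_antisym p q _
      | succ k => exact map_zero (connesB p q)
    rw [hcD_apply, Pi.add_apply, Pi.add_apply, Pi.add_apply, Pi.add_apply, Pi.add_apply,
      Pi.add_apply, h1, h2, h3, add_zero, add_zero]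
    rfl

/-- The lift is the antisymmetrized cocycle in column `0`; the homotopy shows that its class
projects to the given one. Through this lemma the connecting map of the sequence of columns
vanishes. -/
theorem exists_hcCocycle_lift {m : ℕ} {c : DiffCochains EG G E M}
    (hc : c ∈ diffCocycles EG G E M m) : ∃ e ∈ hcCocycles EG G E M m,
      projI EG G E M e - c ∈ diffCoboundaries EG G E M m := by
  obtain ⟨hm, hD⟩ := hc
  rw [SetLike.mem_coe, LinearMap.mem_ker] at hD
  refine ⟨columnZero (totalAntisym c), ⟨columnZero_mem_cochains fun p q h ↦ ?_, ?_⟩, ?_⟩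
  · rw [totalAntisym_apply, hm p q h, map_zero]
  · rw [SetLike.mem_coe, LinearMap.mem_ker, hcD_columnZero_totalAntisym, hD, map_zero]
    funext p q k
    cases k <;> rfl
  · have h := diffD_totalHomotopy c
    rw [hD, map_zero, add_zero] at h
    rw [projI_columnZero, ← neg_sub, ← h]
    refine neg_mem ?_
    -- In degree `0` the space of coboundaries is `⊥` by definition, so the homotopy term itself has
    -- to vanish; it does, as it reads components of positive degree.
    cases m with
    | zero =>
      have h0 : totalHomotopy c = 0 := by
        funext p q
        rw [totalHomotopy_apply, hm (p + 1) q (by omega), map_zero]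
        rfl
      rw [h0, map_zero]
      exact zero_mem _
    | succ m =>
      refine ⟨_, fun p q h ↦ ?_, rfl⟩
      rw [totalHomotopy_apply, hm (p + 1) q (by omega), map_zero]

theorem exists_eq_shiftS {c : Bicomplex EG G E M} (hc : projI EG G E M c = 0) :
    c = shiftS EG G E M (fun p q k ↦ c p q (k + 1)) := by
  funext p q k
  cases k with
  | zero => exact congrFun (congrFun hc p) q
  | succ k => rfl

theorem shiftS_injective : Function.Injective (shiftS EG G E M) := fun c e h ↦ by
  funext p q k
  exact congrFun (congrFun (congrFun h p) q) (k + 1)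

theorem projI_shiftS (c : Bicomplex EG G E M) : projI EG G E M (shiftS EG G E M c) = 0 := rfl

/-- Injectivity of `S` on cohomology. If `S c = D e`, then `e` projects to a cocycle of column `0`;
correcting `e` by a lift of that cocycle and by a coboundary makes the projection zero without
changing `D e`. The corrected cochain is then itself a shift, of a primitive of `c`. -/
theorem mem_hcCoboundaries_of_shiftS {m : ℕ} {c : Bicomplex EG G E M}
    (h : shiftS EG G E M c ∈ hcCoboundaries EG G E M (m + 2)) :
    c ∈ hcCoboundaries EG G E M m := by
  obtain ⟨e, he, hec⟩ := h
  obtain ⟨e', he', f, hf, hfe⟩ := exists_hcCocycle_lift (m := m + 1) (c := projI EG G E M e)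
    ⟨projI_mem_cochains EG G E M he, by
      rw [SetLike.mem_coe, LinearMap.mem_ker, diffD_projI, hec, projI_shiftS]⟩
  set r := e - e' + hcD EG G E M (columnZero f) with hr
  have hrm : r ∈ hcCochains EG G E M (m + 1) :=
    add_mem (sub_mem he he'.1) (hcD_mem_cochains (columnZero_mem_cochains hf))
  have hr0 : projI EG G E M r = 0 := by
    rw [hr, map_add, map_sub, ← diffD_projI, projI_columnZero, hfe, ← neg_sub, neg_add_cancel]
  have hrD : hcD EG G E M r = shiftS EG G E M c := by
    rw [hr, map_add, map_sub, hcD_hcD, LinearMap.mem_ker.1 he'.2, hec, sub_zero, add_zero]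
  rw [exists_eq_shiftS hr0, hcD_shiftS] at hrD
  rw [← shiftS_injective hrD]
  -- For `m = 0` the primitive would have degree `-1`: the shifted part of `r` is zero, and so `c`
  -- is zero.
  cases m with
  | zero =>
    have h0 : (fun p q k ↦ r p q (k + 1)) = (0 : Bicomplex EG G E M) := by
      funext p q k
      exact hrm p q (k + 1) (by omega)
    rw [h0, map_zero]
    exact zero_mem _
  | succ m => exact ⟨_, fun p q k h ↦ hrm p q (k + 1) (by omega), rfl⟩

/-- Exactness at the middle term: subtract the differential of a primitive placed in column `0`, and
what remains lies in the columns `k ≥ 1`. The degree condition on `e` is written without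
subtraction, so that it also forces `e = 0` when `m < 2`. -/
theorem exists_sub_shiftS_mem_hcCoboundaries {m : ℕ} {c : Bicomplex EG G E M}
    (hc : c ∈ hcCocycles EG G E M m)
    (h : projI EG G E M c ∈ diffCoboundaries EG G E M m) : ∃ e : Bicomplex EG G E M,
      (∀ p q k, p + q + 2 * k + 2 ≠ m → e p q k = 0) ∧ hcD EG G E M e = 0 ∧
        c - shiftS EG G E M e ∈ hcCoboundaries EG G E M m := by
  obtain ⟨r, hr, hcr⟩ : ∃ r ∈ hcCoboundaries EG G E M m,
      projI EG G E M r = projI EG G E M c := by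
    cases m with
    | zero =>
      refine ⟨0, zero_mem _, ?_⟩
      rw [diffCoboundaries, Submodule.mem_bot] at h
      rw [h, map_zero]
    | succ m =>
      obtain ⟨f, hf, hfc⟩ := h
      refine ⟨_, ⟨columnZero f, columnZero_mem_cochains hf, rfl⟩, ?_⟩
      rw [← diffD_projI, projI_columnZero, hfc]
  have hrm : r ∈ hcCochains EG G E M m ∧ hcD EG G E M r = 0 := by
    cases m with
    | zero =>
      rw [hcCoboundaries, Submodule.mem_bot] at hr
      rw [hr]
      exact ⟨zero_mem _, map_zero _⟩
    | succ m =>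
      obtain ⟨f, hf, rfl⟩ := hr
      exact ⟨hcD_mem_cochains hf, hcD_hcD f⟩
  have h0 := exists_eq_shiftS (c := c - r) (by rw [map_sub, hcr, sub_self])
  refine ⟨fun p q k ↦ (c - r) p q (k + 1), fun p q k h ↦
    (sub_mem hc.1 hrm.1 : c - r ∈ hcCochains EG G E M m) p q (k + 1) (by omega), ?_, ?_⟩
  · refine shiftS_injective ?_
    rw [← hcD_shiftS, ← h0, map_zero, map_sub, hrm.2, LinearMap.mem_ker.1 hc.2, sub_zero]
  · rw [← h0, sub_sub_cancel]
    exact hr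

end TotalComplex

/-! ### Splitting of short exact sequences of vector spaces -/

theorem exists_splitting_of_shortExact {K U V W : Type*} [Field K] [AddCommGroup U] [Module K U]
    [AddCommGroup V] [Module K V] [AddCommGroup W] [Module K W] (f : V →ₗ[K] W) (g : U →ₗ[K] V)
    (hf : Function.Surjective f) (hg : Function.Injective g) (hfg : ∀ x, f (g x) = 0)
    (hex : ∀ y, f y = 0 → ∃ x, g x = y) :
    ∃ e : V ≃ₗ[K] W × U, (∀ y, (e y).1 = f y) ∧ ∀ x, (e (g x)).2 = x := by
  obtain ⟨s, hs⟩ := f.exists_rightInverse_of_surjective (LinearMap.range_eq_top.2 hf)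
  have hs' : ∀ a, f (s a) = a := fun a ↦ DFunLike.congr_fun hs a
  have hI : ∀ z, f (s.coprod g z) = z.1 := fun z ↦ by
    rw [LinearMap.coprod_apply, map_add, hs', hfg, add_zero]
  -- A linear section `s` of `f`, which exists over a field, and `g` together identify `W × U` with
  -- `V`; the inverse of this map is the required splitting.
  have hb : Function.Bijective (s.coprod g) := by
    constructor
    · rw [← LinearMap.ker_eq_bot, LinearMap.ker_eq_bot']
      rintro ⟨a, x⟩ hz
      have ha : 0 = a := by rw [← show _ = a from hI (a, x), hz, map_zero]
      subst ha
      rw [LinearMap.coprod_apply, map_zero, zero_add] at hz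
      exact Prod.ext rfl (hg (hz.trans (map_zero _).symm))
    · intro y
      obtain ⟨x, hx⟩ := hex (y - s (f y)) (by rw [map_sub, hs', sub_self])
      exact ⟨(f y, x), by rw [LinearMap.coprod_apply, hx, add_sub_cancel]⟩
  let e := LinearEquiv.ofBijective _ hb
  refine ⟨e.symm, fun y ↦ ?_, fun x ↦ ?_⟩
  · rw [← hI]
    exact congrArg _ (e.apply_symm_apply y)
  · have h : g x = e (0, x) := by
      change _ = s.coprod g (0, x)
      rw [LinearMap.coprod_apply, map_zero, zero_add]
    rw [h, e.symm_apply_apply]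

/-! ### Direct sums over the degrees `j + 2k = m` -/

section DegreeSums

theorem add_two_mul_succ {j k m : ℕ} (h : j + 2 * k = m) : j + 2 * (k + 1) = m + 2 := by omega

variable (H : ℕ → Type*) [∀ j, AddCommGroup (H j)] [∀ j, Module ℝ (H j)]

/-- The sum of the spaces `H j` over all `j`, `k` with `j + 2 k = m`. -/
abbrev EvenSum (m : ℕ) : Type _ :=
  DirectSum {i : ℕ × ℕ // i.1 + 2 * i.2 = m} (fun i ↦ H i.1.1)

instance finite_degrees (m : ℕ) : Finite {i : ℕ × ℕ // i.1 + 2 * i.2 = m} :=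
  Finite.of_injective (β := Fin (m + 1) × Fin (m + 1))
    (fun i ↦ (⟨i.1.1, by have := i.2; omega⟩, ⟨i.1.2, by have := i.2; omega⟩)) fun i j h ↦ by
      simp only [Prod.mk.injEq, Fin.mk.injEq] at h
      exact Subtype.ext (Prod.ext h.1 h.2)

/-- Splitting off the summand with index `k = 0`. -/
def EvenSum.split (m : ℕ) : EvenSum H (m + 2) →ₗ[ℝ] H (m + 2) × EvenSum H m :=
  letI := Fintype.ofFinite {i : ℕ × ℕ // i.1 + 2 * i.2 = m}
  LinearMap.prod (DirectSum.component ℝ {i : ℕ × ℕ // i.1 + 2 * i.2 = m + 2} (fun i ↦ H i.1.1) ⟨(m + 2, 0), rfl⟩)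
    ((DirectSum.linearEquivFunOnFintype ℝ _ _).symm.toLinearMap ∘ₗ
      LinearMap.pi fun i : {i : ℕ × ℕ // i.1 + 2 * i.2 = m} ↦
        DirectSum.component ℝ {i : ℕ × ℕ // i.1 + 2 * i.2 = m + 2} (fun i ↦ H i.1.1)
          ⟨(i.1.1, i.1.2 + 1), add_two_mul_succ i.2⟩)

theorem EvenSum.split_snd (m : ℕ) (y : EvenSum H (m + 2)) (j k : ℕ) (h : j + 2 * k = m) :
    (EvenSum.split H m y).2 ⟨(j, k), h⟩ = y ⟨(j, k + 1), add_two_mul_succ h⟩ := rfl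

/-- An index of total degree `m + 2` either has `k = 0`, and then `j = m + 2`, or is obtained from
an index of total degree `m` by raising `k`. -/
theorem EvenSum.split_bijective (m : ℕ) : Function.Bijective (EvenSum.split H m) := by
  constructor
  · intro y z hyz
    refine DFinsupp.ext fun i ↦ ?_
    obtain ⟨⟨j, k⟩, h⟩ := i
    cases k with
    | zero =>
      obtain rfl : j = m + 2 := h
      exact congrArg Prod.fst hyz
    | succ k =>
      have h' : j + 2 * k = m := by dsimp only at h; omega
      exact DFunLike.congr_fun (congrArg Prod.snd hyz) ⟨(j, k), h'⟩
  · intro x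
    let _ := Fintype.ofFinite {i : ℕ × ℕ // i.1 + 2 * i.2 = m + 2}
    -- For `k = 0` the equality `j = m + 2` is only propositional, hence the cast. It reduces away
    -- at the index `(m + 2, 0)` used by `split`.
    let f : ∀ i : {i : ℕ × ℕ // i.1 + 2 * i.2 = m + 2}, H i.1.1
      | ⟨(j, 0), h⟩ => cast (congrArg H (show m + 2 = j from h.symm)) x.1
      | ⟨(j, k + 1), h⟩ => x.2 ⟨(j, k), by dsimp only at h ⊢; omega⟩
    refine ⟨(DirectSum.linearEquivFunOnFintype ℝ _ _).symm f, Prod.ext rfl ?_⟩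
    exact DFinsupp.ext fun i ↦ rfl

/-- For `m < 2` the only index is `(m, 0)`. -/
theorem EvenSum.component_bijective {m : ℕ} (hm : m < 2) :
    Function.Bijective (DirectSum.component ℝ {i : ℕ × ℕ // i.1 + 2 * i.2 = m}
      (fun i ↦ H i.1.1) ⟨(m, 0), rfl⟩) := by
  constructor
  · intro y z hyz
    refine DFinsupp.ext fun i ↦ ?_
    obtain ⟨⟨j, k⟩, h⟩ := i
    obtain rfl : k = 0 := by dsimp only at h; omega
    obtain rfl : j = m := h
    exact hyz
  · intro x
    exact ⟨DirectSum.lof ℝ _ (fun i : {i : ℕ × ℕ // i.1 + 2 * i.2 = m} ↦ H i.1.1) ⟨(m, 0), rfl⟩ x,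
      DirectSum.component.lof_self ℝ _ _⟩

end DegreeSums

/-! ### The sequence of `S` and `I`, and the decomposition of cyclic cohomology -/

section Decomposition
variable (EG : Type*) [NormedAddCommGroup EG] [NormedSpace ℝ EG] (G : Type*) [TopologicalSpace G]
  [ChartedSpace EG G] [Group G] [LieGroup 𝓘(ℝ, EG) ∞ G]
  (E : Type*) [NormedAddCommGroup E] [NormedSpace ℝ E] (M : Type*) [TopologicalSpace M]
  [ChartedSpace E M] [IsManifold 𝓘(ℝ, E) ∞ M] [MulAction G M]
  [ContMDiffSMul 𝓘(ℝ, EG) 𝓘(ℝ, E) ∞ G M]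

theorem HC.I_mk_eq_zero_iff {m : ℕ} (c : hcCocycles EG G E M m) :
    HC.I EG G E M m (Submodule.Quotient.mk c) = 0 ↔
      projI EG G E M c ∈ diffCoboundaries EG G E M m := by
  let e : diffCocycles EG G E M m := ⟨projI EG G E M c, projI_mem_cocycles EG G E M c.2⟩
  exact Submodule.Quotient.mk_eq_zero (x := e)
    ((diffCoboundaries EG G E M m).submoduleOf (diffCocycles EG G E M m))

theorem HC.S_mk_eq_zero_iff {m : ℕ} (c : hcCocycles EG G E M m) :
    HC.S EG G E M m (Submodule.Quotient.mk c) = 0 ↔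
      shiftS EG G E M c ∈ hcCoboundaries EG G E M (m + 2) := by
  let e : hcCocycles EG G E M (m + 2) := ⟨shiftS EG G E M c, shiftS_mem_cocycles EG G E M c.2⟩
  exact Submodule.Quotient.mk_eq_zero (x := e)
    ((hcCoboundaries EG G E M (m + 2)).submoduleOf (hcCocycles EG G E M (m + 2)))

theorem HC.mk_eq_zero_iff {m : ℕ} (c : hcCocycles EG G E M m) :
    (Submodule.Quotient.mk c : HC EG G E M m) = 0 ↔
      (c : Bicomplex EG G E M) ∈ hcCoboundaries EG G E M m :=
  Submodule.Quotient.mk_eq_zero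
    ((hcCoboundaries EG G E M m).submoduleOf (hcCocycles EG G E M m))

theorem HC.I_surjective (m : ℕ) : Function.Surjective (HC.I EG G E M m) := by
  intro x
  obtain ⟨c, rfl⟩ := Submodule.Quotient.mk_surjective _ x
  obtain ⟨e, he, h⟩ := exists_hcCocycle_lift c.2
  exact ⟨Submodule.Quotient.mk ⟨e, he⟩, (Submodule.Quotient.eq
    ((diffCoboundaries EG G E M m).submoduleOf (diffCocycles EG G E M m))).2 h⟩

theorem HC.S_injective (m : ℕ) : Function.Injective (HC.S EG G E M m) := by
  rw [← LinearMap.ker_eq_bot, LinearMap.ker_eq_bot']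
  intro x hx
  obtain ⟨c, rfl⟩ := Submodule.Quotient.mk_surjective _ x
  rw [HC.S_mk_eq_zero_iff] at hx
  exact (HC.mk_eq_zero_iff EG G E M c).2 (mem_hcCoboundaries_of_shiftS hx)

theorem HC.I_S (m : ℕ) (x : HC EG G E M m) : HC.I EG G E M (m + 2) (HC.S EG G E M m x) = 0 := by
  obtain ⟨c, rfl⟩ := Submodule.Quotient.mk_surjective _ x
  exact (HC.I_mk_eq_zero_iff EG G E M ⟨_, shiftS_mem_cocycles EG G E M c.2⟩).2
    (zero_mem (diffCoboundaries EG G E M (m + 2)))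

theorem HC.exists_S_eq (m : ℕ) (x : HC EG G E M (m + 2)) (hx : HC.I EG G E M (m + 2) x = 0) :
    ∃ y, HC.S EG G E M m y = x := by
  obtain ⟨c, rfl⟩ := Submodule.Quotient.mk_surjective _ x
  rw [HC.I_mk_eq_zero_iff] at hx
  obtain ⟨e, he, heD, h⟩ := exists_sub_shiftS_mem_hcCoboundaries c.2 hx
  refine ⟨Submodule.Quotient.mk ⟨e, fun p q k h ↦ he p q k (by omega), heD⟩, Eq.symm ?_⟩
  exact (Submodule.Quotient.eq
    ((hcCoboundaries EG G E M (m + 2)).submoduleOf (hcCocycles EG G E M (m + 2)))).2 h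

/-- In degrees below `2` only column `0` contributes, so the shifted remainder given by exactness is
zero. -/
theorem HC.I_bijective {m : ℕ} (hm : m < 2) : Function.Bijective (HC.I EG G E M m) := by
  refine ⟨?_, HC.I_surjective EG G E M m⟩
  rw [← LinearMap.ker_eq_bot, LinearMap.ker_eq_bot']
  intro x hx
  obtain ⟨c, rfl⟩ := Submodule.Quotient.mk_surjective _ x
  rw [HC.I_mk_eq_zero_iff] at hx
  obtain ⟨e, he, -, h⟩ := exists_sub_shiftS_mem_hcCoboundaries c.2 hx
  have h0 : e = 0 := by
    funext p q k
    exact he p q k (by omega)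
  rw [h0, map_zero, sub_zero] at h
  exact (HC.mk_eq_zero_iff EG G E M c).2 h

theorem HC.exists_splitting (m : ℕ) :
    ∃ e : HC EG G E M (m + 2) ≃ₗ[ℝ] HDiff EG G E M (m + 2) × HC EG G E M m,
      (∀ x, (e x).1 = HC.I EG G E M (m + 2) x) ∧ ∀ x, (e (HC.S EG G E M m x)).2 = x :=
  exists_splitting_of_shortExact _ _ (HC.I_surjective EG G E M (m + 2)) (HC.S_injective EG G E M m)
    (HC.I_S EG G E M m) (HC.exists_S_eq EG G E M m)

/-- The decomposition of cyclic cohomology into differentiable cohomology groups. -/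
def HC.decomposition : (m : ℕ) → HC EG G E M m ≃ₗ[ℝ] EvenSum (HDiff EG G E M) m
  | 0 => (LinearEquiv.ofBijective _ (HC.I_bijective EG G E M zero_lt_two)).trans
      (LinearEquiv.ofBijective _ (EvenSum.component_bijective (HDiff EG G E M) zero_lt_two)).symm
  | 1 => (LinearEquiv.ofBijective _ (HC.I_bijective EG G E M one_lt_two)).trans
      (LinearEquiv.ofBijective _ (EvenSum.component_bijective (HDiff EG G E M) one_lt_two)).symm
  | m + 2 => ((HC.exists_splitting EG G E M m).choose.trans
      ((LinearEquiv.refl ℝ _).prodCongr (HC.decomposition m))).trans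
      (LinearEquiv.ofBijective _ (EvenSum.split_bijective (HDiff EG G E M) m)).symm

/-- The recursion step seen through `split`. The two required properties of the decomposition follow
from it and from the two properties of the chosen splitting, one for each component. -/
theorem HC.split_decomposition (m : ℕ) (x : HC EG G E M (m + 2)) :
    EvenSum.split _ m (HC.decomposition EG G E M (m + 2) x) =
      (((HC.exists_splitting EG G E M m).choose x).1,
        HC.decomposition EG G E M m ((HC.exists_splitting EG G E M m).choose x).2) := by
  rw [HC.decomposition]
  exact LinearEquiv.apply_symm_apply
    (LinearEquiv.ofBijective _ (EvenSum.split_bijective (HDiff EG G E M) m)) _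

theorem HC.decomposition_zero (m : ℕ) (x : HC EG G E M m) :
    HC.decomposition EG G E M m x ⟨(m, 0), rfl⟩ = HC.I EG G E M m x := by
  match m with
  | 0 =>
    exact LinearEquiv.apply_symm_apply (LinearEquiv.ofBijective _
      (EvenSum.component_bijective (HDiff EG G E M) zero_lt_two)) _
  | 1 =>
    exact LinearEquiv.apply_symm_apply (LinearEquiv.ofBijective _
      (EvenSum.component_bijective (HDiff EG G E M) one_lt_two)) _
  | m + 2 =>
    rw [← (HC.exists_splitting EG G E M m).choose_spec.1 x]
    exact congrArg Prod.fst (HC.split_decomposition EG G E M m x)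

theorem HC.decomposition_S (m : ℕ) (x : HC EG G E M m) (j k : ℕ) (h : j + 2 * k = m) :
    HC.decomposition EG G E M (m + 2) (HC.S EG G E M m x) ⟨(j, k + 1), add_two_mul_succ h⟩ =
      HC.decomposition EG G E M m x ⟨(j, k), h⟩ := by
  rw [← EvenSum.split_snd (HDiff EG G E M) m _ j k h, HC.split_decomposition,
    (HC.exists_splitting EG G E M m).choose_spec.2 x]

end Decomposition

end
end HopfCyclic

theorem mainTheorem2
    {EG : Type*} [NormedAddCommGroup EG] [NormedSpace ℝ EG] [FiniteDimensional ℝ EG]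
    {G : Type*} [TopologicalSpace G] [ChartedSpace EG G] [Group G] [LieGroup 𝓘(ℝ, EG) ∞ G]
    {E : Type*} [NormedAddCommGroup E] [NormedSpace ℝ E] [FiniteDimensional ℝ E]
    {M : Type*} [TopologicalSpace M] [ChartedSpace E M] [IsManifold 𝓘(ℝ, E) ∞ M]
    [MulAction G M] [ContMDiffSMul 𝓘(ℝ, EG) 𝓘(ℝ, E) ∞ G M] :
    ∃ Φ : ∀ m : ℕ, HopfCyclic.HC EG G E M m ≃ₗ[ℝ]
        DirectSum {i : ℕ × ℕ // i.1 + 2 * i.2 = m} (fun i ↦ HopfCyclic.HDiff EG G E M i.1.1),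
      (∀ (m : ℕ) (x : HopfCyclic.HC EG G E M m),
        Φ m x ⟨(m, 0), rfl⟩ = HopfCyclic.HC.I EG G E M m x) ∧
      (∀ (m : ℕ) (x : HopfCyclic.HC EG G E M m) (j k : ℕ) (h : j + 2 * k = m),
        Φ (m + 2) (HopfCyclic.HC.S EG G E M m x) ⟨(j, k + 1), by dsimp only; omega⟩ =
          Φ m x ⟨(j, k), h⟩) := by
  exact ⟨HopfCyclic.HC.decomposition EG G E M, HopfCyclic.HC.decomposition_zero EG G E M,
    HopfCyclic.HC.decomposition_S EG G E M⟩
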